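/- Fix an integer $d \ge 1$ and equip the cube $[0,1]^d$ with the $\ell_\infty$ distance. Consider the $2n$ literals $x_1,\dots,x_n,\overline x_1,\dots,\overline x_n$ on $n$ Boolean variables, and the following two random 2-SAT formulae. - $F_2(n,\gamma)$, for a constant $\gamma \ge 0$: place $2n$ independent uniform points in $[0,1]^d$, one for each literal; for any two distinct literals whose points are at distance at most $\gamma n^{-1/d}$, include the 2-clause formed by these two literals. - $F_2(n,\mu)$, for a constant $\mu \ge 0$: for each of the $2n$ literals draw a Poisson point process of intensity $\mu$ on $[0,1]^d$, these processes being independent; for any two distinct literals such that some point of the first and some point of the second are at distance at most $n^{-1/d}$, include the 2-clause formed by these two literals. An event depending on $n$ holds whp if its probability tends to $1$ as $n \to \infty$, with $d,\gamma,\mu$ fixed. Then for every $\epsilon > 0$: 1. If $\gamma < 2^{-(1+1/d)} - \epsilon$, then whp $F_2(n,\gamma)$ is satisfiable. If $\gamma > 2^{-(1+1/d)} + \epsilon$, then whp $F_2(n,\gamma)$ is not satisfiable. 2. If $\mu < 2^{-(d+1)/2} - \epsilon$, then whp $F_2(n,\mu)$ is satisfiable. If $\mu > 2^{-(d+1)/2}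 + \epsilon$, then whp $F_2(n,\mu)$ is not satisfiable. -/

import Mathlib

open MeasureTheory ProbabilityTheory Filter Topology
open scoped NNReal ENNReal

namespace Geom2SAT

/-- The `2n` literals on the variables `x_0, …, x_{n-1}`: `(i, true)` is the literal `x_i` and
`(i, false)` is its negation. -/
abbrev Literal (n : ℕ) : Type := Fin n × Bool

/-- A (disjunctive) clause is a finite set of literals. -/
abbrev Clause (n : ℕ) : Type := Finset (Literal n)

/-- A formula (in conjunctive normal form) is a set of clauses. -/
abbrev Formula (n : ℕ) : Type := Set (Clause n)

/-- The formula `F` is satisfiable: some truth assignment makes at least one literal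
of every clause true. -/
def Formula.IsSat {n : ℕ} (F : Formula n) : Prop :=
  ∃ v : Fin n → Bool, ∀ C ∈ F, ∃ l ∈ C, v l.1 = l.2

/-- The cube `[0,1]^d`. Its distance, as that of every finite product in Mathlib, is the
`ℓ^∞` distance, and its `volume` is Lebesgue measure (a probability measure). -/
abbrev Cube (d : ℕ) : Type := Fin d → unitInterval

/-- The geometric 2-SAT formula of a set of positioned literals: `pts l` is the set of points of
the cube that carry the label `l`. For any two distinct literals that label two points at
`ℓ^∞` distance at most `r`, the 2-clause formed by these literals is present. -/
def geomFormula {d n : ℕ} (r : ℝ) (pts : Literal n → Set (Cube d)) : Formula n :=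
  {C | ∃ l l' : Literal n, l ≠ l' ∧ C = {l, l'} ∧ ∃ x ∈ pts l, ∃ y ∈ pts l', dist x y ≤ r}

/-- The radius scale `n^{-1/d}`. -/
noncomputable def scale (d n : ℕ) : ℝ := (n : ℝ) ^ (-(1 / (d : ℝ)))

/-! ### The model with one uniform point for each literal -/

/-- The law of `2n` independent uniform points of the cube, one for each literal. -/
noncomputable def uniformLaw (d n : ℕ) : Measure (Literal n → Cube d) :=
  Measure.pi fun _ => (volume : Measure (Cube d))

/-- The formula `F_2(n, γ)` as a function of the positions of the `2n` literals; the radius is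
`γ n^{-1/d}`. -/
noncomputable def uniformFormula {d n : ℕ} (γ : ℝ) (X : Literal n → Cube d) : Formula n :=
  geomFormula (γ * scale d n) fun l => {X l}

/-! ### The Poisson model -/

/-- The sample space of a Poisson point process on the cube: the number of points and a sequence
of potential points. -/
abbrev PoissonSample (d : ℕ) : Type := ℕ × (ℕ → Cube d)

/-- The points of the process: the first `ω.1` terms of the sequence `ω.2`. -/
def PoissonSample.points {d : ℕ} (ω : PoissonSample d) : Set (Cube d) :=
  {x | ∃ j < ω.1, ω.2 j = x}

/-- The law of the Poisson point process of intensity `μ` on the cube (with respect to Lebesgue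
measure, which has total mass one): a Poisson(`μ`) number of points which, independently of this
number, are independent and uniform. -/
noncomputable def poissonProcessLaw (d : ℕ) (μ : ℝ≥0) : Measure (PoissonSample d) :=
  (poissonMeasure μ).prod (Measure.infinitePi fun _ : ℕ => (volume : Measure (Cube d)))

/-- The law of `2n` independent Poisson point processes of intensity `μ` on the cube, one for
each literal. -/
noncomputable def poissonLaw (d n : ℕ) (μ : ℝ≥0) : Measure (Literal n → PoissonSample d) :=
  Measure.pi fun _ => poissonProcessLaw d μ

/-- The formula `F_2(n, μ)` as a function of the realisations of the `2n` processes; the radius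
is `n^{-1/d}`. -/
noncomputable def poissonFormula {d n : ℕ} (ω : Literal n → PoissonSample d) : Formula n :=
  geomFormula (scale d n) fun l => (ω l).points

end Geom2SAT

/-!
Both formulae are instances of one model. Independent points `ω l` with a common law `ν` are
attached to the `2n` literals, and a symmetric relation `E` between points decides which clauses
are present (`relFormula`). All that matters is the probability `p` that two independent points are
related, and a bound `q` for the probability that a random point is related to a given one
(`EdgeRel`). A literal has about `2np` implications, and the formula is satisfiable with high
probability if `2np` stays below one (`tendsto_not_isSat_zero`) and unsatisfiable with high
probability if it stays above one (`tendsto_isSat_zero`). Clauses are correlated only through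
shared literals, so that a matching of `k` literal pairs is present with probability `p ^ k`, and
each further edge with a new end costs at most `q`. The implication `l → l'` is the pair
`{¬l, l'}`; the pairs of an implication path through distinct variables therefore form a matching.

Below the threshold, an unsatisfiable formula contains a bicycle (`exists_bicycle`): an implication
path through distinct variables, closed up at both ends. The bicycles with `k + 1` variables have
expected number at most of the order `n k² q² (2np)^k`, and the sum over `k` vanishes when
`n q² → 0`.

Above the threshold, a snake `¬c → ⋯ → c → ⋯ → ¬c` forces unsatisfiability
(`not_isSat_of_snake`), and the second moment method produces a snake of logarithmic length
(`real_isSat_le`). The paths `y₀ — c — ¬y_k` and `z₀ — ¬c — ¬z_k` of two edges have probability at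
least `p²` each by Jensen's inequality, which gives the first moment. For the second moment, only
snakes without other edges between their literals are counted (`goodEvent`); an extra edge has
a probability of order `q`, so half of the first moment is kept (`le_real_induced_snake`). A second
snake that meets such a snake must follow the edges of the first one whenever it moves between its
variables, and has there at most `6 ^ 6` patterns to choose from (`exists_select`). The weights of
these paths are summed by a recursion along the path (`pathSum_le`), where each return to the first
snake costs a factor of order `k / n`. Snakes with no common variable are independent.

For uniform points, `p ~ q = (2γ) ^ d / n`. For the Poisson model a point is a whole cluster, that
is, a realisation of the process. Two clusters of sizes `a` and `b` are related with
probability close to `a b 2 ^ d / n`, by the union bound and a Bonferroni inequality, whence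
`p ~ μ ^ 2 * 2 ^ d / n`. A bound `q` is available only for clusters of bounded size
(`clusterRel`): clusters larger than a constant are discarded above the threshold, and below it no
cluster exceeds a logarithmic size with high probability.
-/

namespace Geom2SAT

/-! ### Implication walks, bicycles and snakes -/

/-- The complementary literal. -/
def Literal.neg {n : ℕ} (l : Literal n) : Literal n := (l.1, !l.2)

@[simp] lemma Literal.neg_neg {n : ℕ} (l : Literal n) : l.neg.neg = l := by
  simp [Literal.neg]

@[simp] lemma Literal.neg_fst {n : ℕ} (l : Literal n) : l.neg.1 = l.1 := rfl

lemma Literal.neg_ne {n : ℕ} (l : Literal n) : l.neg ≠ l := by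
  intro h
  have := congrArg Prod.snd h
  simp [Literal.neg] at this

lemma Literal.eq_or_eq_neg {n : ℕ} {l l' : Literal n} (h : l.1 = l'.1) :
    l' = l ∨ l' = l.neg := by
  obtain ⟨i, b⟩ := l
  obtain ⟨j, c⟩ := l'
  simp only at h
  subst h
  cases b <;> cases c <;> simp [Literal.neg]

lemma Literal.ne_of_fst_ne {n : ℕ} {l l' : Literal n} (h : l.1 ≠ l'.1) : l ≠ l' :=
  fun e => h (congrArg Prod.fst e)

/-- The 2-SAT formula whose clauses are the pairs of distinct literals related by `R`. -/
def relFormula {n : ℕ} (R : Literal n → Literal n → Prop) : Formula n :=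
  {C | ∃ l l' : Literal n, l ≠ l' ∧ C = {l, l'} ∧ R l l'}

/-- The implication `l → l'` that is equivalent to the clause `{¬l, l'}` of `relFormula R`. -/
def Step {n : ℕ} (R : Literal n → Literal n → Prop) (l l' : Literal n) : Prop :=
  l.neg ≠ l' ∧ R l.neg l'

lemma Step.contrapose {n : ℕ} {R : Literal n → Literal n → Prop} (hR : ∀ l l', R l l' → R l' l)
    {l l' : Literal n} (h : Step R l l') : Step R l'.neg l.neg := by
  refine ⟨?_, ?_⟩
  · simpa using h.1.symm
  · simpa using hR _ _ h.2

lemma reflTransGen_contrapose {n : ℕ} {R : Literal n → Literal n → Prop}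
    (hR : ∀ l l', R l l' → R l' l) {l l' : Literal n} (h : Relation.ReflTransGen (Step R) l l') :
    Relation.ReflTransGen (Step R) l'.neg l.neg := by
  induction h with
  | refl => exact .refl
  | tail _ hs ih => exact Relation.ReflTransGen.head (hs.contrapose hR) ih

lemma IsSat.step {n : ℕ} {R : Literal n → Literal n → Prop} {v : Fin n → Bool}
    (hv : ∀ C ∈ relFormula R, ∃ l ∈ C, v l.1 = l.2) {l l' : Literal n} (h : Step R l l')
    (hl : v l.1 = l.2) : v l'.1 = l'.2 := by
  obtain ⟨k, hk, hvk⟩ := hv {l.neg, l'} ⟨_, _, h.1, rfl, h.2⟩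
  simp only [Finset.mem_insert, Finset.mem_singleton] at hk
  rcases hk with rfl | rfl
  · simp [Literal.neg, hl] at hvk
  · exact hvk

/-- In an unsatisfiable formula some literal implies its complement and is implied by it.
A maximal consistent set of literals that is closed under implication omits such a literal. -/
lemma exists_contradictory {n : ℕ} {R : Literal n → Literal n → Prop}
    (hR : ∀ l l', R l l' → R l' l)
    (h : ¬ (relFormula R).IsSat) : ∃ x : Literal n,
      Relation.ReflTransGen (Step R) x x.neg ∧ Relation.ReflTransGen (Step R) x.neg x := by
  classical
  by_contra hno
  push Not at hno
  let good : Set (Set (Literal n)) :=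
    {S | (∀ l ∈ S, ∀ l', Step R l l' → l' ∈ S) ∧ ∀ l ∈ S, l.neg ∉ S}
  obtain ⟨S, hS, hmax⟩ := (Set.toFinite good).exists_maximal ⟨∅, by simp [good]⟩
  have hclosed : ∀ l ∈ S, ∀ l', Relation.ReflTransGen (Step R) l l' → l' ∈ S := by
    intro l hl l' hll'
    induction hll' with
    | refl => exact hl
    | tail _ hs ih => exact hS.1 _ ih _ hs
  have hfull : ∀ l : Literal n, l ∉ S → l.neg ∈ S := by
    -- otherwise `l` or its complement can be added, together with all that it implies
    have key : ∀ x : Literal n, x ∉ S → x.neg ∉ S → Relation.ReflTransGen (Step R) x x.neg := by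
      intro x hx hx'
      by_contra hr
      have hmem : S ∪ {y | Relation.ReflTransGen (Step R) x y} ∈ good := by
        refine ⟨?_, ?_⟩
        · rintro l (hl | hl) l' hs
          · exact Or.inl (hS.1 _ hl _ hs)
          · exact Or.inr (Relation.ReflTransGen.tail hl hs)
        · rintro l (hl | hl) (hl' | hl')
          · exact hS.2 _ hl hl'
          · have := reflTransGen_contrapose hR hl'
            rw [Literal.neg_neg] at this
            exact hx' (hclosed _ hl _ this)
          · have := reflTransGen_contrapose hR hl
            exact hx' (hclosed _ hl' _ this)
          · have := reflTransGen_contrapose hR hl'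
            rw [Literal.neg_neg] at this
            exact hr (Relation.ReflTransGen.trans hl this)
      have := hmax hmem (by intro y hy; exact Or.inl hy)
      exact hx (this (Or.inr .refl))
    intro x hx
    by_contra hx'
    refine hno x (key x hx hx') ?_
    have := key x.neg hx' (by simpa using hx)
    simpa using this
  apply h
  refine ⟨fun i => decide ((i, true) ∈ S), ?_⟩
  have hval : ∀ l ∈ S, decide ((l.1, true) ∈ S) = l.2 := by
    rintro ⟨i, b⟩ hl
    cases b
    · have := hS.2 _ hl
      simpa [Literal.neg] using this
    · simpa using hl
  rintro C ⟨l, l', hne, rfl, hr⟩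
  by_cases hl : l ∈ S
  · exact ⟨l, by simp, hval l hl⟩
  · refine ⟨l', by simp, hval l' (hS.1 _ (hfull l hl) _ ⟨by simpa using hne, by simpa using hr⟩)⟩

/-- An infinite implication walk from a literal to its complement. -/
lemma exists_infinite_walk {n : ℕ} {R : Literal n → Literal n → Prop} {x : Literal n}
    (h₁ : Relation.ReflTransGen (Step R) x x.neg) (h₂ : Relation.ReflTransGen (Step R) x.neg x) :
    ∃ L, ∃ f : ℕ → Literal n, (∀ i, Step R (f i) (f (i + 1))) ∧ f L = (f 0).neg := by
  classical
  have hsucc : ∀ y : {y // Relation.ReflTransGen (Step R) y x},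
      ∃ z : {z // Relation.ReflTransGen (Step R) z x}, Step R y.1 z.1 := by
    rintro ⟨y, hy⟩
    rcases hy.cases_head with rfl | ⟨z, hz, hzx⟩
    · rcases h₁.cases_head with h | ⟨z, hz, hzx⟩
      · exact absurd h.symm (Literal.neg_ne y)
      · exact ⟨⟨z, hzx.trans h₂⟩, hz⟩
    · exact ⟨⟨z, hzx⟩, hz⟩
  choose s hs using hsucc
  suffices ∀ y, Relation.ReflTransGen (Step R) y x.neg →
      ∃ f : ℕ → Literal n, f 0 = y ∧ (∀ i, Step R (f i) (f (i + 1))) ∧ ∃ L, f L = x.neg by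
    obtain ⟨f, h0, hf, L, hL⟩ := this x h₁
    exact ⟨L, f, hf, by rw [hL, h0]⟩
  intro y hy
  induction hy using Relation.ReflTransGen.head_induction_on with
  | refl =>
    refine ⟨fun i => (s^[i] ⟨x.neg, h₂⟩).1, rfl, fun i => ?_, 0, rfl⟩
    simp only [Function.iterate_succ_apply']
    exact hs _
  | @head a c h _ ih =>
    obtain ⟨f, h0, hf, L, hL⟩ := ih
    refine ⟨fun i => Nat.casesOn i a f, rfl, fun i => ?_, L + 1, hL⟩
    cases i with
    | zero => simpa [h0] using h
    | succ i => exact hf i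

/-- An unsatisfiable formula contains a bicycle: an implication path through distinct variables
whose first literal is implied by the complement of a literal of the path, and whose last
literal implies a literal on a variable of the path. The path starts at the first repetition
along an infinite walk that reaches the complement of its start as early as possible. -/
lemma exists_bicycle {n : ℕ} {R : Literal n → Literal n → Prop} (hR : ∀ l l', R l l' → R l' l)
    (h : ¬ (relFormula R).IsSat) : ∃ k, ∃ w : Fin (k + 1) → Literal n,
      Function.Injective (fun i => (w i).1) ∧
      (∀ i : Fin k, R (w i.castSucc).neg (w i.succ)) ∧
      (∃ i, w i ≠ w 0 ∧ R (w i) (w 0)) ∧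
      ∃ j b, (w (Fin.last k)).neg ≠ ((w j).1, b) ∧ R (w (Fin.last k)).neg ((w j).1, b) := by
  classical
  obtain ⟨x, hx, hx'⟩ := exists_contradictory hR h
  have hex := exists_infinite_walk hx hx'
  obtain ⟨f, hf, hfL⟩ := Nat.find_spec hex
  have hmin : ∀ m, (∃ f : ℕ → Literal n, (∀ i, Step R (f i) (f (i + 1))) ∧ f m = (f 0).neg) →
      Nat.find hex ≤ m := fun m hm => Nat.find_min' hex hm
  generalize Nat.find hex = L at hfL hmin
  have hL : L ≠ 0 := by
    rintro rfl
    exact Literal.neg_ne _ hfL.symm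
  -- up to time `L`, the walk repeats a variable only at its two ends
  have hrep : ∀ a b, a < b → b ≤ L → (f a).1 = (f b).1 → a = 0 ∧ b = L := by
    intro a b hab hbL hv
    rcases Literal.eq_or_eq_neg hv with he | he
    · -- a repeated literal allows a shortcut
      exfalso
      have := hmin (L - (b - a)) ⟨fun i => if i ≤ a then f i else f (i + (b - a)), ?_, ?_⟩
      · omega
      · intro i
        by_cases h1 : i + 1 ≤ a
        · simp [h1, show i ≤ a by omega, hf]
        · by_cases h2 : i ≤ a
          · have : i = a := by omega
            subst this
            simp only [le_refl, if_true, h1, if_false, ← he]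
            have e : i + 1 + (b - i) = b + 1 := by omega
            rw [e]
            exact hf b
          · simp only [h1, h2, if_false]
            have e : i + 1 + (b - a) = i + (b - a) + 1 := by omega
            rw [e]
            exact hf _
      · simp only [Nat.zero_le, if_true]
        by_cases h1 : L - (b - a) ≤ a
        · have e : L - (b - a) = a := by omega
          have e' : L = b := by omega
          simp only [e, le_refl, if_true]
          rw [← hfL, e', he]
        · simp only [h1, if_false]
          rw [← hfL]
          congr 1
          omega
    · -- a literal and its complement: the walk may as well start at the first of them
      have := hmin (b - a) ⟨fun i => f (a + i), fun i => hf _, by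
        simp only [add_zero]
        rw [← he]
        congr 1
        omega⟩
      omega
  -- the path runs from time `1` until just before the next repeated variable
  have hex2 : ∃ M, L ≤ M ∧ ∃ j, 1 ≤ j ∧ j ≤ M ∧ (f (M + 1)).1 = (f j).1 := by
    obtain ⟨a, b, hab, he⟩ :=
      Finite.exists_ne_map_eq_of_infinite (fun i : ℕ => (f (L + 1 + i)).1)
    wlog hlt : a < b generalizing a b
    · exact this b a hab.symm he.symm (by omega)
    refine ⟨L + b, by omega, L + 1 + a, by omega, by omega, ?_⟩
    have e : L + b + 1 = L + 1 + b := by omega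
    rw [e]
    exact he.symm
  obtain ⟨hLM, j, hj1, hjM, hj⟩ := Nat.find_spec hex2
  have hmin2 : ∀ m, (L ≤ m ∧ ∃ j, 1 ≤ j ∧ j ≤ m ∧ (f (m + 1)).1 = (f j).1) →
      Nat.find hex2 ≤ m := fun m hm => Nat.find_min' hex2 hm
  generalize Nat.find hex2 = M at hLM hjM hj hmin2
  have hinj : ∀ a b, 1 ≤ a → a < b → b ≤ M → (f a).1 ≠ (f b).1 := by
    intro a b ha hab hb he
    by_cases hbL : b ≤ L
    · have := hrep a b hab hbL he
      omega
    · have := hmin2 (b - 1) ⟨by omega, a, ha, by omega, by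
        rw [Nat.sub_add_cancel (by omega)]
        exact he.symm⟩
      omega
  obtain ⟨k, rfl⟩ : ∃ k, M = k + 1 := ⟨M - 1, by omega⟩
  refine ⟨k, fun i => f (i + 1), ?_, ?_, ?_, ?_⟩
  · intro a b hab
    simp only at hab
    by_contra hne
    have hne' : (a : ℕ) ≠ b := fun e => hne (Fin.ext e)
    rcases lt_or_gt_of_ne hne' with hlt | hlt
    · exact hinj _ _ (by omega) (by omega) (by omega) hab
    · exact hinj _ _ (by omega) (by omega) (by omega) hab.symm
  · intro i
    exact (hf _).2
  · -- the step out of `f 0 = ¬f L`: the literal of the path related to `f 1` is `f L`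
    have h0 := hf 0
    rw [Step] at h0
    have e : (f 0).neg = f L := hfL.symm
    rw [e] at h0
    refine ⟨⟨L - 1, by omega⟩, ?_⟩
    simpa [Nat.sub_add_cancel (show 1 ≤ L by omega)] using h0
  · -- the step that closes the repetition
    have hM := hf (k + 1)
    rw [Step] at hM
    refine ⟨⟨j - 1, by omega⟩, (f (k + 1 + 1)).2, ?_⟩
    simp only [Fin.val_last, Nat.sub_add_cancel hj1, ← hj]
    exact hM

/-- The implication path `¬c → y₀ → ⋯ → y_k → c`, as a set of clauses. -/
def HalfSnake {n k : ℕ} (R : Literal n → Literal n → Prop) (c : Literal n)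
    (y : Fin (k + 1) → Literal n) : Prop :=
  (R c (y 0) ∧ R (y (Fin.last k)).neg c) ∧ ∀ i : Fin k, R (y i.castSucc).neg (y i.succ)

/-- The literals `c, y₀, …, y_k, z₀, …, z_k` belong to distinct variables. -/
structure DistinctVars {n k : ℕ} (c : Literal n) (y z : Fin (k + 1) → Literal n) : Prop where
  injy : Function.Injective fun i => (y i).1
  injz : Function.Injective fun i => (z i).1
  cy : ∀ i, c.1 ≠ (y i).1
  cz : ∀ i, c.1 ≠ (z i).1
  yz : ∀ i j, (y i).1 ≠ (z j).1

lemma HalfSnake.implies {n k : ℕ} {R : Literal n → Literal n → Prop} {v : Fin n → Bool}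
    (hv : ∀ C ∈ relFormula R, ∃ l ∈ C, v l.1 = l.2) {c : Literal n} {y : Fin (k + 1) → Literal n}
    (h : HalfSnake R c y) (hinj : Function.Injective fun i => (y i).1) (hc : ∀ i, c.1 ≠ (y i).1)
    (hl : v c.neg.1 = c.neg.2) : v c.1 = c.2 := by
  have h0 : v (y 0).1 = (y 0).2 :=
    IsSat.step hv ⟨by simpa using Literal.ne_of_fst_ne (hc 0), by simpa using h.1.1⟩ hl
  have hi : ∀ i : Fin (k + 1), v (y i).1 = (y i).2 := by
    intro i
    induction i using Fin.induction with
    | zero => exact h0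
    | succ i ih =>
      refine IsSat.step hv ⟨?_, h.2 i⟩ ih
      apply Literal.ne_of_fst_ne
      intro e
      exact absurd (hinj e) (Fin.castSucc_lt_succ).ne
  exact IsSat.step hv ⟨Literal.ne_of_fst_ne (by simpa using (hc _).symm), h.1.2⟩ (hi (Fin.last k))

/-- A snake `¬c → ⋯ → c → ⋯ → ¬c` makes the formula unsatisfiable. -/
lemma not_isSat_of_snake {n k : ℕ} {R : Literal n → Literal n → Prop} {c : Literal n}
    {y z : Fin (k + 1) → Literal n} (hd : DistinctVars c y z) (hy : HalfSnake R c y)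
    (hz : HalfSnake R c.neg z) : ¬ (relFormula R).IsSat := by
  rintro ⟨v, hv⟩
  by_cases hc : v c.1 = c.2
  · have := hz.implies hv hd.injz (by simpa using hd.cz) (by simpa using hc)
    simp [Literal.neg, hc] at this
  · refine hc (hy.implies hv hd.injy hd.cy ?_)
    revert hc
    simp only [Literal.neg]
    cases v c.1 <;> cases c.2 <;> simp

lemma relFormula_mono {n : ℕ} {R R' : Literal n → Literal n → Prop}
    (h : ∀ l l', R l l' → R' l l') (hs : (relFormula R').IsSat) : (relFormula R).IsSat := by
  obtain ⟨v, hv⟩ := hs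
  refine ⟨v, ?_⟩
  rintro C ⟨l, l', hne, rfl, hr⟩
  exact hv _ ⟨l, l', hne, rfl, h _ _ hr⟩

/-! ### Random relations between independent points -/

section RandomRelation

set_option linter.unusedSectionVars false

variable {X ι : Type*} [MeasurableSpace X]

/-- A symmetric measurable relation `E` on a probability space: two independent points are
related with probability `p`, and any fixed point is related to a random one with probability
at most `q`. -/
structure EdgeRel (ν : Measure X) (E : X → X → Prop) (p q : ℝ) : Prop where
  meas : MeasurableSet {z : X × X | E z.1 z.2}
  symm : ∀ x y, E x y → E y x
  le_q : ∀ x, ν.real {y | E x y} ≤ q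
  eq_p : (ν.prod ν).real {z : X × X | E z.1 z.2} = p

/-- The event that the points at the indices `a` and `b` are related. -/
def edge (E : X → X → Prop) (a b : ι) : Set (ι → X) := {ω | E (ω a) (ω b)}

/-- The event `G` depends only on the coordinates in `D`. -/
abbrev Dep (G : Set (ι → X)) (D : Set ι) : Prop := DependsOn (fun ω => ω ∈ G) D

lemma Dep.mono {G : Set (ι → X)} {D D' : Set ι} (h : Dep G D) (hD : D ⊆ D') : Dep G D' :=
  fun _ _ hxy => h fun i hi => hxy i (hD hi)

lemma Dep.inter {G H : Set (ι → X)} {D : Set ι} (h : Dep G D) (h' : Dep H D) :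
    Dep (G ∩ H) D := by
  intro x y hxy
  have h1 := h hxy
  have h2 := h' hxy
  simp only [eq_iff_iff] at h1 h2
  simp only [Set.mem_inter_iff, h1, h2]

lemma Dep.biInter {κ : Type*} {T : Finset κ} {G : κ → Set (ι → X)} {D : Set ι}
    (h : ∀ j ∈ T, Dep (G j) D) : Dep (⋂ j ∈ T, G j) D := by
  intro x y hxy
  simp only [Set.mem_iInter, eq_iff_iff]
  exact forall₂_congr fun j hj => by simpa using h j hj hxy

lemma dep_univ (D : Set ι) : Dep (Set.univ : Set (ι → X)) D := fun _ _ _ => by simp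

lemma dep_edge (E : X → X → Prop) {a b : ι} {D : Set ι} (ha : a ∈ D) (hb : b ∈ D) :
    Dep (edge E a b) D := by
  intro x y hxy
  simp only [edge, Set.mem_ofPred_eq, hxy a ha, hxy b hb]

lemma Dep.update [DecidableEq ι] {G : Set (ι → X)} {D : Set ι} (h : Dep G D) {i : ι} (hi : i ∉ D)
    (x : ι → X) (y : X) : Function.update x i y ∈ G ↔ x ∈ G := by
  have := h (x := Function.update x i y) (y := x) fun j hj => by
    rw [Function.update_of_ne]
    rintro rfl
    exact hi hj
  simpa using this

/-- The factor contributed by the edge `ab` to the probability of a forest when the points at the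
indices in `D` are already placed. -/
noncomputable def edgeWt (p q : ℝ) (D : Set ι) (a b : ι) : ℝ :=
  open Classical in if a ∈ D ∧ b ∈ D then 1 else if a ∈ D ∨ b ∈ D then q else p

variable {ν : Measure X} [IsProbabilityMeasure ν] {E : X → X → Prop} {p q : ℝ}

namespace EdgeRel

lemma measurableSet_edge (h : EdgeRel ν E p q) (a b : ι) :
    MeasurableSet (edge E a b : Set (ι → X)) := by
  have hm : Measurable fun ω : ι → X => (ω a, ω b) :=
    (measurable_pi_apply a).prodMk (measurable_pi_apply b)
  exact hm h.meas

lemma edge_comm (h : EdgeRel ν E p q) (a b : ι) :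
    (edge E a b : Set (ι → X)) = edge E b a := by
  ext ω
  exact ⟨h.symm _ _, h.symm _ _⟩

lemma measurable_deg (h : EdgeRel ν E p q) : Measurable fun x => ν {y | E x y} :=
  measurable_measure_prodMk_left h.meas

lemma lintegral_deg (h : EdgeRel ν E p q) : ∫⁻ x, ν {y | E x y} ∂ν = ENNReal.ofReal p := by
  rw [← h.eq_p, ofReal_measureReal, Measure.prod_apply h.meas]
  rfl

lemma deg_le (h : EdgeRel ν E p q) (x : X) : ν {y | E x y} ≤ ENNReal.ofReal q := by
  rw [← ofReal_measureReal]
  exact ENNReal.ofReal_le_ofReal (h.le_q x)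

lemma p_nonneg (h : EdgeRel ν E p q) : 0 ≤ p := h.eq_p ▸ measureReal_nonneg

lemma q_nonneg (h : EdgeRel ν E p q) : 0 ≤ q := by
  obtain ⟨x⟩ := nonempty_of_isProbabilityMeasure ν
  exact measureReal_nonneg.trans (h.le_q x)

lemma p_le_q (h : EdgeRel ν E p q) : p ≤ q := by
  have : ENNReal.ofReal p ≤ ENNReal.ofReal q := by
    rw [← h.lintegral_deg]
    calc ∫⁻ x, ν {y | E x y} ∂ν ≤ ∫⁻ _, ENNReal.ofReal q ∂ν := lintegral_mono fun x => h.deg_le x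
      _ = _ := by simp
  exact (ENNReal.ofReal_le_ofReal_iff h.q_nonneg).1 this

/-- The expected squared degree is at least the square of the expected degree. -/
lemma sq_le_lintegral_deg_sq (h : EdgeRel ν E p q) :
    ENNReal.ofReal (p ^ 2) ≤ ∫⁻ x, ν {y | E x y} * ν {y | E x y} ∂ν := by
  have h1 := ENNReal.lintegral_mul_le_Lp_mul_Lq ν (p := 2) (q := 2)
    (Real.HolderConjugate.two_two) (f := fun x => ν {y | E x y}) (g := fun _ => 1)
    h.measurable_deg.aemeasurable aemeasurable_const
  simp only [Pi.mul_apply, mul_one, ENNReal.one_rpow, lintegral_one, measure_univ,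
    h.lintegral_deg] at h1
  have h2 := ENNReal.rpow_le_rpow h1 (show (0 : ℝ) ≤ 2 by norm_num)
  rw [← ENNReal.rpow_mul] at h2
  norm_num at h2
  rw [← ENNReal.ofReal_pow h.p_nonneg] at h2
  simpa [sq] using h2

end EdgeRel

variable [Fintype ι] [DecidableEq ι]

/-- One coordinate of a product probability measure can be integrated out first. -/
lemma lintegral_pi_update {f : (ι → X) → ℝ≥0∞} (hf : Measurable f) (i : ι) :
    ∫⁻ x, f x ∂Measure.pi (fun _ : ι => ν) =
      ∫⁻ x, ∫⁻ y, f (Function.update x i y) ∂ν ∂Measure.pi (fun _ : ι => ν) := by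
  obtain ⟨x₀⟩ := nonempty_of_isProbabilityMeasure (Measure.pi (fun _ : ι => ν))
  have hg : Measurable fun x : ι → X => ∫⁻ y, f (Function.update x i y) ∂ν := by
    have hu : Measurable fun z : (ι → X) × X => Function.update z.1 i z.2 :=
      measurable_update'
    exact Measurable.lintegral_prod_right (hf.comp hu)
  rw [lintegral_eq_lmarginal_univ x₀, lintegral_eq_lmarginal_univ x₀,
    lmarginal_erase' _ hf (Finset.mem_univ i), lmarginal_erase' _ hg (Finset.mem_univ i)]
  congr 2
  ext x
  simp

lemma lintegral_indicator_mul_eval {G : Set (ι → X)} {D : Set ι} (hG : MeasurableSet G)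
    (hD : Dep G D) {a : ι} (ha : a ∉ D) {f : X → ℝ≥0∞} (hf : Measurable f) :
    ∫⁻ x, G.indicator 1 x * f (x a) ∂Measure.pi (fun _ : ι => ν) =
      Measure.pi (fun _ : ι => ν) G * ∫⁻ z, f z ∂ν := by
  rw [lintegral_pi_update (f := fun x => G.indicator 1 x * f (x a))
    ((measurable_one.indicator hG).mul (hf.comp (measurable_pi_apply a))) a]
  have : ∀ x : ι → X, ∫⁻ y, G.indicator 1 (Function.update x a y) *
      f (Function.update x a y a) ∂ν = G.indicator 1 x * ∫⁻ z, f z ∂ν := by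
    intro x
    rw [← lintegral_const_mul _ hf]
    refine lintegral_congr fun y => ?_
    by_cases hx : x ∈ G <;> simp [Set.indicator, hD.update ha, hx]
  simp only [this]
  rw [lintegral_mul_const _ (measurable_one.indicator hG), lintegral_indicator_one hG]

namespace EdgeRel

lemma lintegral_inter_edge (h : EdgeRel ν E p q) {G : Set (ι → X)} {D : Set ι}
    (hG : MeasurableSet G) (hD : Dep G D) {a b : ι} (ha : a ∉ D) (hab : a ≠ b)
    {f : X → ℝ≥0∞} (hf : Measurable f) :
    ∫⁻ x, (G ∩ edge E a b).indicator 1 x * f (x b) ∂Measure.pi (fun _ : ι => ν) =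
      ∫⁻ x, G.indicator 1 x * (ν {y | E (x b) y} * f (x b)) ∂Measure.pi (fun _ : ι => ν) := by
  rw [lintegral_pi_update (f := fun x => (G ∩ edge E a b).indicator 1 x * f (x b))
    ((measurable_one.indicator (hG.inter (h.measurableSet_edge a b))).mul
    (hf.comp (measurable_pi_apply b))) a]
  refine lintegral_congr fun x => ?_
  have hm : MeasurableSet {y | E (x b) y} := h.meas.preimage measurable_prodMk_left
  have : ∀ y, (G ∩ edge E a b).indicator (1 : (ι → X) → ℝ≥0∞) (Function.update x a y) *
      f (Function.update x a y b) =
      (G.indicator 1 x * f (x b)) * {y | E (x b) y}.indicator 1 y := by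
    intro y
    rw [Function.update_of_ne hab.symm]
    by_cases hx : x ∈ G
    · by_cases hE : E (x b) y
      · have : E y (x b) := h.symm _ _ hE
        simp [Set.indicator, hD.update ha, hx, edge, hab.symm, hE, this]
      · have : ¬ E y (x b) := fun h' => hE (h.symm _ _ h')
        simp [Set.indicator, hD.update ha, hx, edge, hab.symm, hE, this]
    · simp [Set.indicator, hD.update ha, hx]
  simp only [this]
  rw [lintegral_const_mul _ (measurable_one.indicator hm), lintegral_indicator_one hm]
  ring

lemma measure_inter_edge (h : EdgeRel ν E p q) {G : Set (ι → X)} {D : Set ι}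
    (hG : MeasurableSet G) (hD : Dep G D) {a b : ι} (ha : a ∉ D) (hab : a ≠ b) :
    Measure.pi (fun _ : ι => ν) (G ∩ edge E a b) =
      ∫⁻ x, G.indicator 1 x * ν {y | E (x b) y} ∂Measure.pi (fun _ : ι => ν) := by
  have := h.lintegral_inter_edge hG hD ha hab (f := 1) measurable_one
  simp only [Pi.one_apply, mul_one] at this
  rw [← this, lintegral_indicator_one (hG.inter (h.measurableSet_edge a b))]

/-- Adding a leaf costs a factor `q`. -/
lemma real_inter_edge_le (h : EdgeRel ν E p q) {G : Set (ι → X)} {D : Set ι}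
    (hG : MeasurableSet G) (hD : Dep G D) {a b : ι} (ha : a ∉ D) (hab : a ≠ b) :
    (Measure.pi (fun _ : ι => ν)).real (G ∩ edge E a b) ≤
      q * (Measure.pi (fun _ : ι => ν)).real G := by
  have h1 : Measure.pi (fun _ : ι => ν) (G ∩ edge E a b) ≤
      ENNReal.ofReal q * Measure.pi (fun _ : ι => ν) G := by
    rw [h.measure_inter_edge hG hD ha hab]
    calc _ ≤ ∫⁻ x, G.indicator 1 x * ENNReal.ofReal q ∂Measure.pi (fun _ : ι => ν) :=
          lintegral_mono fun x => mul_le_mul_right (h.deg_le _) _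
      _ = _ := by
        rw [lintegral_mul_const _ (measurable_one.indicator hG), lintegral_indicator_one hG,
          mul_comm]
  have h2 := ENNReal.toReal_mono (by finiteness) h1
  rwa [ENNReal.toReal_mul, ENNReal.toReal_ofReal h.q_nonneg] at h2

/-- An edge between two fresh points is independent of the past. -/
lemma real_inter_edge_eq (h : EdgeRel ν E p q) {G : Set (ι → X)} {D : Set ι}
    (hG : MeasurableSet G) (hD : Dep G D) {a b : ι} (ha : a ∉ D) (hb : b ∉ D) (hab : a ≠ b) :
    (Measure.pi (fun _ : ι => ν)).real (G ∩ edge E a b) =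
      p * (Measure.pi (fun _ : ι => ν)).real G := by
  have h1 : Measure.pi (fun _ : ι => ν) (G ∩ edge E a b) =
      Measure.pi (fun _ : ι => ν) G * ENNReal.ofReal p := by
    rw [h.measure_inter_edge hG hD ha hab, lintegral_indicator_mul_eval hG hD hb h.measurable_deg,
      h.lintegral_deg]
  rw [measureReal_def, h1, ENNReal.toReal_mul, ENNReal.toReal_ofReal h.p_nonneg, mul_comm]
  rfl

/-- A path with two edges through three fresh points has probability at least `p ^ 2`. -/
lemma sq_mul_le_real_inter_path (h : EdgeRel ν E p q) {G : Set (ι → X)} {D : Set ι}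
    (hG : MeasurableSet G) (hD : Dep G D) {a b c : ι} (ha : a ∉ D) (hb : b ∉ D) (hc : c ∉ D)
    (hab : a ≠ b) (hbc : b ≠ c) (hac : a ≠ c) :
    p ^ 2 * (Measure.pi (fun _ : ι => ν)).real G ≤
      (Measure.pi (fun _ : ι => ν)).real (G ∩ edge E a b ∩ edge E c b) := by
  have h1 : Measure.pi (fun _ : ι => ν) (G ∩ edge E a b ∩ edge E c b) =
      Measure.pi (fun _ : ι => ν) G * ∫⁻ x, ν {y | E x y} * ν {y | E x y} ∂ν := by
    rw [h.measure_inter_edge (D := insert a (insert b D))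
      (hG.inter (h.measurableSet_edge a b)) ?_ ?_ hbc.symm,
      h.lintegral_inter_edge hG hD ha hab h.measurable_deg,
      lintegral_indicator_mul_eval hG hD hb (f := fun x => ν {y | E x y} * ν {y | E x y})
        (h.measurable_deg.mul h.measurable_deg)]
    · exact (hD.mono fun i hi => by simp [hi]).inter (dep_edge E (by simp) (by simp))
    · simp [hc, hac.symm, hbc.symm]
  have h2 : ENNReal.ofReal (p ^ 2) * Measure.pi (fun _ : ι => ν) G ≤
      Measure.pi (fun _ : ι => ν) (G ∩ edge E a b ∩ edge E c b) := by
    rw [h1, mul_comm]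
    exact mul_le_mul_right h.sq_le_lintegral_deg_sq _
  have h3 := ENNReal.toReal_mono (by finiteness) h2
  rwa [ENNReal.toReal_mul, ENNReal.toReal_ofReal (by positivity)] at h3

lemma edgeWt_nonneg (h : EdgeRel ν E p q) (D : Set ι) (a b : ι) : 0 ≤ edgeWt p q D a b := by
  have := h.p_nonneg
  have := h.q_nonneg
  unfold edgeWt
  split_ifs <;> positivity

lemma real_inter_edge_le_edgeWt (h : EdgeRel ν E p q) {G : Set (ι → X)} {D : Set ι}
    (hG : MeasurableSet G) (hD : Dep G D) {a b : ι} (hab : a ≠ b) :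
    (Measure.pi (fun _ : ι => ν)).real (G ∩ edge E a b) ≤
      edgeWt p q D a b * (Measure.pi (fun _ : ι => ν)).real G := by
  unfold edgeWt
  split_ifs with h1 h2
  · rw [one_mul]
    exact measureReal_mono Set.inter_subset_left
  · by_cases ha : a ∈ D
    · have hb : b ∉ D := fun hb => h1 ⟨ha, hb⟩
      rw [h.edge_comm]
      exact h.real_inter_edge_le hG hD hb hab.symm
    · exact h.real_inter_edge_le hG hD ha hab
  · push Not at h2
    exact (h.real_inter_edge_eq hG hD h2.1 h2.2 hab).le

lemma measurableSet_biInter_edge (h : EdgeRel ν E p q) {κ : Type*} (T : Finset κ) (a b : κ → ι) :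
    MeasurableSet (⋂ j ∈ T, edge E (a j) (b j) : Set (ι → X)) :=
  T.measurableSet_biInter fun _ _ => h.measurableSet_edge _ _

/-- The edges of a matching each contribute their factor. -/
lemma real_inter_matching_le (h : EdgeRel ν E p q) {κ : Type*} {G : Set (ι → X)} {D : Set ι}
    (hG : MeasurableSet G) (hD : Dep G D) {a b : κ → ι} (ha : Function.Injective a)
    (hb : Function.Injective b) (hab : ∀ i j, a i ≠ b j) (T : Finset κ) :
    (Measure.pi (fun _ : ι => ν)).real (G ∩ ⋂ j ∈ T, edge E (a j) (b j)) ≤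
      (∏ j ∈ T, edgeWt p q D (a j) (b j)) * (Measure.pi (fun _ : ι => ν)).real G := by
  classical
  induction T using Finset.induction_on with
  | empty => simp
  | insert j T hj ih =>
    rw [Finset.set_biInter_insert, Finset.prod_insert hj,
      Set.inter_comm (edge E (a j) (b j)), ← Set.inter_assoc]
    have hD' : Dep (G ∩ ⋂ j ∈ T, edge E (a j) (b j)) (D ∪ (a '' T ∪ b '' T)) := by
      refine (hD.mono Set.subset_union_left).inter (Dep.biInter fun i hi => dep_edge E ?_ ?_)
      · exact Or.inr (Or.inl ⟨i, hi, rfl⟩)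
      · exact Or.inr (Or.inr ⟨i, hi, rfl⟩)
    refine (h.real_inter_edge_le_edgeWt (hG.inter (h.measurableSet_biInter_edge T a b)) hD'
      (hab j j)).trans ?_
    have e1 : a j ∈ D ∪ (a '' T ∪ b '' T) ↔ a j ∈ D := by
      have : a j ∉ a '' T := by
        rintro ⟨i, hi, he⟩
        exact hj (ha he ▸ hi)
      have : a j ∉ b '' T := by
        rintro ⟨i, hi, he⟩
        exact hab _ _ he.symm
      simp_all
    have e2 : b j ∈ D ∪ (a '' T ∪ b '' T) ↔ b j ∈ D := by
      have : b j ∉ b '' T := by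
        rintro ⟨i, hi, he⟩
        exact hj (hb he ▸ hi)
      have : b j ∉ a '' T := by
        rintro ⟨i, hi, he⟩
        exact hab _ _ he
      simp_all
    have e3 : edgeWt p q (D ∪ (a '' T ∪ b '' T)) (a j) (b j) = edgeWt p q D (a j) (b j) := by
      simp only [edgeWt, e1, e2]
    rw [e3, mul_assoc]
    exact mul_le_mul_of_nonneg_left ih (h.edgeWt_nonneg _ _ _)

lemma real_inter_matching_eq (h : EdgeRel ν E p q) {κ : Type*} {G : Set (ι → X)} {D : Set ι}
    (hG : MeasurableSet G) (hD : Dep G D) {a b : κ → ι} (ha : Function.Injective a)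
    (hb : Function.Injective b) (hab : ∀ i j, a i ≠ b j) (haD : ∀ i, a i ∉ D)
    (hbD : ∀ i, b i ∉ D) (T : Finset κ) :
    (Measure.pi (fun _ : ι => ν)).real (G ∩ ⋂ j ∈ T, edge E (a j) (b j)) =
      p ^ T.card * (Measure.pi (fun _ : ι => ν)).real G := by
  classical
  induction T using Finset.induction_on with
  | empty => simp
  | insert j T hj ih =>
    rw [Finset.set_biInter_insert, Finset.card_insert_of_notMem hj,
      Set.inter_comm (edge E (a j) (b j)), ← Set.inter_assoc]
    have hD' : Dep (G ∩ ⋂ j ∈ T, edge E (a j) (b j)) (D ∪ (a '' T ∪ b '' T)) := by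
      refine (hD.mono Set.subset_union_left).inter (Dep.biInter fun i hi => dep_edge E ?_ ?_)
      · exact Or.inr (Or.inl ⟨i, hi, rfl⟩)
      · exact Or.inr (Or.inr ⟨i, hi, rfl⟩)
    rw [h.real_inter_edge_eq (hG.inter (h.measurableSet_biInter_edge T a b)) hD' ?_ ?_ (hab j j),
      ih]
    · ring
    · rintro (hi | ⟨i, hi, he⟩ | ⟨i, hi, he⟩)
      · exact haD _ hi
      · exact hj (ha he ▸ hi)
      · exact hab _ _ he.symm
    · rintro (hi | ⟨i, hi, he⟩ | ⟨i, hi, he⟩)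
      · exact hbD _ hi
      · exact hab _ _ he
      · exact hj (hb he ▸ hi)

end EdgeRel

end RandomRelation

/-! ### Satisfiability below the threshold -/

section Subcritical

variable {X : Type*} [MeasurableSpace X] {ν : Measure X} [IsProbabilityMeasure ν]
  {E : X → X → Prop} {p q : ℝ}

/-- The edges of a bicycle: a matching, and then two more edges, each with a fresh endpoint. -/
def bicycleEvent {n k : ℕ} (E : X → X → Prop) (w : Fin (k + 1) → Literal n)
    (i : Fin (k + 1)) (v : Literal n) : Set (Literal n → X) :=
  ((Set.univ ∩ ⋂ t ∈ (Finset.univ : Finset (Fin k)), edge E (w t.castSucc).neg (w t.succ)) ∩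
    edge E (w 0) (w i)) ∩ edge E (w (Fin.last k)).neg v

/-- Each of the `k` edges of the path costs a factor `p`, as they form a matching; the two closing
edges cost `q` each. -/
lemma EdgeRel.real_bicycleEvent_le (h : EdgeRel ν E p q) {n k : ℕ} {w : Fin (k + 1) → Literal n}
    (hw : Function.Injective fun i => (w i).1) {i : Fin (k + 1)} (hi : w i ≠ w 0)
    {v : Literal n} (hv : (w (Fin.last k)).neg ≠ v) :
    (Measure.pi (fun _ : Literal n => ν)).real (bicycleEvent E w i v) ≤ p ^ k * q ^ 2 := by
  have hw' : ∀ s t, (w s).1 = (w t).1 → s = t := fun _ _ e => hw e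
  have hM : MeasurableSet (Set.univ ∩ ⋂ t ∈ (Finset.univ : Finset (Fin k)),
      edge E (w t.castSucc).neg (w t.succ)) :=
    MeasurableSet.univ.inter (h.measurableSet_biInter_edge _ _ _)
  have h1 := h.real_inter_matching_eq (ι := Literal n) (G := Set.univ) (D := ∅)
    MeasurableSet.univ (dep_univ _)
    (a := fun t : Fin k => (w t.castSucc).neg) (b := fun t => w t.succ)
    (fun s t hst => by
      have := hw' s.castSucc t.castSucc (congrArg Prod.fst hst :)
      exact Fin.castSucc_injective _ this)
    (fun s t hst => Fin.succ_injective _ (hw' _ _ (congrArg Prod.fst hst :)))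
    (fun s t hst => by
      have e := hw' s.castSucc t.succ (congrArg Prod.fst hst :)
      rw [← e] at hst
      exact Literal.neg_ne _ hst) (by simp) (by simp) Finset.univ
  have hdep : Dep (Set.univ ∩ ⋂ t ∈ (Finset.univ : Finset (Fin k)),
      edge E (w t.castSucc).neg (w t.succ) : Set (Literal n → X))
      {l | ∃ t : Fin k, l = (w t.castSucc).neg ∨ l = w t.succ} :=
    (dep_univ _).inter (Dep.biInter fun t _ => dep_edge E ⟨t, Or.inl rfl⟩ ⟨t, Or.inr rfl⟩)
  have h0 : w 0 ∉ {l | ∃ t : Fin k, l = (w t.castSucc).neg ∨ l = w t.succ} := by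
    rintro ⟨t, ht | ht⟩
    · have e := hw' 0 t.castSucc (congrArg Prod.fst ht :)
      rw [← e] at ht
      exact Literal.neg_ne _ ht.symm
    · exact absurd (hw' _ _ (congrArg Prod.fst ht :)) (Fin.succ_ne_zero t).symm
  -- `w 0` and `¬w k` are the only literals of the path that the matching leaves free, and each
  -- serves as a leaf
  have h2 := h.real_inter_edge_le hM hdep h0 hi.symm (b := w i)
  have hdep2 : Dep ((Set.univ ∩ ⋂ t ∈ (Finset.univ : Finset (Fin k)),
      edge E (w t.castSucc).neg (w t.succ)) ∩ edge E (w 0) (w i) : Set (Literal n → X))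
      ({l | ∃ t : Fin k, l = (w t.castSucc).neg ∨ l = w t.succ} ∪ {w 0, w i}) :=
    (hdep.mono Set.subset_union_left).inter (dep_edge E (by simp) (by simp))
  have hlast : (w (Fin.last k)).neg ∉
      ({l | ∃ t : Fin k, l = (w t.castSucc).neg ∨ l = w t.succ} ∪ {w 0, w i}) := by
    have hpos : ∀ t, (w (Fin.last k)).neg ≠ w t := by
      intro t ht
      have e := hw' (Fin.last k) t (congrArg Prod.fst ht :)
      rw [← e] at ht
      exact Literal.neg_ne _ ht
    rintro (⟨t, ht | ht⟩ | ht | ht)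
    · exact absurd (hw' (Fin.last k) t.castSucc (congrArg Prod.fst ht :))
        (Fin.castSucc_lt_last t).ne'
    · exact hpos _ ht
    · exact hpos _ ht
    · exact hpos _ ht
  have h3 := h.real_inter_edge_le (hM.inter (h.measurableSet_edge _ _)) hdep2 hlast hv
  have hq := h.q_nonneg
  rw [h1] at h2
  simp only [Finset.card_univ, Fintype.card_fin, probReal_univ, mul_one] at h2
  calc _ ≤ _ := h3
    _ ≤ q * (q * p ^ k) := by gcongr
    _ = _ := by ring

/-- The union bound over all bicycles: there are `(2n) ^ (k + 1)` sequences of literals, and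
`2 (k + 1) ^ 2` choices of the two literals at which the path is closed. -/
lemma EdgeRel.real_not_isSat_le (h : EdgeRel ν E p q) (n : ℕ) :
    (Measure.pi (fun _ : Literal n => ν)).real
      {ω | ¬ (relFormula fun l l' => E (ω l) (ω l')).IsSat} ≤
      ∑ k ∈ Finset.range n, (2 * n : ℝ) ^ (k + 1) * (2 * (k + 1) ^ 2) * (p ^ k * q ^ 2) := by
  classical
  let S : (Σ k : Fin n, (Fin (k + 1) → Literal n) × Fin (k + 1) × Fin (k + 1) × Bool) →
      Set (Literal n → X) := fun x =>
    if Function.Injective (fun i => (x.2.1 i).1) ∧ x.2.1 x.2.2.1 ≠ x.2.1 0 ∧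
      (x.2.1 (Fin.last x.1)).neg ≠ ((x.2.1 x.2.2.2.1).1, x.2.2.2.2) then
    bicycleEvent E x.2.1 x.2.2.1 ((x.2.1 x.2.2.2.1).1, x.2.2.2.2) else ∅
  have hp := h.p_nonneg
  have hS : ∀ x, (Measure.pi (fun _ : Literal n => ν)).real (S x) ≤ p ^ (x.1 : ℕ) * q ^ 2 := by
    intro x
    simp only [S]
    split_ifs with hx
    · exact h.real_bicycleEvent_le hx.1 hx.2.1 hx.2.2
    · simp only [measureReal_empty]
      positivity
  have hsub : {ω | ¬ (relFormula fun l l' => E (ω l) (ω l')).IsSat} ⊆ ⋃ x, S x := by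
    intro ω hω
    obtain ⟨k, w, hw, he, ⟨i, hi, hi'⟩, j, b, hne, hb⟩ :=
      exists_bicycle (R := fun l l' => E (ω l) (ω l')) (fun _ _ => h.symm _ _) hω
    have hk : k < n := by
      have := Fintype.card_le_of_injective _ hw
      simp only [Fintype.card_fin] at this
      omega
    refine Set.mem_iUnion.2 ⟨⟨⟨k, hk⟩, w, i, j, b⟩, ?_⟩
    simp only [S]
    rw [if_pos ⟨hw, hi, hne⟩]
    refine ⟨⟨⟨trivial, ?_⟩, h.symm _ _ hi'⟩, hb⟩
    simp only [Set.mem_iInter]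
    exact fun t _ => he t
  refine (measureReal_mono hsub).trans ((measureReal_iUnion_fintype_le _).trans ?_)
  calc ∑ x, (Measure.pi (fun _ : Literal n => ν)).real (S x)
      ≤ ∑ x : (Σ k : Fin n, (Fin (k + 1) → Literal n) × Fin (k + 1) × Fin (k + 1) × Bool),
          p ^ (x.1 : ℕ) * q ^ 2 := Finset.sum_le_sum fun x _ => hS x
    _ = _ := by
        rw [Fintype.sum_sigma, Finset.sum_range]
        refine Finset.sum_congr rfl fun k _ => ?_
        simp only [Finset.sum_const, Finset.card_univ, Fintype.card_prod, Fintype.card_fun,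
          Fintype.card_fin, Fintype.card_bool, nsmul_eq_mul]
        push_cast
        ring

lemma summable_sq_mul_geometric {r : ℝ} (h0 : 0 ≤ r) (h1 : r < 1) :
    Summable fun k : ℕ => ((k : ℝ) + 1) ^ 2 * r ^ k := by
  have e : ∀ k : ℕ, ((k : ℝ) + 1) ^ 2 * r ^ k =
      (k : ℝ) ^ 2 * r ^ k + 2 * ((k : ℝ) ^ 1 * r ^ k) + (k : ℝ) ^ 0 * r ^ k := by
    intro k
    ring
  simp only [e]
  have hr : ‖r‖ < 1 := by rwa [Real.norm_of_nonneg h0]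
  exact ((summable_pow_mul_geometric_of_norm_lt_one 2 hr).add
    ((summable_pow_mul_geometric_of_norm_lt_one 1 hr).mul_left 2)).add
    (summable_pow_mul_geometric_of_norm_lt_one 0 hr)

/-- If the expected number of implications of a literal stays below one, then the formula is
satisfiable with high probability: the expected number of bicycles vanishes. -/
theorem tendsto_not_isSat_zero {E : ℕ → X → X → Prop} {p q : ℕ → ℝ} {r : ℝ} (hr : r < 1)
    (h : ∀ᶠ n in atTop, EdgeRel ν (E n) (p n) (q n))
    (hp : ∀ᶠ n : ℕ in atTop, 2 * n * p n ≤ r)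
    (hq : Tendsto (fun n : ℕ => n * q n ^ 2) atTop (𝓝 0)) :
    Tendsto (fun n : ℕ => (Measure.pi (fun _ : Literal n => ν)).real
      {ω | ¬ (relFormula fun l l' => E n (ω l) (ω l')).IsSat}) atTop (𝓝 0) := by
  have hr0 : 0 ≤ r := by
    obtain ⟨n, hn, hn'⟩ := (h.and hp).exists
    have := hn.p_nonneg
    exact le_trans (by positivity) hn'
  have hs := summable_sq_mul_geometric hr0 hr
  have hlim : Tendsto (fun n : ℕ => (4 * ∑' k : ℕ, ((k : ℝ) + 1) ^ 2 * r ^ k) * (n * q n ^ 2))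
      atTop (𝓝 0) := by
    simpa using hq.const_mul (4 * ∑' k : ℕ, ((k : ℝ) + 1) ^ 2 * r ^ k)
  refine squeeze_zero' (Eventually.of_forall fun n => measureReal_nonneg) ?_ hlim
  filter_upwards [h, hp] with n hn hpn
  have hpn0 := hn.p_nonneg
  refine (hn.real_not_isSat_le n).trans ?_
  calc ∑ k ∈ Finset.range n, (2 * n : ℝ) ^ (k + 1) * (2 * (k + 1) ^ 2) * (p n ^ k * q n ^ 2)
      = 4 * (n * q n ^ 2) * ∑ k ∈ Finset.range n, ((k : ℝ) + 1) ^ 2 * (2 * n * p n) ^ k := by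
        rw [Finset.mul_sum]
        refine Finset.sum_congr rfl fun k _ => ?_
        rw [mul_pow (2 * (n : ℝ)) (p n) k, pow_succ]
        ring
    _ ≤ 4 * (n * q n ^ 2) * ∑ k ∈ Finset.range n, ((k : ℝ) + 1) ^ 2 * r ^ k := by gcongr
    _ ≤ 4 * (n * q n ^ 2) * ∑' k : ℕ, ((k : ℝ) + 1) ^ 2 * r ^ k := by
        gcongr
        exact hs.sum_le_tsum _ fun k _ => by positivity
    _ = _ := by ring

end Subcritical

/-! ### The probability of a snake -/

section Snake

set_option linter.unusedSectionVars false

variable {X : Type*} [MeasurableSpace X] {ν : Measure X} [IsProbabilityMeasure ν]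
  {E : X → X → Prop} {p q : ℝ} {n k : ℕ}

/-- The event that the half snake `¬c → y₀ → ⋯ → y_k → c` is present. -/
def halfEvent (E : X → X → Prop) (c : Literal n) (y : Fin (k + 1) → Literal n) :
    Set (Literal n → X) :=
  {ω | HalfSnake (fun l l' => E (ω l) (ω l')) c y}

/-- The event that the snake `¬c → y₀ → ⋯ → y_k → c → z₀ → ⋯ → z_k → ¬c` is present. -/
def snakeEvent (E : X → X → Prop) (c : Literal n) (y z : Fin (k + 1) → Literal n) :
    Set (Literal n → X) :=
  halfEvent E c y ∩ halfEvent E c.neg z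

/-- The variables of a snake. -/
def snakeVars (c : Literal n) (y z : Fin (k + 1) → Literal n) : Finset (Fin n) :=
  insert c.1 (Finset.univ.image (fun i => (y i).1) ∪ Finset.univ.image (fun i => (z i).1))

/-- The literals of a snake that are not covered by its matching edges. -/
def hookSet (c : Literal n) (y z : Fin (k + 1) → Literal n) : Finset (Literal n) :=
  {c, c.neg, y 0, (y (Fin.last k)).neg, z 0, (z (Fin.last k)).neg}

/-- The first endpoints of the matching edges of a snake. -/
def matchFst (y z : Fin (k + 1) → Literal n) : Fin k ⊕ Fin k → Literal n :=
  Sum.elim (fun i => (y i.castSucc).neg) (fun i => (z i.castSucc).neg)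

/-- The second endpoints of the matching edges of a snake. -/
def matchSnd (y z : Fin (k + 1) → Literal n) : Fin k ⊕ Fin k → Literal n :=
  Sum.elim (fun i => y i.succ) (fun i => z i.succ)

/-- Two literals are joined by a matching edge of the snake. -/
def MatchRel (y z : Fin (k + 1) → Literal n) (l l' : Literal n) : Prop :=
  ∃ j, (l = matchFst y z j ∧ l' = matchSnd y z j) ∨ (l' = matchFst y z j ∧ l = matchSnd y z j)

/-- The event that all edges between the literals of a snake are edges of its matching or
join two of the six literals that the matching leaves uncovered. -/
def inducedEvent (E : X → X → Prop) (c : Literal n) (y z : Fin (k + 1) → Literal n) :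
    Set (Literal n → X) :=
  {ω | ∀ l l' : Literal n, l.1 ∈ snakeVars c y z → l'.1 ∈ snakeVars c y z → l ≠ l' →
    E (ω l) (ω l') → (l ∈ hookSet c y z ∧ l' ∈ hookSet c y z) ∨ MatchRel y z l l'}

/-- The two paths with two edges that pass through `c` and through `¬c`. -/
def hookEvent (E : X → X → Prop) (c : Literal n) (y z : Fin (k + 1) → Literal n) :
    Set (Literal n → X) :=
  (Set.univ ∩ edge E (y 0) c ∩ edge E (y (Fin.last k)).neg c) ∩
    edge E (z 0) c.neg ∩ edge E (z (Fin.last k)).neg c.neg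

lemma card_snakeVars_le (c : Literal n) (y z : Fin (k + 1) → Literal n) :
    (snakeVars c y z).card ≤ 2 * k + 3 := by
  refine (Finset.card_insert_le _ _).trans ?_
  have h := Finset.card_union_le (Finset.univ.image (fun i => (y i).1))
    (Finset.univ.image (fun i => (z i).1))
  have h1 : (Finset.univ.image (fun i => (y i).1)).card ≤ k + 1 :=
    Finset.card_image_le.trans (by simp)
  have h2 : (Finset.univ.image (fun i => (z i).1)).card ≤ k + 1 :=
    Finset.card_image_le.trans (by simp)
  omega

lemma card_hookSet_le (c : Literal n) (y z : Fin (k + 1) → Literal n) :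
    (hookSet c y z).card ≤ 6 := by
  unfold hookSet
  exact Finset.card_le_six

lemma mem_snakeVars_c (c : Literal n) (y z : Fin (k + 1) → Literal n) :
    c.1 ∈ snakeVars c y z := Finset.mem_insert_self _ _

lemma mem_snakeVars_y (c : Literal n) (y z : Fin (k + 1) → Literal n) (i : Fin (k + 1)) :
    (y i).1 ∈ snakeVars c y z := by
  refine Finset.mem_insert_of_mem (Finset.mem_union_left _ ?_)
  exact Finset.mem_image_of_mem (fun i => (y i).1) (Finset.mem_univ i)

lemma mem_snakeVars_z (c : Literal n) (y z : Fin (k + 1) → Literal n) (i : Fin (k + 1)) :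
    (z i).1 ∈ snakeVars c y z := by
  refine Finset.mem_insert_of_mem (Finset.mem_union_right _ ?_)
  exact Finset.mem_image_of_mem (fun i => (z i).1) (Finset.mem_univ i)

namespace DistinctVars

variable {c : Literal n} {y z : Fin (k + 1) → Literal n}

lemma y_inj (hd : DistinctVars c y z) {i j : Fin (k + 1)} (h : (y i).1 = (y j).1) : i = j :=
  hd.injy h

lemma z_inj (hd : DistinctVars c y z) {i j : Fin (k + 1)} (h : (z i).1 = (z j).1) : i = j :=
  hd.injz h

lemma matchFst_injective (hd : DistinctVars c y z) : Function.Injective (matchFst y z) := by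
  rintro (i | i) (j | j) h
  · have := hd.y_inj (i := i.castSucc) (j := j.castSucc) (congrArg Prod.fst h :)
    rw [Fin.castSucc_injective _ this]
  · exact absurd (congrArg Prod.fst h :) (hd.yz i.castSucc j.castSucc)
  · exact absurd (congrArg Prod.fst h :).symm (hd.yz j.castSucc i.castSucc)
  · have := hd.z_inj (i := i.castSucc) (j := j.castSucc) (congrArg Prod.fst h :)
    rw [Fin.castSucc_injective _ this]

lemma matchSnd_injective (hd : DistinctVars c y z) : Function.Injective (matchSnd y z) := by
  rintro (i | i) (j | j) h
  · have := hd.y_inj (i := i.succ) (j := j.succ) (congrArg Prod.fst h :)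
    rw [Fin.succ_injective _ this]
  · exact absurd (congrArg Prod.fst h :) (hd.yz i.succ j.succ)
  · exact absurd (congrArg Prod.fst h :).symm (hd.yz j.succ i.succ)
  · have := hd.z_inj (i := i.succ) (j := j.succ) (congrArg Prod.fst h :)
    rw [Fin.succ_injective _ this]

lemma matchFst_ne_matchSnd (hd : DistinctVars c y z) (i j : Fin k ⊕ Fin k) :
    matchFst y z i ≠ matchSnd y z j := by
  intro h
  rcases i with i | i <;> rcases j with j | j
  · have e := hd.y_inj (i := i.castSucc) (j := j.succ) (congrArg Prod.fst h :)
    simp only [matchFst, matchSnd, Sum.elim_inl, ← e] at h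
    exact Literal.neg_ne _ h
  · exact absurd (congrArg Prod.fst h :) (hd.yz i.castSucc j.succ)
  · exact absurd (congrArg Prod.fst h :).symm (hd.yz j.succ i.castSucc)
  · have e := hd.z_inj (i := i.castSucc) (j := j.succ) (congrArg Prod.fst h :)
    simp only [matchFst, matchSnd, Sum.elim_inr, ← e] at h
    exact Literal.neg_ne _ h

/-- The matching of a snake has no vertex in the hook set. -/
lemma matchFst_notMem_hookSet (hd : DistinctVars c y z) (j : Fin k ⊕ Fin k) :
    matchFst y z j ∉ hookSet c y z := by
  intro h
  simp only [hookSet, Finset.mem_insert, Finset.mem_singleton] at h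
  rcases j with i | i
  · simp only [matchFst, Sum.elim_inl] at h
    rcases h with h | h | h | h | h | h
    · exact hd.cy i.castSucc (congrArg Prod.fst h :).symm
    · exact hd.cy i.castSucc (congrArg Prod.fst h :).symm
    · have e := hd.y_inj (i := i.castSucc) (j := 0) (congrArg Prod.fst h :)
      rw [e] at h
      exact Literal.neg_ne _ h
    · have e := hd.y_inj (i := i.castSucc) (j := Fin.last k) (congrArg Prod.fst h :)
      exact (Fin.castSucc_lt_last i).ne e
    · exact hd.yz i.castSucc 0 (congrArg Prod.fst h :)
    · exact hd.yz i.castSucc (Fin.last k) (congrArg Prod.fst h :)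
  · simp only [matchFst, Sum.elim_inr] at h
    rcases h with h | h | h | h | h | h
    · exact hd.cz i.castSucc (congrArg Prod.fst h :).symm
    · exact hd.cz i.castSucc (congrArg Prod.fst h :).symm
    · exact hd.yz 0 i.castSucc (congrArg Prod.fst h :).symm
    · exact hd.yz (Fin.last k) i.castSucc (congrArg Prod.fst h :).symm
    · have e := hd.z_inj (i := i.castSucc) (j := 0) (congrArg Prod.fst h :)
      rw [e] at h
      exact Literal.neg_ne _ h
    · have e := hd.z_inj (i := i.castSucc) (j := Fin.last k) (congrArg Prod.fst h :)
      exact (Fin.castSucc_lt_last i).ne e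

lemma matchSnd_notMem_hookSet (hd : DistinctVars c y z) (j : Fin k ⊕ Fin k) :
    matchSnd y z j ∉ hookSet c y z := by
  intro h
  simp only [hookSet, Finset.mem_insert, Finset.mem_singleton] at h
  rcases j with i | i
  · simp only [matchSnd, Sum.elim_inl] at h
    rcases h with h | h | h | h | h | h
    · exact hd.cy i.succ (congrArg Prod.fst h :).symm
    · exact hd.cy i.succ (congrArg Prod.fst h :).symm
    · have e := hd.y_inj (i := i.succ) (j := 0) (congrArg Prod.fst h :)
      exact Fin.succ_ne_zero i e
    · have e := hd.y_inj (i := i.succ) (j := Fin.last k) (congrArg Prod.fst h :)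
      rw [e] at h
      exact Literal.neg_ne _ h.symm
    · exact hd.yz i.succ 0 (congrArg Prod.fst h :)
    · exact hd.yz i.succ (Fin.last k) (congrArg Prod.fst h :)
  · simp only [matchSnd, Sum.elim_inr] at h
    rcases h with h | h | h | h | h | h
    · exact hd.cz i.succ (congrArg Prod.fst h :).symm
    · exact hd.cz i.succ (congrArg Prod.fst h :).symm
    · exact hd.yz 0 i.succ (congrArg Prod.fst h :).symm
    · exact hd.yz (Fin.last k) i.succ (congrArg Prod.fst h :).symm
    · have e := hd.z_inj (i := i.succ) (j := 0) (congrArg Prod.fst h :)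
      exact Fin.succ_ne_zero i e
    · have e := hd.z_inj (i := i.succ) (j := Fin.last k) (congrArg Prod.fst h :)
      rw [e] at h
      exact Literal.neg_ne _ h.symm

/-- Each literal has at most one partner in the matching. -/
lemma matchRel_unique (hd : DistinctVars c y z) {l l' l'' : Literal n} (h : MatchRel y z l l')
    (h' : MatchRel y z l l'') : l' = l'' := by
  obtain ⟨i, ⟨h1, h2⟩ | ⟨h1, h2⟩⟩ := h <;> obtain ⟨j, ⟨h3, h4⟩ | ⟨h3, h4⟩⟩ := h'
  · have := hd.matchFst_injective (h1.symm.trans h3)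
    rw [h2, h4, this]
  · exact absurd (h1.symm.trans h4) (hd.matchFst_ne_matchSnd i j)
  · exact absurd (h3.symm.trans h2) (hd.matchFst_ne_matchSnd j i)
  · have := hd.matchSnd_injective (h2.symm.trans h4)
    rw [h1, h3, this]

end DistinctVars

lemma MatchRel.fst_notMem_hookSet {c : Literal n} {y z : Fin (k + 1) → Literal n}
    (hd : DistinctVars c y z) {l l' : Literal n} (h : MatchRel y z l l') :
    l ∉ hookSet c y z := by
  obtain ⟨j, ⟨rfl, -⟩ | ⟨-, rfl⟩⟩ := h
  · exact hd.matchFst_notMem_hookSet j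
  · exact hd.matchSnd_notMem_hookSet j

namespace EdgeRel

variable {c : Literal n} {y z : Fin (k + 1) → Literal n}

lemma snakeEvent_eq (h : EdgeRel ν E p q) : snakeEvent E c y z =
    hookEvent E c y z ∩
      ⋂ j ∈ (Finset.univ : Finset (Fin k ⊕ Fin k)), edge E (matchFst y z j) (matchSnd y z j) := by
  have hs : ∀ a b, E a b ↔ E b a := fun a b => ⟨h.symm a b, h.symm b a⟩
  ext ω
  simp only [snakeEvent, halfEvent, HalfSnake, hookEvent, edge, Set.mem_inter_iff, Set.mem_iInter,
    Set.mem_ofPred_eq, Finset.mem_univ, forall_const, Sum.forall, matchFst, matchSnd,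
    Sum.elim_inl, Sum.elim_inr, Set.mem_univ, true_and, hs (ω (y 0)) (ω c),
    hs (ω (z 0)) (ω c.neg)]
  tauto

lemma measurableSet_hookEvent (h : EdgeRel ν E p q) : MeasurableSet (hookEvent E c y z) :=
  (((MeasurableSet.univ.inter (h.measurableSet_edge _ _)).inter (h.measurableSet_edge _ _)).inter
    (h.measurableSet_edge _ _)).inter (h.measurableSet_edge _ _)

lemma measurableSet_snakeEvent (h : EdgeRel ν E p q) : MeasurableSet (snakeEvent E c y z) := by
  rw [h.snakeEvent_eq]
  exact h.measurableSet_hookEvent.inter (h.measurableSet_biInter_edge _ _ _)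

lemma dep_hookEvent : Dep (hookEvent E c y z) (hookSet c y z : Set (Literal n)) := by
  refine ((((dep_univ _).inter (dep_edge E ?_ ?_)).inter (dep_edge E ?_ ?_)).inter
    (dep_edge E ?_ ?_)).inter (dep_edge E ?_ ?_) <;> simp [hookSet]

lemma real_snakeEvent_eq (h : EdgeRel ν E p q) (hd : DistinctVars c y z) :
    (Measure.pi (fun _ : Literal n => ν)).real (snakeEvent E c y z) =
      p ^ (2 * k) * (Measure.pi (fun _ : Literal n => ν)).real (hookEvent E c y z) := by
  rw [h.snakeEvent_eq, h.real_inter_matching_eq h.measurableSet_hookEvent dep_hookEvent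
    hd.matchFst_injective hd.matchSnd_injective hd.matchFst_ne_matchSnd
    (by simpa using hd.matchFst_notMem_hookSet) (by simpa using hd.matchSnd_notMem_hookSet)]
  simp [two_mul]

lemma le_real_hookEvent (h : EdgeRel ν E p q) (hd : DistinctVars c y z) :
    p ^ 4 ≤ (Measure.pi (fun _ : Literal n => ν)).real (hookEvent E c y z) := by
  have hy : y 0 ≠ (y (Fin.last k)).neg := by
    intro e
    have := hd.y_inj (i := 0) (j := Fin.last k) (congrArg Prod.fst e :)
    rw [← this] at e
    exact Literal.neg_ne _ e.symm
  have hz : z 0 ≠ (z (Fin.last k)).neg := by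
    intro e
    have := hd.z_inj (i := 0) (j := Fin.last k) (congrArg Prod.fst e :)
    rw [← this] at e
    exact Literal.neg_ne _ e.symm
  have h1 := h.sq_mul_le_real_inter_path (ι := Literal n) (G := Set.univ) (D := ∅)
    MeasurableSet.univ (dep_univ _) (a := y 0) (b := c) (c := (y (Fin.last k)).neg)
    (by simp) (by simp) (by simp) (Literal.ne_of_fst_ne (hd.cy 0).symm)
    (Literal.ne_of_fst_ne (hd.cy (Fin.last k))) hy
  have hdep : Dep (Set.univ ∩ edge E (y 0) c ∩ edge E (y (Fin.last k)).neg c :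
      Set (Literal n → X)) {y 0, c, (y (Fin.last k)).neg} :=
    ((dep_univ _).inter (dep_edge E (by simp) (by simp))).inter (dep_edge E (by simp) (by simp))
  have h2 := h.sq_mul_le_real_inter_path (ι := Literal n)
    ((MeasurableSet.univ.inter (h.measurableSet_edge (y 0) c)).inter
      (h.measurableSet_edge (y (Fin.last k)).neg c)) hdep
    (a := z 0) (b := c.neg) (c := (z (Fin.last k)).neg) ?_ ?_ ?_
    (Literal.ne_of_fst_ne (hd.cz 0).symm)
    (Literal.ne_of_fst_ne (hd.cz (Fin.last k))) hz
  · calc p ^ 4 = p ^ 2 * (p ^ 2 * (Measure.pi (fun _ : Literal n => ν)).real Set.univ) := by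
          rw [probReal_univ]; ring
      _ ≤ p ^ 2 * _ := by gcongr
      _ ≤ _ := h2
  · rintro (e | e | e)
    · exact hd.yz 0 0 (congrArg Prod.fst e :).symm
    · exact hd.cz 0 (congrArg Prod.fst e :).symm
    · exact hd.yz (Fin.last k) 0 (congrArg Prod.fst e :).symm
  · rintro (e | e | e)
    · exact hd.cy 0 (congrArg Prod.fst e :)
    · exact Literal.neg_ne _ e
    · exact hd.cy (Fin.last k) (congrArg Prod.fst e :)
  · rintro (e | e | e)
    · exact hd.yz 0 (Fin.last k) (congrArg Prod.fst e :).symm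
    · exact hd.cz (Fin.last k) (congrArg Prod.fst e :).symm
    · exact hd.yz (Fin.last k) (Fin.last k) (congrArg Prod.fst e :).symm

/-- An additional edge that neither belongs to the matching nor stays inside the hook set makes
the graph of the snake a larger forest, which costs a factor of order `q`. -/
lemma real_snakeEvent_inter_edge_le (h : EdgeRel ν E p q) (hd : DistinctVars c y z) {C : ℝ}
    (hC : 1 ≤ C) (hqp : q ≤ C * p) {l l' : Literal n} (hne : l ≠ l')
    (hS : ¬ (l ∈ hookSet c y z ∧ l' ∈ hookSet c y z)) (hm : ¬ MatchRel y z l l') :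
    (Measure.pi (fun _ : Literal n => ν)).real (snakeEvent E c y z ∩ edge E l l') ≤
      C ^ 4 * q * (Measure.pi (fun _ : Literal n => ν)).real (snakeEvent E c y z) := by
  classical
  have hp := h.p_nonneg
  have hq := h.q_nonneg
  have h1 : (Measure.pi (fun _ : Literal n => ν)).real (hookEvent E c y z ∩ edge E l l') ≤
      q * (Measure.pi (fun _ : Literal n => ν)).real (hookEvent E c y z) := by
    by_cases hl : l ∈ hookSet c y z
    · have hl' : l' ∉ hookSet c y z := fun hl' => hS ⟨hl, hl'⟩
      rw [h.edge_comm]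
      exact h.real_inter_edge_le h.measurableSet_hookEvent dep_hookEvent (by simpa using hl')
        hne.symm
    · exact h.real_inter_edge_le h.measurableSet_hookEvent dep_hookEvent (by simpa using hl) hne
  set D : Set (Literal n) := (hookSet c y z : Set (Literal n)) ∪ {l, l'} with hD
  have hdep : Dep (hookEvent E c y z ∩ edge E l l') D :=
    (dep_hookEvent.mono Set.subset_union_left).inter (dep_edge E (by simp) (by simp))
  have h2 := h.real_inter_matching_le
    (h.measurableSet_hookEvent.inter (h.measurableSet_edge l l')) hdep
    hd.matchFst_injective hd.matchSnd_injective hd.matchFst_ne_matchSnd Finset.univ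
  let t : Fin k ⊕ Fin k → ℕ := fun j =>
    ((if matchFst y z j = l then 1 else 0) + (if matchFst y z j = l' then 1 else 0)) +
    ((if matchSnd y z j = l then 1 else 0) + (if matchSnd y z j = l' then 1 else 0))
  have hone : ∀ (f : Fin k ⊕ Fin k → Literal n), Function.Injective f → ∀ x,
      ∑ j, (if f j = x then 1 else 0) ≤ 1 := by
    intro f hf x
    rw [Finset.sum_boole, Nat.cast_id, Finset.card_le_one]
    intro i hi j hj
    simp only [Finset.mem_filter, Finset.mem_univ, true_and] at hi hj
    exact hf (hi.trans hj.symm)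
  have ht : ∑ j, t j ≤ 4 := by
    simp only [t, Finset.sum_add_distrib]
    have e1 := hone _ hd.matchFst_injective l
    have e2 := hone _ hd.matchFst_injective l'
    have e3 := hone _ hd.matchSnd_injective l
    have e4 := hone _ hd.matchSnd_injective l'
    omega
  have hw : ∀ j, edgeWt p q D (matchFst y z j) (matchSnd y z j) ≤ p * C ^ t j := by
    intro j
    have ha := hd.matchFst_notMem_hookSet j
    have hb := hd.matchSnd_notMem_hookSet j
    have hab := hd.matchFst_ne_matchSnd j j
    have hDa : matchFst y z j ∈ D ↔ matchFst y z j = l ∨ matchFst y z j = l' := by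
      simp [hD, ha]
    have hDb : matchSnd y z j ∈ D ↔ matchSnd y z j = l ∨ matchSnd y z j = l' := by
      simp [hD, hb]
    have hnot : ¬ (matchFst y z j ∈ D ∧ matchSnd y z j ∈ D) := by
      rw [hDa, hDb]
      rintro ⟨e1 | e1, e2 | e2⟩
      · exact hab (e1.trans e2.symm)
      · exact hm ⟨j, Or.inl ⟨e1.symm, e2.symm⟩⟩
      · exact hm ⟨j, Or.inr ⟨e1.symm, e2.symm⟩⟩
      · exact hab (e1.trans e2.symm)
    unfold edgeWt
    rw [if_neg hnot]
    split_ifs with ho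
    · have ht1 : 1 ≤ t j := by
        rw [hDa, hDb] at ho
        rcases ho with (e | e) | (e | e) <;> simp only [t, e, if_true] <;> omega
      calc q ≤ p * C := by linarith
        _ ≤ p * C ^ t j := by
          gcongr
          exact le_self_pow₀ hC (by omega)
    · exact le_mul_of_one_le_right hp (one_le_pow₀ hC)
  have h3 : ∏ j, edgeWt p q D (matchFst y z j) (matchSnd y z j) ≤ p ^ (2 * k) * C ^ 4 := by
    calc ∏ j, edgeWt p q D (matchFst y z j) (matchSnd y z j) ≤ ∏ j, p * C ^ t j :=
          Finset.prod_le_prod (fun j _ => h.edgeWt_nonneg _ _ _) fun j _ => hw j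
      _ = p ^ (2 * k) * C ^ ∑ j, t j := by
          rw [Finset.prod_mul_distrib, Finset.prod_pow_eq_pow_sum]
          simp [two_mul]
      _ ≤ _ := by gcongr
  rw [h.snakeEvent_eq, Set.inter_right_comm, ← h.snakeEvent_eq, h.real_snakeEvent_eq hd]
  calc _ ≤ _ := h2
    _ ≤ (p ^ (2 * k) * C ^ 4) *
        (q * (Measure.pi (fun _ : Literal n => ν)).real (hookEvent E c y z)) := by
        gcongr
    _ = _ := by ring

lemma measurableSet_inducedEvent (h : EdgeRel ν E p q) :
    MeasurableSet (inducedEvent E c y z) := by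
  have : inducedEvent E c y z = ⋂ l : Literal n, ⋂ l' : Literal n,
      ⋂ (_ : l.1 ∈ snakeVars c y z ∧ l'.1 ∈ snakeVars c y z ∧ l ≠ l' ∧
        ¬ ((l ∈ hookSet c y z ∧ l' ∈ hookSet c y z) ∨ MatchRel y z l l')), (edge E l l')ᶜ := by
    ext ω
    simp only [inducedEvent, edge, Set.mem_ofPred_eq, Set.mem_iInter, Set.mem_compl_iff]
    refine forall₂_congr fun l l' => ?_
    tauto
  rw [this]
  exact MeasurableSet.iInter fun l => MeasurableSet.iInter fun l' => MeasurableSet.iInter fun _ =>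
    (h.measurableSet_edge l l').compl

lemma real_snakeEvent_diff_inducedEvent_le (h : EdgeRel ν E p q) (hd : DistinctVars c y z) {C : ℝ}
    (hC : 1 ≤ C) (hqp : q ≤ C * p) :
    (Measure.pi (fun _ : Literal n => ν)).real (snakeEvent E c y z \ inducedEvent E c y z) ≤
      (2 * (2 * k + 3)) ^ 2 * (C ^ 4 * q *
        (Measure.pi (fun _ : Literal n => ν)).real (snakeEvent E c y z)) := by
  classical
  have hq := h.q_nonneg
  let V := snakeVars c y z
  let T : Finset (Literal n × Literal n) :=
    ((V ×ˢ Finset.univ) ×ˢ (V ×ˢ Finset.univ)).filter fun x =>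
      x.1 ≠ x.2 ∧ ¬ (x.1 ∈ hookSet c y z ∧ x.2 ∈ hookSet c y z) ∧ ¬ MatchRel y z x.1 x.2
  have hT : (T.card : ℝ) ≤ (2 * (2 * k + 3)) ^ 2 := by
    have h1 : T.card ≤ (V.card * 2) * (V.card * 2) := by
      refine (Finset.card_filter_le _ _).trans ?_
      simp [Finset.card_product]
    have h2 : V.card ≤ 2 * k + 3 := card_snakeVars_le c y z
    have h3 : T.card ≤ (2 * (2 * k + 3)) ^ 2 := by
      refine h1.trans ?_
      rw [sq]
      exact Nat.mul_le_mul (by omega) (by omega)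
    exact_mod_cast h3
  have hsub : snakeEvent E c y z \ inducedEvent E c y z ⊆
      ⋃ x ∈ T, snakeEvent E c y z ∩ edge E x.1 x.2 := by
    rintro ω ⟨hω, hni⟩
    simp only [inducedEvent, Set.mem_ofPred_eq] at hni
    push Not at hni
    obtain ⟨l, l', hl, hl', hne, hE, hS, hm⟩ := hni
    simp only [Set.mem_iUnion]
    refine ⟨(l, l'), ?_, hω, hE⟩
    simp only [T, Finset.mem_filter, Finset.mem_product, Finset.mem_univ, and_true]
    exact ⟨⟨hl, hl'⟩, hne, fun hh => hS hh.1 hh.2, hm⟩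
  refine (measureReal_mono hsub (measure_ne_top _ _)).trans
    ((measureReal_biUnion_finset_le _ _).trans ?_)
  calc ∑ x ∈ T, (Measure.pi (fun _ : Literal n => ν)).real (snakeEvent E c y z ∩ edge E x.1 x.2)
      ≤ ∑ x ∈ T, C ^ 4 * q *
        (Measure.pi (fun _ : Literal n => ν)).real (snakeEvent E c y z) := by
        refine Finset.sum_le_sum fun x hx => ?_
        simp only [T, Finset.mem_filter] at hx
        exact h.real_snakeEvent_inter_edge_le hd hC hqp hx.2.1 hx.2.2.1 hx.2.2.2
    _ = T.card * (C ^ 4 * q *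
        (Measure.pi (fun _ : Literal n => ν)).real (snakeEvent E c y z)) := by
        rw [Finset.sum_const, nsmul_eq_mul]
    _ ≤ _ := by gcongr

/-- The probability that a given snake is present, without unwanted edges between its literals. -/
lemma le_real_induced_snake (h : EdgeRel ν E p q) (hd : DistinctVars c y z) {C : ℝ}
    (hC : 1 ≤ C) (hqp : q ≤ C * p) (hsmall : (2 * (2 * k + 3)) ^ 2 * (C ^ 4 * q) ≤ 1 / 2) :
    p ^ (2 * k + 4) / 2 ≤ (Measure.pi (fun _ : Literal n => ν)).real
      (snakeEvent E c y z ∩ inducedEvent E c y z) := by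
  have h1 := h.real_snakeEvent_diff_inducedEvent_le hd hC hqp
  have h2 := measureReal_inter_add_sdiff (μ := Measure.pi (fun _ : Literal n => ν))
    (s := snakeEvent E c y z) (h.measurableSet_inducedEvent (c := c) (y := y) (z := z))
  have h3 : p ^ (2 * k + 4) ≤
      (Measure.pi (fun _ : Literal n => ν)).real (snakeEvent E c y z) := by
    rw [h.real_snakeEvent_eq hd, pow_add]
    have := h.p_nonneg
    gcongr
    exact h.le_real_hookEvent hd
  have h4 : (0 : ℝ) ≤ (Measure.pi (fun _ : Literal n => ν)).real (snakeEvent E c y z) :=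
    measureReal_nonneg
  nlinarith

end EdgeRel

end Snake

/-! ### A half snake in the presence of a given snake -/

section Half

set_option linter.unusedSectionVars false

variable {X : Type*} [MeasurableSpace X] {ν : Measure X} [IsProbabilityMeasure ν]
  {E : X → X → Prop} {p q : ℝ} {n k : ℕ}

/-- The factor of an implication `l → l'` when the points of the literals on `V` are placed. -/
noncomputable def stepWt (p q : ℝ) (V : Finset (Fin n)) (l l' : Literal n) : ℝ :=
  if l.1 ∈ V ∧ l'.1 ∈ V then 1 else if l.1 ∈ V ∨ l'.1 ∈ V then q else p

/-- The factor of an edge that attaches `l` to a placed point. -/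
noncomputable def leafWt (q : ℝ) (V : Finset (Fin n)) (l : Literal n) : ℝ :=
  if l.1 ∈ V then 1 else q

/-- The factor of the path `y₀ — c — ¬y_k` when the points of the literals on `V` and the interior
of the half snake are placed. If only `c` is not placed, its two edges together cost one factor,
since both neighbours of `c` may be close to each other. -/
noncomputable def hookWt (q : ℝ) (V : Finset (Fin n)) (c y₀ y₁ : Literal n) : ℝ :=
  if c.1 ∈ V then leafWt q V y₀ * leafWt q V y₁
  else if y₀.1 ∈ V then q * leafWt q V y₁ else q * q

lemma leafWt_nonneg (hq : 0 ≤ q) (V : Finset (Fin n)) (l : Literal n) : 0 ≤ leafWt q V l := by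
  unfold leafWt
  split_ifs <;> positivity

lemma hookWt_nonneg (hq : 0 ≤ q) (V : Finset (Fin n)) (c y₀ y₁ : Literal n) :
    0 ≤ hookWt q V c y₀ y₁ := by
  have := leafWt_nonneg hq V y₀
  have := leafWt_nonneg hq V y₁
  unfold hookWt
  split_ifs <;> positivity

lemma hookWt_of_mem {V : Finset (Fin n)} {y₀ : Literal n} (h : y₀.1 ∈ V) (c y₁ : Literal n) :
    hookWt q V c y₀ y₁ = leafWt q V y₁ * leafWt q V c := by
  by_cases hc : c.1 ∈ V <;> simp [hookWt, leafWt, h, hc, mul_comm]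

lemma hookWt_of_notMem {V : Finset (Fin n)} {y₀ : Literal n} (h : y₀.1 ∉ V) (c y₁ : Literal n) :
    hookWt q V c y₀ y₁ = q * (if c.1 ∈ V then leafWt q V y₁ else q) := by
  by_cases hc : c.1 ∈ V <;> simp [hookWt, leafWt, h, hc]

namespace EdgeRel

lemma measurableSet_halfEvent (h : EdgeRel ν E p q) (c : Literal n)
    (y : Fin (k + 1) → Literal n) : MeasurableSet (halfEvent E c y) := by
  have : halfEvent E c y = (edge E c (y 0) ∩ edge E (y (Fin.last k)).neg c) ∩
      ⋂ j ∈ (Finset.univ : Finset (Fin k)), edge E (y j.castSucc).neg (y j.succ) := by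
    ext ω
    simp [halfEvent, HalfSnake, edge]
  rw [this]
  exact ((h.measurableSet_edge _ _).inter (h.measurableSet_edge _ _)).inter
    (h.measurableSet_biInter_edge _ _ _)

set_option maxHeartbeats 800000 in
/-- The probability of a half snake on new points, given an event that depends on the points in
`D`: its interior is a matching, and the two remaining edges are leaves where possible. -/
lemma real_inter_halfEvent_le (h : EdgeRel ν E p q) (hq1 : q ≤ 1) {G : Set (Literal n → X)}
    {D : Set (Literal n)} (hG : MeasurableSet G) (hD : Dep G D) (V : Finset (Fin n))
    {c : Literal n} {y : Fin (k + 1) → Literal n}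
    (hinj : Function.Injective fun i => (y i).1) (hc : ∀ i, c.1 ≠ (y i).1)
    (hDy : ∀ i, (y i).1 ∉ V → y i ∉ D ∧ (y i).neg ∉ D) (hDc : c.1 ∉ V → c ∉ D) :
    (Measure.pi (fun _ : Literal n => ν)).real (G ∩ halfEvent E c y) ≤
      hookWt q V c (y 0) (y (Fin.last k)) * (∏ i : Fin k, stepWt p q V (y i.castSucc) (y i.succ)) *
        (Measure.pi (fun _ : Literal n => ν)).real G := by
  classical
  have hp := h.p_nonneg
  have hq := h.q_nonneg
  have hpq := h.p_le_q
  have hinj' : ∀ i j, (y i).1 = (y j).1 → i = j := fun _ _ e => hinj e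
  set M : Set (Literal n → X) :=
    ⋂ j ∈ (Finset.univ : Finset (Fin k)), edge E (y j.castSucc).neg (y j.succ) with hM
  have hmatch := h.real_inter_matching_le hG hD
    (a := fun t : Fin k => (y t.castSucc).neg) (b := fun t => y t.succ)
    (fun s t hst => by
      have := hinj' s.castSucc t.castSucc (congrArg Prod.fst hst :)
      exact Fin.castSucc_injective _ this)
    (fun s t hst => Fin.succ_injective _ (hinj' s.succ t.succ (congrArg Prod.fst hst :)))
    (fun s t hst => by
      have e := hinj' s.castSucc t.succ (congrArg Prod.fst hst :)
      simp only [← e] at hst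
      exact Literal.neg_ne _ hst) Finset.univ
  have hprod : ∏ j, edgeWt p q D (y (Fin.castSucc j)).neg (y j.succ) ≤
      ∏ i : Fin k, stepWt p q V (y i.castSucc) (y i.succ) := by
    refine Finset.prod_le_prod (fun j _ => h.edgeWt_nonneg _ _ _) fun j _ => ?_
    have ha := fun hh => (hDy j.castSucc hh).2
    have hb := fun hh => (hDy j.succ hh).1
    unfold edgeWt stepWt
    split_ifs <;> first | tauto | linarith
  have hM1 : (Measure.pi (fun _ : Literal n => ν)).real (G ∩ M) ≤
      (∏ i : Fin k, stepWt p q V (y i.castSucc) (y i.succ)) *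
        (Measure.pi (fun _ : Literal n => ν)).real G := by
    refine hmatch.trans ?_
    gcongr
  have hGM : MeasurableSet (G ∩ M) := hG.inter (h.measurableSet_biInter_edge _ _ _)
  set D₁ : Set (Literal n) :=
    D ∪ {l | ∃ t : Fin k, l = (y t.castSucc).neg ∨ l = y t.succ} with hD₁
  have hdep : Dep (G ∩ M) D₁ := (hD.mono Set.subset_union_left).inter
    (Dep.biInter fun t _ => dep_edge E (Or.inr ⟨t, Or.inl rfl⟩) (Or.inr ⟨t, Or.inr rfl⟩))
  have hy0 : (y 0).1 ∉ V → y 0 ∉ D₁ := by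
    rintro hV (hh | ⟨t, ht | ht⟩)
    · exact (hDy 0 hV).1 hh
    · have e := hinj' 0 t.castSucc (congrArg Prod.fst ht :)
      rw [← e] at ht
      exact Literal.neg_ne _ ht.symm
    · exact Fin.succ_ne_zero t (hinj' 0 t.succ (congrArg Prod.fst ht :)).symm
  have hyk : (y (Fin.last k)).1 ∉ V → (y (Fin.last k)).neg ∉ D₁ := by
    rintro hV (hh | ⟨t, ht | ht⟩)
    · exact (hDy (Fin.last k) hV).2 hh
    · exact (Fin.castSucc_lt_last t).ne' (hinj' (Fin.last k) t.castSucc (congrArg Prod.fst ht :))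
    · have e := hinj' (Fin.last k) t.succ (congrArg Prod.fst ht :)
      rw [← e] at ht
      exact Literal.neg_ne _ ht
  have hcD : c.1 ∉ V → c ∉ D₁ := by
    rintro hV (hh | ⟨t, ht | ht⟩)
    · exact hDc hV hh
    · exact hc t.castSucc (congrArg Prod.fst ht :)
    · exact hc t.succ (congrArg Prod.fst ht :)
  have h0k : y 0 ≠ (y (Fin.last k)).neg := by
    intro e
    have := hinj' 0 (Fin.last k) (congrArg Prod.fst e :)
    rw [← this] at e
    exact Literal.neg_ne _ e.symm
  have hc0 : c ≠ y 0 := Literal.ne_of_fst_ne (hc 0)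
  have hck : (y (Fin.last k)).neg ≠ c := Literal.ne_of_fst_ne (hc (Fin.last k)).symm
  have hnn : (0 : ℝ) ≤ (Measure.pi (fun _ : Literal n => ν)).real (G ∩ M) := measureReal_nonneg
  have hset : G ∩ halfEvent E c y = G ∩ M ∩ edge E c (y 0) ∩ edge E (y (Fin.last k)).neg c := by
    ext ω
    simp only [halfEvent, HalfSnake, hM, edge, Set.mem_inter_iff, Set.mem_iInter,
      Set.mem_ofPred_eq, Finset.mem_univ, forall_const]
    tauto
  -- The two hook edges are added in the order that leaves a new point for each: the edge at `y 0`
  -- comes first if `y 0` is already placed, and last if it is new.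
  have hfirst : (y 0).1 ∈ V → (Measure.pi (fun _ : Literal n => ν)).real (G ∩ halfEvent E c y) ≤
      leafWt q V (y (Fin.last k)) * (leafWt q V c *
        (Measure.pi (fun _ : Literal n => ν)).real (G ∩ M)) := by
    intro hV
    rw [hset]
    have s1 : (Measure.pi (fun _ : Literal n => ν)).real (G ∩ M ∩ edge E c (y 0)) ≤
        leafWt q V c * (Measure.pi (fun _ : Literal n => ν)).real (G ∩ M) := by
      unfold leafWt
      split_ifs with hcV
      · rw [one_mul]
        exact measureReal_mono Set.inter_subset_left
      · exact h.real_inter_edge_le hGM hdep (hcD hcV) hc0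
    have hdep2 : Dep (G ∩ M ∩ edge E c (y 0)) (D₁ ∪ {c, y 0}) :=
      (hdep.mono Set.subset_union_left).inter (dep_edge E (by simp) (by simp))
    have s2 : (Measure.pi (fun _ : Literal n => ν)).real
        (G ∩ M ∩ edge E c (y 0) ∩ edge E (y (Fin.last k)).neg c) ≤ leafWt q V (y (Fin.last k)) *
        (Measure.pi (fun _ : Literal n => ν)).real (G ∩ M ∩ edge E c (y 0)) := by
      unfold leafWt
      split_ifs with hkV
      · rw [one_mul]
        exact measureReal_mono Set.inter_subset_left
      · refine h.real_inter_edge_le (hGM.inter (h.measurableSet_edge _ _)) hdep2 ?_ hck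
        rintro (hh | hh | hh)
        · exact hyk hkV hh
        · exact hck hh
        · exact h0k hh.symm
    exact s2.trans (mul_le_mul_of_nonneg_left s1 (leafWt_nonneg hq _ _))
  have hsecond : (y 0).1 ∉ V → (Measure.pi (fun _ : Literal n => ν)).real (G ∩ halfEvent E c y) ≤
      q * ((if c.1 ∈ V then leafWt q V (y (Fin.last k)) else q) *
        (Measure.pi (fun _ : Literal n => ν)).real (G ∩ M)) := by
    intro hV
    rw [hset, Set.inter_right_comm]
    have s1 : (Measure.pi (fun _ : Literal n => ν)).real
        (G ∩ M ∩ edge E (y (Fin.last k)).neg c) ≤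
        (if c.1 ∈ V then leafWt q V (y (Fin.last k)) else q) *
        (Measure.pi (fun _ : Literal n => ν)).real (G ∩ M) := by
      unfold leafWt
      split_ifs with hcV hkV
      · rw [one_mul]
        exact measureReal_mono Set.inter_subset_left
      · exact h.real_inter_edge_le hGM hdep (hyk hkV) hck
      · rw [h.edge_comm]
        exact h.real_inter_edge_le hGM hdep (hcD hcV) hck.symm
    have hdep2 : Dep (G ∩ M ∩ edge E (y (Fin.last k)).neg c) (D₁ ∪ {(y (Fin.last k)).neg, c}) :=
      (hdep.mono Set.subset_union_left).inter (dep_edge E (by simp) (by simp))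
    have s2 : (Measure.pi (fun _ : Literal n => ν)).real
        (G ∩ M ∩ edge E (y (Fin.last k)).neg c ∩ edge E c (y 0)) ≤ q *
        (Measure.pi (fun _ : Literal n => ν)).real (G ∩ M ∩ edge E (y (Fin.last k)).neg c) := by
      rw [h.edge_comm c]
      refine h.real_inter_edge_le (hGM.inter (h.measurableSet_edge _ _)) hdep2 ?_ hc0.symm
      rintro (hh | hh | hh)
      · exact hy0 hV hh
      · exact h0k hh
      · exact hc0 hh.symm
    exact s2.trans (mul_le_mul_of_nonneg_left s1 hq)
  have hmain : (Measure.pi (fun _ : Literal n => ν)).real (G ∩ halfEvent E c y) ≤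
      hookWt q V c (y 0) (y (Fin.last k)) *
        (Measure.pi (fun _ : Literal n => ν)).real (G ∩ M) := by
    by_cases hV : (y 0).1 ∈ V
    · rw [hookWt_of_mem hV, mul_assoc]
      exact hfirst hV
    · rw [hookWt_of_notMem hV, mul_assoc]
      exact hsecond hV
  refine hmain.trans ?_
  rw [mul_assoc]
  exact mul_le_mul_of_nonneg_left hM1 (hookWt_nonneg hq _ _ _ _)

lemma dep_halfEvent {c : Literal n} {y : Fin (k + 1) → Literal n} {D : Set (Literal n)}
    (hc : c ∈ D) (hy : ∀ i, y i ∈ D ∧ (y i).neg ∈ D) : Dep (halfEvent E c y) D := by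
  intro ω ω' hω
  have h1 := hω c hc
  have h2 := fun i => hω _ (hy i).1
  have h3 := fun i => hω _ (hy i).2
  simp only [halfEvent, HalfSnake, Set.mem_ofPred_eq, h1, h2, h3]

end EdgeRel

/-- An implication from `l` to `l'` that the induced event of a snake allows. -/
def AllowedStep (c : Literal n) (y z : Fin (k + 1) → Literal n) (l l' : Literal n) : Prop :=
  (l.neg ∈ hookSet c y z ∧ l' ∈ hookSet c y z) ∨ MatchRel y z l.neg l'

/-- A choice of an allowed successor for each literal of a snake. A literal whose complement is
matched has only one successor; the others, at most six in number, get theirs from `τ`. -/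
noncomputable def select (c : Literal n) (y z : Fin (k + 1) → Literal n)
    (τ : hookSet c y z → hookSet c y z) (l : Literal n) : Literal n :=
  open Classical in
  if h : l.neg ∈ hookSet c y z then τ ⟨l.neg, h⟩
  else if h : ∃ l', MatchRel y z l.neg l' then h.choose else l

lemma card_select_le (c : Literal n) (y z : Fin (k + 1) → Literal n) :
    Fintype.card (hookSet c y z → hookSet c y z) ≤ 6 ^ 6 := by
  have h := card_hookSet_le c y z
  have hpos : 0 < (hookSet c y z).card := Finset.card_pos.2 ⟨c, by simp [hookSet]⟩
  rw [Fintype.card_fun, Fintype.card_coe]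
  calc _ ≤ 6 ^ (hookSet c y z).card := Nat.pow_le_pow_left h _
    _ ≤ 6 ^ 6 := Nat.pow_le_pow_right (by norm_num) h

/-- A path through distinct variables that uses allowed steps inside a set of variables `V`
follows one of the selections there. -/
lemma exists_select {c : Literal n} {y z : Fin (k + 1) → Literal n} (hd : DistinctVars c y z)
    {m : ℕ} {w : Fin (m + 1) → Literal n} (hw : Function.Injective fun i => (w i).1)
    (V : Finset (Fin n)) (hstep : ∀ i : Fin m, (w i.castSucc).1 ∈ V → (w i.succ).1 ∈ V →
      AllowedStep c y z (w i.castSucc) (w i.succ)) :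
    ∃ τ : hookSet c y z → hookSet c y z, ∀ i : Fin m, (w i.castSucc).1 ∈ V → (w i.succ).1 ∈ V →
      w i.succ = select c y z τ (w i.castSucc) := by
  classical
  -- the variables of the path are distinct, so that it leaves each literal at most once
  let τ : hookSet c y z → hookSet c y z := fun x =>
    if h : ∃ i : Fin m, (w i.castSucc).neg = x.1 ∧ w i.succ ∈ hookSet c y z then
      ⟨w h.choose.succ, h.choose_spec.2⟩ else x
  refine ⟨τ, fun i hi hi' => ?_⟩
  unfold select
  rcases hstep i hi hi' with ⟨h1, h2⟩ | hM
  · rw [dif_pos h1]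
    have hex : ∃ j : Fin m, (w j.castSucc).neg = (w i.castSucc).neg ∧
        w j.succ ∈ hookSet c y z := ⟨i, rfl, h2⟩
    have e : hex.choose = i := by
      have := hw (a₁ := hex.choose.castSucc) (a₂ := i.castSucc)
        (congrArg Prod.fst hex.choose_spec.1 :)
      exact Fin.castSucc_injective _ this
    simp only [τ]
    rw [dif_pos hex]
    simp only [e]
  · rw [dif_neg (hM.fst_notMem_hookSet hd)]
    have hex : ∃ l', MatchRel y z (w i.castSucc).neg l' := ⟨_, hM⟩
    rw [dif_pos hex]
    exact hd.matchRel_unique hM hex.choose_spec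

end Half

/-! ### Sums of path weights -/

section Transfer

variable {n k : ℕ}

/-- The sum of the weights `W` over all paths with `j` steps from `l`, where the last literal
carries the weight `f`. -/
noncomputable def pathSum (W : Literal n → Literal n → ℝ) (f : Literal n → ℝ) :
    ℕ → Literal n → ℝ
  | 0, l => f l
  | j + 1, l => ∑ l', W l l' * pathSum W f j l'

/-- The part of `pathSum` that comes from paths meeting the variables in `V`. -/
noncomputable def visitSum (W : Literal n → Literal n → ℝ) (f : Literal n → ℝ)
    (V : Finset (Fin n)) : ℕ → Literal n → ℝ
  | 0, l => if l.1 ∈ V then f l else 0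
  | j + 1, l => if l.1 ∈ V then pathSum W f (j + 1) l else ∑ l', W l l' * visitSum W f V j l'

/-- The weight of a path. -/
noncomputable def pathWt (W : Literal n → Literal n → ℝ) (y : Fin (k + 1) → Literal n) : ℝ :=
  ∏ i : Fin k, W (y i.castSucc) (y i.succ)

lemma pathWt_cons (W : Literal n → Literal n → ℝ) (l : Literal n) (y : Fin (k + 1) → Literal n) :
    pathWt W (Fin.cons l y : Fin (k + 2) → Literal n) = W l (y 0) * pathWt W y := by
  simp only [pathWt]
  rw [Fin.prod_univ_succ]
  simp

lemma sum_fin_succ_fun {α : Type*} [Fintype α] (F : (Fin (k + 1) → α) → ℝ) :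
    ∑ y, F y = ∑ l, ∑ y : Fin k → α, F (Fin.cons l y) := by
  rw [← Fintype.sum_prod_type', ← (Fin.consEquiv fun _ : Fin (k + 1) => α).sum_comp]
  rfl

lemma sum_pathWt (W : Literal n → Literal n → ℝ) (f g : Literal n → ℝ) :
    ∑ y : Fin (k + 1) → Literal n, g (y 0) * pathWt W y * f (y (Fin.last k)) =
      ∑ l, g l * pathSum W f k l := by
  induction k generalizing g with
  | zero =>
    rw [sum_fin_succ_fun]
    simp [pathSum, pathWt]
  | succ k ih =>
    rw [sum_fin_succ_fun]
    refine Finset.sum_congr rfl fun l _ => ?_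
    rw [pathSum, ← ih, Finset.mul_sum]
    refine Finset.sum_congr rfl fun y _ => ?_
    rw [pathWt_cons, ← Fin.succ_last]
    simp only [Fin.cons_zero, Fin.cons_succ]
    ring

lemma sum_pathWt_visit (W : Literal n → Literal n → ℝ) (f g : Literal n → ℝ)
    (V : Finset (Fin n)) :
    ∑ y : Fin (k + 1) → Literal n,
      (if ∃ i, (y i).1 ∈ V then g (y 0) * pathWt W y * f (y (Fin.last k)) else 0) =
      ∑ l, g l * visitSum W f V k l := by
  induction k generalizing g with
  | zero =>
    rw [sum_fin_succ_fun]
    refine Finset.sum_congr rfl fun l _ => ?_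
    by_cases hl : l.1 ∈ V <;> simp [visitSum, pathWt, hl]
  | succ k ih =>
    rw [sum_fin_succ_fun]
    refine Finset.sum_congr rfl fun l _ => ?_
    by_cases hl : l.1 ∈ V
    · rw [visitSum, if_pos hl, pathSum, ← sum_pathWt, Finset.mul_sum]
      refine Finset.sum_congr rfl fun y _ => ?_
      rw [pathWt_cons, ← Fin.succ_last, if_pos ⟨0, by simpa using hl⟩]
      simp only [Fin.cons_zero, Fin.cons_succ]
      ring
    · rw [visitSum, if_neg hl, ← ih, Finset.mul_sum]
      refine Finset.sum_congr rfl fun y _ => ?_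
      have e : (∃ i : Fin (k + 1 + 1),
          ((Fin.cons l y : Fin (k + 2) → Literal n) i).1 ∈ V) ↔ ∃ i, (y i).1 ∈ V := by
        rw [Fin.exists_fin_succ]
        simp [hl]
      rw [pathWt_cons, ← Fin.succ_last]
      simp only [e, Fin.cons_zero, Fin.cons_succ]
      split_ifs
      · ring
      · simp

/-- The weight of an implication when the points of the literals on `V` are placed and the
implications inside `V` are those of `σ`. -/
noncomputable def selWt (p q : ℝ) (V : Finset (Fin n)) (σ : Literal n → Literal n)
    (l l' : Literal n) : ℝ :=
  if l.1 ∈ V ∧ l'.1 ∈ V then (if l' = σ l then 1 else 0)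
  else if l.1 ∈ V ∨ l'.1 ∈ V then q else p

variable {p q : ℝ} {V : Finset (Fin n)} {σ : Literal n → Literal n}

lemma selWt_nonneg (hp : 0 ≤ p) (hq : 0 ≤ q) (l l' : Literal n) : 0 ≤ selWt p q V σ l l' := by
  unfold selWt
  split_ifs <;> positivity

lemma pathWt_nonneg (hp : 0 ≤ p) (hq : 0 ≤ q) (y : Fin (k + 1) → Literal n) :
    0 ≤ pathWt (selWt p q V σ) y :=
  Finset.prod_nonneg fun _ _ => selWt_nonneg hp hq _ _

lemma sum_ite_mem_le {A F s : ℝ} (hA : 0 ≤ A) (hF : 0 ≤ F) (hs : (V.card : ℝ) ≤ s) :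
    ∑ l : Literal n, (if l.1 ∈ V then A else F) ≤ 2 * s * A + 2 * n * F := by
  calc ∑ l : Literal n, (if l.1 ∈ V then A else F)
      ≤ ∑ l : Literal n, ((if l.1 ∈ V then A else 0) + F) :=
        Finset.sum_le_sum fun l _ => by split_ifs <;> simp [hF]
    _ = 2 * V.card * A + 2 * n * F := by
        have e : ∑ l : Literal n, (if l.1 ∈ V then A else 0) = 2 * V.card * A := by
          rw [Fintype.sum_prod_type]
          change ∑ x : Fin n, ∑ _b : Bool, (if x ∈ V then A else 0) = _
          simp only [Finset.sum_const, Finset.card_univ, Fintype.card_bool, nsmul_eq_mul,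
            ← Finset.mul_sum, Finset.sum_ite_mem, Finset.univ_inter]
          push_cast
          ring
        rw [Finset.sum_add_distrib, e, Finset.sum_const, Finset.card_univ, Fintype.card_prod,
          Fintype.card_bool, Fintype.card_fin, nsmul_eq_mul]
        push_cast
        ring
    _ ≤ _ := by gcongr

lemma sum_selWt_mul_le_of_notMem (hp : 0 ≤ p) (hq : 0 ≤ q) {A F s : ℝ} (hA : 0 ≤ A) (hF : 0 ≤ F)
    (hs : (V.card : ℝ) ≤ s) {u : Literal n → ℝ} (hu : ∀ l, l.1 ∈ V → u l ≤ A)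
    (hu' : ∀ l, l.1 ∉ V → u l ≤ F) {l : Literal n} (hl : l.1 ∉ V) :
    ∑ l', selWt p q V σ l l' * u l' ≤ 2 * n * p * F + 2 * s * q * A := by
  calc ∑ l', selWt p q V σ l l' * u l'
      ≤ ∑ l' : Literal n, (if l'.1 ∈ V then q * A else p * F) := by
        refine Finset.sum_le_sum fun l' _ => ?_
        by_cases hl' : l'.1 ∈ V
        · simp only [selWt, hl, hl', false_and, if_false, or_true, if_true]
          exact mul_le_mul_of_nonneg_left (hu _ hl') hq
        · simp only [selWt, hl, hl', false_and, if_false, or_false]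
          exact mul_le_mul_of_nonneg_left (hu' _ hl') hp
    _ ≤ _ := sum_ite_mem_le (by positivity) (by positivity) hs
    _ = _ := by ring

lemma sum_selWt_mul_le_of_mem (hq : 0 ≤ q) {A F : ℝ} (hA : 0 ≤ A) (hF : 0 ≤ F)
    {u : Literal n → ℝ} (hu : ∀ l, l.1 ∈ V → u l ≤ A)
    (hu' : ∀ l, l.1 ∉ V → u l ≤ F) {l : Literal n} (hl : l.1 ∈ V) :
    ∑ l', selWt p q V σ l l' * u l' ≤ 2 * n * q * F + A := by
  calc ∑ l', selWt p q V σ l l' * u l'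
      ≤ ∑ l' : Literal n, (q * F + if l' = σ l then A else 0) := by
        refine Finset.sum_le_sum fun l' _ => ?_
        have hqF : 0 ≤ q * F := by positivity
        by_cases hl' : l'.1 ∈ V
        · simp only [selWt, hl, hl', and_self, if_true]
          have := hu _ hl'
          split_ifs <;> simp <;> linarith
        · simp only [selWt, hl, hl', and_false, if_false, true_or, if_true]
          have := mul_le_mul_of_nonneg_left (hu' _ hl') hq
          split_ifs <;> simp <;> linarith
    _ = _ := by
        rw [Finset.sum_add_distrib]
        simp
        ring

/-- Bounds for path sums. A path that is off `V` gains a factor `2np` per step, and it pays the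
factor `2sq` for each entry into `V`; on `V` it is deterministic. -/
lemma pathSum_le (hp : 0 ≤ p) (hq : 0 ≤ q) (hlam : 1 ≤ 2 * n * p) {s D ε f₀ a₀ : ℝ}
    (hs : (V.card : ℝ) ≤ s) (hD0 : 0 ≤ D) (hD : 2 * n * q + D ≤ D * (2 * n * p))
    (hε : k * (2 * s * q) ≤ ε) (hεD : ε * D ≤ 1 / 2) {f : Literal n → ℝ}
    (hf₀ : 0 ≤ f₀) (ha₀ : 0 ≤ a₀) (hf : ∀ l, l.1 ∉ V → f l ≤ f₀) (ha : ∀ l, l.1 ∈ V → f l ≤ a₀) :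
    ∀ j ≤ k, (∀ l, l.1 ∉ V → pathSum (selWt p q V σ) f j l ≤
        2 * (f₀ + ε * a₀) * (2 * n * p) ^ j) ∧
      (∀ l, l.1 ∈ V → pathSum (selWt p q V σ) f j l ≤
        a₀ + D * (2 * (f₀ + ε * a₀)) * (2 * n * p) ^ j) ∧
      ∀ l, l.1 ∉ V → visitSum (selWt p q V σ) f V j l ≤
        ε * (a₀ + D * (2 * (f₀ + ε * a₀))) * (2 * n * p) ^ j := by
  have hs0 : 0 ≤ s := le_trans (by positivity) hs
  have hκ : 0 ≤ 2 * s * q := by positivity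
  have hε0 : 0 ≤ ε := le_trans (by positivity) hε
  set F := 2 * (f₀ + ε * a₀) with hF
  have hF0 : 0 ≤ F := by positivity
  set lam := 2 * n * p with hlamdef
  have hB : 0 ≤ a₀ + D * F := by positivity
  -- a bound that is uniform in `j` follows from one that grows linearly
  have hlin : ∀ j ≤ k, j * (2 * s * q) ≤ ε := by
    intro j hj
    refine le_trans ?_ hε
    gcongr
  have key : ∀ j ≤ k, (∀ l, l.1 ∉ V → pathSum (selWt p q V σ) f j l ≤
        (f₀ + j * (2 * s * q) * (a₀ + D * F)) * lam ^ j) ∧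
      (∀ l, l.1 ∈ V → pathSum (selWt p q V σ) f j l ≤ a₀ + D * F * lam ^ j) ∧
      ∀ l, l.1 ∉ V → visitSum (selWt p q V σ) f V j l ≤
        j * (2 * s * q) * (a₀ + D * F) * lam ^ j := by
    intro j hj
    induction j with
    | zero =>
      refine ⟨fun l hl => ?_, fun l hl => ?_, fun l hl => ?_⟩
      · simpa [pathSum] using hf l hl
      · simp only [pathSum, pow_zero, mul_one]
        have := ha l hl
        have : 0 ≤ D * F := by positivity
        linarith
      · simp [visitSum, hl]
    | succ j ih =>
      obtain ⟨h1, h2, h3⟩ := ih (by omega)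
      have hpow : 1 ≤ lam ^ j := one_le_pow₀ hlam
      have hpow' : lam ^ j ≤ lam ^ (j + 1) := pow_le_pow_right₀ hlam (by omega)
      have hA : a₀ + D * F * lam ^ j ≤ (a₀ + D * F) * lam ^ (j + 1) := by
        have : a₀ * 1 ≤ a₀ * lam ^ (j + 1) := by gcongr; exact hpow.trans hpow'
        have : D * F * lam ^ j ≤ D * F * lam ^ (j + 1) := by gcongr
        linarith
      have hFj : ∀ l, l.1 ∉ V → pathSum (selWt p q V σ) f j l ≤ F * lam ^ j := by
        intro l hl
        refine (h1 l hl).trans ?_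
        have e1 : j * (2 * s * q) * (a₀ + D * F) ≤ ε * (a₀ + D * F) := by
          gcongr
          exact hlin j (by omega)
        have e2 : ε * D * F ≤ 1 / 2 * F := by gcongr
        gcongr
        nlinarith
      refine ⟨fun l hl => ?_, fun l hl => ?_, fun l hl => ?_⟩
      · rw [pathSum]
        refine (sum_selWt_mul_le_of_notMem hp hq (by positivity) (by positivity) hs h2 h1
          hl).trans ?_
        calc _ ≤ lam * ((f₀ + j * (2 * s * q) * (a₀ + D * F)) * lam ^ j) +
              2 * s * q * ((a₀ + D * F) * lam ^ (j + 1)) := by gcongr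
          _ = _ := by push_cast; ring
      · rw [pathSum]
        refine (sum_selWt_mul_le_of_mem hq (by positivity) (by positivity) h2 hFj hl).trans ?_
        have : (2 * n * q + D) * (F * lam ^ j) ≤ D * lam * (F * lam ^ j) := by gcongr
        rw [pow_succ]
        linarith
      · rw [visitSum, if_neg hl]
        have h2' : ∀ l, l.1 ∈ V → visitSum (selWt p q V σ) f V j l ≤ a₀ + D * F * lam ^ j := by
          intro l hl
          have e : visitSum (selWt p q V σ) f V j l = pathSum (selWt p q V σ) f j l := by
            cases j <;> simp [visitSum, pathSum, hl]
          rw [e]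
          exact h2 l hl
        refine (sum_selWt_mul_le_of_notMem hp hq (by positivity) (by positivity) hs h2' h3
          hl).trans ?_
        calc _ ≤ lam * (j * (2 * s * q) * (a₀ + D * F) * lam ^ j) +
              2 * s * q * ((a₀ + D * F) * lam ^ (j + 1)) := by gcongr
          _ = _ := by push_cast; ring
  intro j hj
  obtain ⟨h1, h2, h3⟩ := key j hj
  have e1 : j * (2 * s * q) * (a₀ + D * F) ≤ ε * (a₀ + D * F) := by
    gcongr
    exact hlin j hj
  refine ⟨fun l hl => (h1 l hl).trans ?_, h2, fun l hl => (h3 l hl).trans ?_⟩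
  · have e2 : ε * D * F ≤ 1 / 2 * F := by gcongr
    gcongr
    nlinarith
  · gcongr

/-- The parameters of a supercritical model with paths of `k` steps and at most `s` placed
variables: `D` bounds the geometric series of the excursions, and `ε` the cost of all
excursions of a path. -/
structure TransferBounds (n k : ℕ) (p q s D ε : ℝ) : Prop where
  p_nonneg : 0 ≤ p
  q_nonneg : 0 ≤ q
  one_le_s : 1 ≤ s
  D_nonneg : 0 ≤ D
  one_le : 1 ≤ 2 * n * p
  le_D : 2 * n * q + D ≤ D * (2 * n * p)
  le_ε : k * (2 * s * q) ≤ ε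
  ε_mul_D : ε * D ≤ 1 / 2
  ε_le_one : ε ≤ 1
  q_le_ε : q ≤ ε
  /-- The paths are so long that their number makes up for the cost of meeting the placed
  variables. -/
  one_le_mul : 1 ≤ ε * (2 * n * p) ^ k

namespace TransferBounds

variable {s D ε b : ℝ}

lemma ε_nonneg (t : TransferBounds n k p q s D ε) : 0 ≤ ε := t.q_nonneg.trans t.q_le_ε

/-- Path sums with a hook edge at the last literal: a path that ends off `V` pays `q ≤ ε`, and one
that ends on `V` has paid for an excursion or started there. -/
lemma pathSum_leafWt_le (t : TransferBounds n k p q s D ε) (hs : (V.card : ℝ) ≤ s)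
    (l : Literal n) :
    pathSum (selWt p q V σ) (leafWt q V) k l ≤
      if l.1 ∈ V then (1 + 4 * D) * (ε * (2 * n * p) ^ k) else 4 * (ε * (2 * n * p) ^ k) := by
  have hlin := pathSum_le (σ := σ) (V := V) (f := leafWt q V) t.p_nonneg t.q_nonneg t.one_le hs
    t.D_nonneg t.le_D t.le_ε t.ε_mul_D t.q_nonneg zero_le_one (fun l hl => by simp [leafWt, hl])
    (fun l hl => by simp [leafWt, hl]) k le_rfl
  have hF : 2 * (q + ε * 1) ≤ 4 * ε := by linarith [t.q_le_ε]
  have hD := t.D_nonneg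
  have hε := t.ε_nonneg
  have hpow : 0 ≤ (2 * n * p) ^ k := pow_nonneg (zero_le_one.trans t.one_le) k
  split_ifs with hl
  · refine (hlin.2.1 l hl).trans ?_
    have h1 := t.one_le_mul
    have : D * (2 * (q + ε * 1)) * (2 * n * p) ^ k ≤ D * (4 * ε) * (2 * n * p) ^ k := by gcongr
    linarith
  · refine (hlin.1 l hl).trans ?_
    have : 2 * (q + ε * 1) * (2 * n * p) ^ k ≤ 4 * ε * (2 * n * p) ^ k := by gcongr
    linarith

/-- The total weight of the half snakes with middle literal `c` on `V`: both hook edges end at a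
placed point. -/
lemma sum_hookWt_of_mem_le (t : TransferBounds n k p q s D ε) (hs : (V.card : ℝ) ≤ s)
    (hb : 2 * n * q ≤ b) {c : Literal n} (hc : c.1 ∈ V) :
    ∑ y : Fin (k + 1) → Literal n,
      hookWt q V c (y 0) (y (Fin.last k)) * pathWt (selWt p q V σ) y ≤
      (2 + 4 * b) * (1 + 4 * D) * s * (ε * (2 * n * p) ^ k) := by
  have hq := t.q_nonneg
  have hD := t.D_nonneg
  have hε := t.ε_nonneg
  have h1s := t.one_le_s
  have hpow : 0 ≤ (2 * n * p) ^ k := pow_nonneg (zero_le_one.trans t.one_le) k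
  have hb0 : 0 ≤ b := le_trans (by positivity) hb
  set Y := ε * (2 * n * p) ^ k with hY
  have hY0 : 0 ≤ Y := by positivity
  calc ∑ y : Fin (k + 1) → Literal n,
      hookWt q V c (y 0) (y (Fin.last k)) * pathWt (selWt p q V σ) y
      = ∑ y : Fin (k + 1) → Literal n,
        leafWt q V (y 0) * pathWt (selWt p q V σ) y * leafWt q V (y (Fin.last k)) := by
        refine Finset.sum_congr rfl fun y _ => ?_
        rw [hookWt, if_pos hc]
        ring
    _ = ∑ l, leafWt q V l * pathSum (selWt p q V σ) (leafWt q V) k l :=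
        sum_pathWt _ _ _
    _ ≤ ∑ l : Literal n, (if l.1 ∈ V then (1 + 4 * D) * Y else q * (4 * Y)) := by
        refine Finset.sum_le_sum fun l _ => ?_
        have h := t.pathSum_leafWt_le (σ := σ) hs l
        by_cases hl : l.1 ∈ V
        · simpa [leafWt, hl] using h
        · simp only [leafWt, hl, if_false] at h ⊢
          gcongr
    _ ≤ 2 * s * ((1 + 4 * D) * Y) + 2 * n * (q * (4 * Y)) :=
        sum_ite_mem_le (by positivity) (by positivity) hs
    _ = 2 * s * ((1 + 4 * D) * Y) + (2 * n * q) * (4 * Y) := by ring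
    _ ≤ 2 * s * ((1 + 4 * D) * Y) + b * (s * (4 * Y)) * (1 + 4 * D) := by
        have e1 : (2 * n * q) * (4 * Y) ≤ b * (1 * (4 * Y)) * 1 := by
          rw [one_mul, mul_one]
          gcongr
        have e2 : b * (1 * (4 * Y)) * 1 ≤ b * (s * (4 * Y)) * (1 + 4 * D) := by
          gcongr
          linarith
        linarith
    _ = _ := by ring

/-- The total weight of the half snakes with middle literal `c` off `V`. -/
lemma sum_hookWt_of_notMem_le (t : TransferBounds n k p q s D ε) (hs : (V.card : ℝ) ≤ s)
    (hb : 2 * n * q ≤ b) {c : Literal n} (hc : c.1 ∉ V) :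
    ∑ y : Fin (k + 1) → Literal n,
      hookWt q V c (y 0) (y (Fin.last k)) * pathWt (selWt p q V σ) y ≤
      (2 + 4 * b) * (1 + 4 * D) * s * (q * (2 * n * p) ^ k) := by
  have hq := t.q_nonneg
  have hD := t.D_nonneg
  have hε := t.ε_nonneg
  have hε1 := t.ε_le_one
  have h1s := t.one_le_s
  have hpow : 0 ≤ (2 * n * p) ^ k := pow_nonneg (zero_le_one.trans t.one_le) k
  have hb0 : 0 ≤ b := le_trans (by positivity) hb
  set P := (2 * n * p) ^ k with hP
  have hlin := pathSum_le (σ := σ) (V := V) (f := fun _ => 1) t.p_nonneg t.q_nonneg t.one_le hs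
    t.D_nonneg t.le_D t.le_ε t.ε_mul_D zero_le_one zero_le_one (fun l hl => le_rfl)
    (fun l hl => le_rfl) k le_rfl
  calc ∑ y : Fin (k + 1) → Literal n,
      hookWt q V c (y 0) (y (Fin.last k)) * pathWt (selWt p q V σ) y
      = ∑ y : Fin (k + 1) → Literal n,
        ((if (y 0).1 ∈ V then q else 0) * pathWt (selWt p q V σ) y * leafWt q V (y (Fin.last k)) +
        (if (y 0).1 ∈ V then 0 else q * q) * pathWt (selWt p q V σ) y * 1) := by
        refine Finset.sum_congr rfl fun y _ => ?_
        rw [hookWt, if_neg hc]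
        split_ifs <;> ring
    _ = ∑ l : Literal n, (if l.1 ∈ V then q else 0) * pathSum (selWt p q V σ) (leafWt q V) k l +
        ∑ l : Literal n, (if l.1 ∈ V then 0 else q * q) *
          pathSum (selWt p q V σ) (fun _ => 1) k l := by
        rw [Finset.sum_add_distrib, ← sum_pathWt, ← sum_pathWt]
    _ ≤ ∑ l : Literal n, (if l.1 ∈ V then q * ((1 + 4 * D) * P) else q * q * (4 * P)) := by
        rw [← Finset.sum_add_distrib]
        refine Finset.sum_le_sum fun l _ => ?_
        by_cases hl : l.1 ∈ V
        · have h := t.pathSum_leafWt_le (σ := σ) hs l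
          have hεP : ε * P ≤ 1 * P := by gcongr
          simp only [hl, if_true, zero_mul, add_zero] at h ⊢
          gcongr
          refine h.trans ?_
          gcongr
          linarith
        · have h := hlin.1 l hl
          simp only [hl, if_false, zero_mul, zero_add]
          gcongr
          refine h.trans ?_
          gcongr
          linarith
    _ ≤ 2 * s * (q * ((1 + 4 * D) * P)) + 2 * n * (q * q * (4 * P)) :=
        sum_ite_mem_le (by positivity) (by positivity) hs
    _ = 2 * s * (q * ((1 + 4 * D) * P)) + (2 * n * q) * (q * (4 * P)) := by ring
    _ ≤ 2 * s * (q * ((1 + 4 * D) * P)) + b * (s * (q * (4 * P))) * (1 + 4 * D) := by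
        have e1 : (2 * n * q) * (q * (4 * P)) ≤ b * (1 * (q * (4 * P))) * 1 := by
          rw [one_mul, mul_one]
          gcongr
        have e2 : b * (1 * (q * (4 * P))) * 1 ≤ b * (s * (q * (4 * P))) * (1 + 4 * D) := by
          gcongr
          linarith
        linarith
    _ = _ := by ring

/-- Among the half snakes with middle literal `c` off `V`, those that meet `V` carry an additional
factor `ε`. -/
lemma sum_hookWt_visit_le (t : TransferBounds n k p q s D ε) (hs : (V.card : ℝ) ≤ s)
    (hb : 2 * n * q ≤ b) {c : Literal n} (hc : c.1 ∉ V) :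
    ∑ y : Fin (k + 1) → Literal n, (if ∃ i, (y i).1 ∈ V then
      hookWt q V c (y 0) (y (Fin.last k)) * pathWt (selWt p q V σ) y else 0) ≤
      (2 + 4 * b) * (1 + 4 * D) * s * (q * (ε * (2 * n * p) ^ k)) := by
  have hq := t.q_nonneg
  have hD := t.D_nonneg
  have hε := t.ε_nonneg
  have hε1 := t.ε_le_one
  have h1s := t.one_le_s
  have hpow : 0 ≤ (2 * n * p) ^ k := pow_nonneg (zero_le_one.trans t.one_le) k
  have hb0 : 0 ≤ b := le_trans (by positivity) hb
  set Y := ε * (2 * n * p) ^ k with hY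
  have hY0 : 0 ≤ Y := by positivity
  have hlin := pathSum_le (σ := σ) (V := V) (f := fun _ => 1) t.p_nonneg t.q_nonneg t.one_le hs
    t.D_nonneg t.le_D t.le_ε t.ε_mul_D zero_le_one zero_le_one (fun l hl => le_rfl)
    (fun l hl => le_rfl) k le_rfl
  calc ∑ y : Fin (k + 1) → Literal n, (if ∃ i, (y i).1 ∈ V then
      hookWt q V c (y 0) (y (Fin.last k)) * pathWt (selWt p q V σ) y else 0)
      = ∑ y : Fin (k + 1) → Literal n,
        ((if (y 0).1 ∈ V then q else 0) * pathWt (selWt p q V σ) y * leafWt q V (y (Fin.last k)) +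
        (if ∃ i, (y i).1 ∈ V then
          (if (y 0).1 ∈ V then 0 else q * q) * pathWt (selWt p q V σ) y * 1 else 0)) := by
        refine Finset.sum_congr rfl fun y _ => ?_
        rw [hookWt, if_neg hc]
        by_cases h0 : (y 0).1 ∈ V
        · have hex : ∃ i, (y i).1 ∈ V := ⟨0, h0⟩
          simp only [h0, hex, if_true]
          ring
        · simp only [h0, if_false]
          split_ifs <;> ring
    _ = ∑ l : Literal n, (if l.1 ∈ V then q else 0) * pathSum (selWt p q V σ) (leafWt q V) k l +
        ∑ l : Literal n, (if l.1 ∈ V then 0 else q * q) *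
          visitSum (selWt p q V σ) (fun _ => 1) V k l := by
        rw [Finset.sum_add_distrib, ← sum_pathWt, ← sum_pathWt_visit]
    _ ≤ ∑ l : Literal n, (if l.1 ∈ V then q * ((1 + 4 * D) * Y) else
          q * q * ((1 + 4 * D) * Y)) := by
        rw [← Finset.sum_add_distrib]
        refine Finset.sum_le_sum fun l _ => ?_
        by_cases hl : l.1 ∈ V
        · have h := t.pathSum_leafWt_le (σ := σ) hs l
          simp only [hl, if_true, zero_mul, add_zero] at h ⊢
          gcongr
        · have h := hlin.2.2 l hl
          simp only [hl, if_false, zero_mul, zero_add]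
          gcongr
          refine h.trans ?_
          have e : 1 + D * (2 * (1 + ε * 1)) ≤ 1 + 4 * D := by nlinarith
          calc _ = (1 + D * (2 * (1 + ε * 1))) * Y := by rw [hY]; ring
            _ ≤ _ := by gcongr
    _ ≤ 2 * s * (q * ((1 + 4 * D) * Y)) + 2 * n * (q * q * ((1 + 4 * D) * Y)) :=
        sum_ite_mem_le (by positivity) (by positivity) hs
    _ = 2 * s * (q * ((1 + 4 * D) * Y)) + (2 * n * q) * (q * ((1 + 4 * D) * Y)) := by ring
    _ ≤ 2 * s * (q * ((1 + 4 * D) * Y)) + (4 * b) * (s * (q * ((1 + 4 * D) * Y))) := by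
        have e1 : (2 * n * q) * (q * ((1 + 4 * D) * Y)) ≤ b * (1 * (q * ((1 + 4 * D) * Y))) := by
          rw [one_mul]
          gcongr
        have e2 : b * (1 * (q * ((1 + 4 * D) * Y))) ≤
            (4 * b) * (s * (q * ((1 + 4 * D) * Y))) := by
          gcongr
          linarith
        linarith
    _ = _ := by ring

end TransferBounds

end Transfer

/-! ### The second moment -/

/-- The second moment method for a finite family of events: Chebyshev's inequality for the number
of events that occur, where `R` bounds its variance. -/
lemma real_iInter_compl_mul_sq_le {Ω κ : Type*} [MeasurableSpace Ω] {P : Measure Ω}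
    [IsProbabilityMeasure P] (T : Finset κ) {G : κ → Set Ω} (hG : ∀ a ∈ T, MeasurableSet (G a))
    {R : ℝ} (hR : ∑ a ∈ T, ∑ b ∈ T, P.real (G a ∩ G b) ≤ (∑ a ∈ T, P.real (G a)) ^ 2 + R) :
    P.real (⋂ a ∈ T, (G a)ᶜ) * (∑ a ∈ T, P.real (G a)) ^ 2 ≤ R := by
  classical
  set m := ∑ a ∈ T, P.real (G a) with hm
  let Y : Ω → ℝ := fun ω => ∑ a ∈ T, (G a).indicator 1 ω
  have hind : ∀ a ∈ T, Integrable ((G a).indicator (1 : Ω → ℝ)) P := fun a ha =>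
    (integrable_const (1 : ℝ)).indicator (hG a ha)
  have hind2 : ∀ a ∈ T, ∀ b ∈ T, Integrable ((G a ∩ G b).indicator (1 : Ω → ℝ)) P :=
    fun a ha b hb => (integrable_const (1 : ℝ)).indicator ((hG a ha).inter (hG b hb))
  have hY : Integrable Y P := integrable_finsetSum _ hind
  have hsq : ∀ ω, (Y ω) ^ 2 = ∑ a ∈ T, ∑ b ∈ T, (G a ∩ G b).indicator 1 ω := by
    intro ω
    simp only [Y, sq, Finset.sum_mul_sum]
    refine Finset.sum_congr rfl fun a _ => Finset.sum_congr rfl fun b _ => ?_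
    by_cases ha : ω ∈ G a <;> by_cases hb : ω ∈ G b <;> simp [ha, hb]
  have hYsq : Integrable (fun ω => (Y ω) ^ 2) P := by
    simp only [hsq]
    exact integrable_finsetSum _ fun a ha => integrable_finsetSum _ fun b hb => hind2 a ha b hb
  have e1 : ∫ ω, Y ω ∂P = m := by
    rw [integral_finsetSum _ hind]
    exact Finset.sum_congr rfl fun a ha => integral_indicator_one (hG a ha)
  have e2 : ∫ ω, (Y ω) ^ 2 ∂P ≤ m ^ 2 + R := by
    refine le_trans (le_of_eq ?_) hR
    simp only [hsq]
    rw [integral_finsetSum _ fun a ha => integrable_finsetSum _ fun b hb => hind2 a ha b hb]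
    refine Finset.sum_congr rfl fun a ha => ?_
    rw [integral_finsetSum _ fun b hb => hind2 a ha b hb]
    exact Finset.sum_congr rfl fun b hb => integral_indicator_one ((hG a ha).inter (hG b hb))
  have hZ : MeasurableSet (⋂ a ∈ T, (G a)ᶜ) :=
    T.measurableSet_biInter fun a ha => (hG a ha).compl
  have hint : Integrable (fun ω => (Y ω) ^ 2 - 2 * m * Y ω + m ^ 2) P :=
    (hYsq.sub (hY.const_mul _)).add (integrable_const _)
  have e3 : ∫ ω, ((Y ω) ^ 2 - 2 * m * Y ω + m ^ 2) ∂P ≤ R := by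
    have h1 : Integrable (fun ω => (Y ω) ^ 2 - 2 * m * Y ω) P := hYsq.sub (hY.const_mul _)
    rw [integral_add h1 (integrable_const _),
      integral_sub hYsq (hY.const_mul _), integral_const_mul, e1]
    simp only [integral_const, probReal_univ, one_smul]
    nlinarith
  refine le_trans ?_ e3
  have e4 : ∫ ω, (⋂ a ∈ T, (G a)ᶜ).indicator (fun _ => m ^ 2) ω ∂P =
      P.real (⋂ a ∈ T, (G a)ᶜ) * m ^ 2 := by
    rw [integral_indicator_const _ hZ, smul_eq_mul]
  rw [← e4]
  refine integral_mono ((integrable_const _).indicator hZ) hint fun ω => ?_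
  by_cases hω : ω ∈ ⋂ a ∈ T, (G a)ᶜ
  · have h0 : Y ω = 0 := by
      refine Finset.sum_eq_zero fun a ha => ?_
      simp only [Set.mem_iInter] at hω
      simpa using hω a ha
    simp [Set.indicator_of_mem hω, h0]
  · simp only [Set.indicator_of_notMem hω]
    nlinarith [sq_nonneg (Y ω - m)]

/-- Events that depend on disjoint sets of coordinates are independent. -/
lemma real_inter_eq_mul_of_disjoint {X ι : Type*} [MeasurableSpace X] {ν : Measure X}
    [IsProbabilityMeasure ν] [Fintype ι] {G H : Set (ι → X)} {S T : Finset ι}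
    (hG : MeasurableSet G) (hH : MeasurableSet H) (hGS : Dep G (S : Set ι))
    (hHT : Dep H (T : Set ι)) (hST : Disjoint S T) :
    (Measure.pi (fun _ : ι => ν)).real (G ∩ H) =
      (Measure.pi (fun _ : ι => ν)).real G * (Measure.pi (fun _ : ι => ν)).real H := by
  classical
  obtain ⟨x₀⟩ := nonempty_of_isProbabilityMeasure ν
  have hind : iIndepFun (fun (i : ι) (ω : ι → X) => ω i) (Measure.pi fun _ : ι => ν) :=
    iIndepFun_pi (X := fun _ x => x) fun _ => aemeasurable_id
  have hST' := hind.indepFun_finset S T hST fun i => measurable_pi_apply i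
  -- a set that depends on `S` is pulled back along the restriction to `S`, by way of the
  -- extension of a function on `S` by the constant `x₀`
  have hext : ∀ S : Finset ι, Measurable fun (u : S → X) (i : ι) =>
      if h : i ∈ S then u ⟨i, h⟩ else x₀ := by
    intro S
    refine measurable_pi_lambda _ fun i => ?_
    by_cases h : i ∈ S
    · simp only [h, dif_pos]
      exact measurable_pi_apply _
    · simp only [h, dif_neg, not_false_eq_true]
      exact measurable_const
  have hpre : ∀ {G : Set (ι → X)} {S : Finset ι}, Dep G (S : Set ι) →
      G = (fun (ω : ι → X) (i : S) => ω i) ⁻¹'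
        ((fun (u : S → X) (i : ι) => if h : i ∈ S then u ⟨i, h⟩ else x₀) ⁻¹' G) := by
    intro G S hGS
    ext ω
    simp only [Set.mem_preimage]
    have := hGS (x := ω) (y := fun i => if i ∈ S then ω i else x₀) fun i hi => by
      simp [Finset.mem_coe.1 hi]
    simpa using this
  have := hST'.measure_inter_preimage_eq_mul _ _ (hext S hG) (hext T hH)
  rw [← hpre hGS, ← hpre hHT] at this
  rw [measureReal_def, this, ENNReal.toReal_mul]
  rfl

section Count

variable {n k : ℕ}

/-- The snakes with `2k + 3` variables. -/
noncomputable def snakes (n k : ℕ) :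
    Finset (Literal n × (Fin (k + 1) → Literal n) × (Fin (k + 1) → Literal n)) :=
  open Classical in Finset.univ.filter fun x => DistinctVars x.1 x.2.1 x.2.2

lemma mem_snakes {x : Literal n × (Fin (k + 1) → Literal n) × (Fin (k + 1) → Literal n)} :
    x ∈ snakes n k ↔ DistinctVars x.1 x.2.1 x.2.2 := by
  simp [snakes]

lemma descFactorial_mul_le_card_snakes :
    n.descFactorial (2 * k + 3) * 2 ^ (2 * k + 3) ≤ (snakes n k).card := by
  classical
  let ι := Option (Fin (k + 1) ⊕ Fin (k + 1))
  have hι : Fintype.card ι = 2 * k + 3 := by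
    simp only [ι, Fintype.card_option, Fintype.card_sum, Fintype.card_fin]
    omega
  have hcard : Fintype.card ((ι ↪ Fin n) × (ι → Bool)) =
      n.descFactorial (2 * k + 3) * 2 ^ (2 * k + 3) := by
    rw [Fintype.card_prod, Fintype.card_embedding_eq, Fintype.card_fun, hι, Fintype.card_fin,
      Fintype.card_bool]
  rw [← hcard, ← Finset.card_univ]
  refine Finset.card_le_card_of_injOn (fun w => ((w.1 none, w.2 none),
    (fun i => (w.1 (some (Sum.inl i)), w.2 (some (Sum.inl i)))),
    fun i => (w.1 (some (Sum.inr i)), w.2 (some (Sum.inr i))))) ?_ ?_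
  · rintro w -
    refine Finset.mem_coe.2 (mem_snakes.2 ⟨?_, ?_, ?_, ?_, ?_⟩)
    · intro i j hij
      exact Sum.inl_injective (Option.some_injective _ (w.1.injective hij))
    · intro i j hij
      exact Sum.inr_injective (Option.some_injective _ (w.1.injective hij))
    · intro i hij
      simpa using w.1.injective hij
    · intro i hij
      simpa using w.1.injective hij
    · intro i j hij
      have := Option.some_injective _ (w.1.injective hij)
      simp at this
  · rintro ⟨e, β⟩ - ⟨e', β'⟩ - h
    simp only [Prod.mk.injEq, funext_iff] at h
    obtain ⟨⟨h1, h2⟩, h3, h4⟩ := h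
    have he : e = e' := by
      ext x
      rcases x with _ | x | x
      · rw [h1]
      · rw [(h3 x).1]
      · rw [(h4 x).1]
    have hβ : β = β' := by
      ext x
      rcases x with _ | x | x
      · rw [h2]
      · rw [(h3 x).2]
      · rw [(h4 x).2]
    rw [he, hβ]

lemma le_card_snakes (h : 2 * (2 * k + 3) ^ 2 ≤ n) :
    (2 * n : ℝ) ^ (2 * k + 3) / 2 ≤ (snakes n k).card := by
  set s := 2 * k + 3 with hs
  have hsn : s ≤ n := by nlinarith
  have hn : (0 : ℝ) < n := by
    have : 0 < n := by omega
    exact_mod_cast this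
  have h1 : ((n + 1 - s : ℕ) : ℝ) ^ s * 2 ^ s ≤ (snakes n k).card := by
    have h2 := (Nat.mul_le_mul_right (2 ^ s) (Nat.pow_sub_le_descFactorial n s)).trans
      (descFactorial_mul_le_card_snakes (n := n) (k := k))
    exact_mod_cast h2
  refine le_trans ?_ h1
  -- Bernoulli's inequality
  have h3 : (1 : ℝ) / 2 ≤ (1 + -(s / n : ℝ)) ^ s := by
    have hb := one_add_mul_le_pow (a := -(s / n : ℝ)) (by
      have : (s : ℝ) / n ≤ 1 := (div_le_one hn).2 (by exact_mod_cast hsn)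
      linarith) s
    refine le_trans ?_ hb
    have : (s : ℝ) * (s / n) ≤ 1 / 2 := by
      rw [← mul_div_assoc, div_le_iff₀ hn]
      have : (2 : ℝ) * s ^ 2 ≤ n := by exact_mod_cast h
      linarith
    linarith
  have h4 : (n : ℝ) * (1 + -(s / n : ℝ)) ≤ ((n + 1 - s : ℕ) : ℝ) := by
    rw [Nat.cast_sub (by omega)]
    push_cast
    have : (n : ℝ) * (s / n) = s := by field_simp
    linarith
  have h5 : 0 ≤ 1 + -(s / n : ℝ) := by
    have : (s : ℝ) / n ≤ 1 := (div_le_one hn).2 (by exact_mod_cast hsn)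
    linarith
  calc (2 * n : ℝ) ^ s / 2 = (n : ℝ) ^ s * (1 / 2) * 2 ^ s := by rw [mul_pow]; ring
    _ ≤ (n : ℝ) ^ s * (1 + -(s / n : ℝ)) ^ s * 2 ^ s := by gcongr
    _ = ((n : ℝ) * (1 + -(s / n : ℝ))) ^ s * 2 ^ s := by rw [← mul_pow]
    _ ≤ _ := by gcongr

end Count

section SecondMoment

set_option linter.unusedSectionVars false

variable {X : Type*} [MeasurableSpace X] {ν : Measure X} [IsProbabilityMeasure ν]
  {E : X → X → Prop} {p q : ℝ} {n k : ℕ} {c : Literal n} {y z : Fin (k + 1) → Literal n}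

/-- The event that the snake is present without unwanted edges between its literals. -/
def goodEvent (E : X → X → Prop) (c : Literal n) (y z : Fin (k + 1) → Literal n) :
    Set (Literal n → X) :=
  snakeEvent E c y z ∩ inducedEvent E c y z

lemma dep_goodEvent : Dep (goodEvent E c y z)
    ((snakeVars c y z ×ˢ Finset.univ : Finset (Literal n)) : Set (Literal n)) := by
  have hc : ∀ l : Literal n, l.1 = c.1 →
      l ∈ ((snakeVars c y z ×ˢ Finset.univ : Finset (Literal n)) : Set (Literal n)) := by
    intro l hl
    simpa [hl] using mem_snakeVars_c c y z
  have hy : ∀ i (l : Literal n), l.1 = (y i).1 →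
      l ∈ ((snakeVars c y z ×ˢ Finset.univ : Finset (Literal n)) : Set (Literal n)) := by
    intro i l hl
    simpa [hl] using mem_snakeVars_y c y z i
  have hz : ∀ i (l : Literal n), l.1 = (z i).1 →
      l ∈ ((snakeVars c y z ×ˢ Finset.univ : Finset (Literal n)) : Set (Literal n)) := by
    intro i l hl
    simpa [hl] using mem_snakeVars_z c y z i
  refine ((EdgeRel.dep_halfEvent (E := E) (hc _ rfl) fun i => ⟨hy i _ rfl, hy i _ rfl⟩).inter
    (EdgeRel.dep_halfEvent (E := E) (c := c.neg) (hc _ rfl) fun i =>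
      ⟨hz i _ rfl, hz i _ rfl⟩)).inter ?_
  intro ω ω' hω
  simp only [inducedEvent, Set.mem_ofPred_eq, eq_iff_iff]
  refine forall₂_congr fun l l' => forall₂_congr fun hl hl' => ?_
  rw [hω l (by simpa using hl), hω l' (by simpa using hl')]

namespace EdgeRel

lemma measurableSet_goodEvent (h : EdgeRel ν E p q) : MeasurableSet (goodEvent E c y z) :=
  h.measurableSet_snakeEvent.inter h.measurableSet_inducedEvent

/-- The weight of a half snake, summed over the selections of the given snake. -/
noncomputable def halfWt (p q : ℝ) (c : Literal n) (y z : Fin (k + 1) → Literal n)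
    (c' : Literal n) (w : Fin (k + 1) → Literal n) : ℝ :=
  ∑ τ : hookSet c y z → hookSet c y z, hookWt q (snakeVars c y z) c' (w 0) (w (Fin.last k)) *
    pathWt (selWt p q (snakeVars c y z) (select c y z τ)) w

lemma halfWt_nonneg (h : EdgeRel ν E p q) (c' : Literal n) (w : Fin (k + 1) → Literal n) :
    0 ≤ halfWt p q c y z c' w :=
  Finset.sum_nonneg fun _ _ => mul_nonneg (hookWt_nonneg h.q_nonneg _ _ _ _)
    (pathWt_nonneg h.p_nonneg h.q_nonneg _)

/-- In the presence of a snake without unwanted edges, a half snake has steps between the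
variables of the snake only where the snake itself has them. -/
lemma allowedStep_of_mem {c' : Literal n} {w : Fin (k + 1) → Literal n} {ω : Literal n → X}
    (hw : Function.Injective fun i => (w i).1) (hω : ω ∈ goodEvent E c y z)
    (hω' : ω ∈ halfEvent E c' w) (i : Fin k) (hi : (w i.castSucc).1 ∈ snakeVars c y z)
    (hi' : (w i.succ).1 ∈ snakeVars c y z) :
    AllowedStep c y z (w i.castSucc) (w i.succ) := by
  refine hω.2 _ _ hi hi' ?_ (hω'.2 i)
  refine Literal.ne_of_fst_ne fun e => ?_
  have := hw (a₁ := i.castSucc) (a₂ := i.succ) e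
  exact (Fin.castSucc_lt_succ (i := i)).ne this

lemma hookWt_mul_prod_le_halfWt (h : EdgeRel ν E p q) (hd : DistinctVars c y z)
    {w : Fin (k + 1) → Literal n} (hw : Function.Injective fun i => (w i).1) (c' : Literal n)
    (hstep : ∀ i : Fin k, (w i.castSucc).1 ∈ snakeVars c y z → (w i.succ).1 ∈ snakeVars c y z →
      AllowedStep c y z (w i.castSucc) (w i.succ)) :
    hookWt q (snakeVars c y z) c' (w 0) (w (Fin.last k)) *
      ∏ i : Fin k, stepWt p q (snakeVars c y z) (w i.castSucc) (w i.succ) ≤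
      halfWt p q c y z c' w := by
  obtain ⟨τ, hτ⟩ := exists_select hd hw _ hstep
  have e : ∏ i : Fin k, stepWt p q (snakeVars c y z) (w i.castSucc) (w i.succ) =
      pathWt (selWt p q (snakeVars c y z) (select c y z τ)) w := by
    refine Finset.prod_congr rfl fun i _ => ?_
    unfold stepWt selWt
    split_ifs with h1 h2
    · rfl
    · exact absurd (hτ i h1.1 h1.2) h2
    · rfl
    · rfl
  rw [e]
  exact Finset.single_le_sum (f := fun τ => hookWt q (snakeVars c y z) c' (w 0) (w (Fin.last k)) *
    pathWt (selWt p q (snakeVars c y z) (select c y z τ)) w)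
    (fun _ _ => mul_nonneg (hookWt_nonneg h.q_nonneg _ _ _ _)
    (pathWt_nonneg h.p_nonneg h.q_nonneg _)) (Finset.mem_univ τ)

/-- The probability that a second snake is present together with a given one. -/
lemma real_goodEvent_inter_le (h : EdgeRel ν E p q) (hq1 : q ≤ 1) (hd : DistinctVars c y z)
    {c' : Literal n} {y' z' : Fin (k + 1) → Literal n} (hd' : DistinctVars c' y' z') :
    (Measure.pi (fun _ : Literal n => ν)).real (goodEvent E c y z ∩ goodEvent E c' y' z') ≤
      (Measure.pi (fun _ : Literal n => ν)).real (goodEvent E c y z) *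
        (halfWt p q c y z c' y' * halfWt p q c y z c'.neg z') := by
  classical
  have hW : 0 ≤ halfWt p q c y z c' y' * halfWt p q c y z c'.neg z' :=
    mul_nonneg (h.halfWt_nonneg _ _) (h.halfWt_nonneg _ _)
  have hsub : goodEvent E c y z ∩ goodEvent E c' y' z' ⊆
      goodEvent E c y z ∩ halfEvent E c' y' ∩ halfEvent E c'.neg z' :=
    fun ω hω => ⟨⟨hω.1, hω.2.1.1⟩, hω.2.1.2⟩
  rcases Set.eq_empty_or_nonempty (goodEvent E c y z ∩ goodEvent E c' y' z') with he | ⟨ω, hω⟩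
  · rw [he, measureReal_empty]
    exact mul_nonneg measureReal_nonneg hW
  set V := snakeVars c y z with hV
  have hG := h.measurableSet_goodEvent (n := n) (k := k) (c := c) (y := y) (z := z)
  have h1 := h.real_inter_halfEvent_le hq1 hG dep_goodEvent V (c := c') (y := y') hd'.injy hd'.cy
    (fun i hi => by constructor <;> simpa using hi) (fun hi => by simpa using hi)
  have hdep : Dep (goodEvent E c y z ∩ halfEvent E c' y')
      (((V ×ˢ Finset.univ : Finset (Literal n)) : Set (Literal n)) ∪
        ({c'} ∪ {l | ∃ i, l.1 = (y' i).1})) := by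
    refine (dep_goodEvent.mono Set.subset_union_left).inter (dep_halfEvent ?_ fun i => ⟨?_, ?_⟩)
    · exact Or.inr (Or.inl rfl)
    · exact Or.inr (Or.inr ⟨i, rfl⟩)
    · exact Or.inr (Or.inr ⟨i, rfl⟩)
  have h2 := h.real_inter_halfEvent_le hq1 (hG.inter (h.measurableSet_halfEvent c' y')) hdep V
    (c := c'.neg) (y := z') hd'.injz hd'.cz
    (fun i hi => by
      constructor
      · rintro (hh | hh | ⟨j, hh⟩)
        · exact hi (by simpa using hh)
        · exact hd'.cz i (congrArg Prod.fst hh :).symm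
        · exact hd'.yz j i hh.symm
      · rintro (hh | hh | ⟨j, hh⟩)
        · exact hi (by simpa using hh)
        · exact hd'.cz i (congrArg Prod.fst hh :).symm
        · exact hd'.yz j i hh.symm)
    (fun hi => by
      rintro (hh | hh | ⟨j, hh⟩)
      · exact hi (by simpa using hh)
      · exact Literal.neg_ne _ hh
      · exact hd'.cy j hh)
  have hy := h.hookWt_mul_prod_le_halfWt hd hd'.injy c'
    (allowedStep_of_mem hd'.injy hω.1 hω.2.1.1)
  have hz := h.hookWt_mul_prod_le_halfWt hd hd'.injz c'.neg
    (allowedStep_of_mem hd'.injz hω.1 hω.2.1.2)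
  have hnn : (0 : ℝ) ≤ (Measure.pi (fun _ : Literal n => ν)).real (goodEvent E c y z) :=
    measureReal_nonneg
  refine (measureReal_mono hsub (measure_ne_top _ _)).trans (h2.trans ?_)
  calc _ ≤ halfWt p q c y z c'.neg z' * (halfWt p q c y z c' y' *
        (Measure.pi (fun _ : Literal n => ν)).real (goodEvent E c y z)) := by
        refine mul_le_mul hz (h1.trans ?_) measureReal_nonneg (h.halfWt_nonneg _ _)
        exact mul_le_mul_of_nonneg_right hy hnn
    _ = _ := by ring

variable {s D ε b : ℝ}

/-- A bound for each selection gives a bound for `halfWt`, since there are at most `6 ^ 6`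
selections. The linear functions `F w` are needed to restrict the sum to paths that meet the
given snake. -/
lemma sum_halfWt_le (F : (Fin (k + 1) → Literal n) → ℝ → ℝ) {c' : Literal n} {B : ℝ}
    (hF : ∀ w (g : (hookSet c y z → hookSet c y z) → ℝ), F w (∑ τ, g τ) = ∑ τ, F w (g τ))
    (hB0 : 0 ≤ B) (hB : ∀ τ : hookSet c y z → hookSet c y z, ∑ w : Fin (k + 1) → Literal n,
      F w (hookWt q (snakeVars c y z) c' (w 0) (w (Fin.last k)) *
        pathWt (selWt p q (snakeVars c y z) (select c y z τ)) w) ≤ B) :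
    ∑ w : Fin (k + 1) → Literal n, F w (halfWt p q c y z c' w) ≤ 6 ^ 6 * B := by
  simp only [halfWt, hF]
  rw [Finset.sum_comm]
  calc _ ≤ ∑ _τ : hookSet c y z → hookSet c y z, B := Finset.sum_le_sum fun τ _ => hB τ
    _ = (Fintype.card (hookSet c y z → hookSet c y z) : ℝ) * B := by
        rw [Finset.sum_const, Finset.card_univ, nsmul_eq_mul]
    _ ≤ _ := by
        gcongr
        exact_mod_cast card_select_le c y z

/-- The conditional expectation of the number of snakes that meet a given snake. If their middle
variable is not on the given snake, then one of their two halves has to meet it, at the cost of a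
factor `ε`. -/
lemma sum_real_goodEvent_inter_le (h : EdgeRel ν E p q) (hq1 : q ≤ 1) (hd : DistinctVars c y z)
    (t : TransferBounds n k p q s D ε) (hs : (2 * k + 3 : ℝ) ≤ s) (hb : 2 * n * q ≤ b) :
    ∑ x ∈ (snakes n k).filter (fun x =>
      ¬ Disjoint (snakeVars c y z) (snakeVars x.1 x.2.1 x.2.2)),
      (Measure.pi (fun _ : Literal n => ν)).real
        (goodEvent E c y z ∩ goodEvent E x.1 x.2.1 x.2.2) ≤
      (Measure.pi (fun _ : Literal n => ν)).real (goodEvent E c y z) *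
        (2 * (1 + b) * (6 ^ 6 * ((2 + 4 * b) * (1 + 4 * D))) ^ 2 * s ^ 3 *
          ε ^ 2 * (2 * n * p) ^ (2 * k)) := by
  classical
  have hq := h.q_nonneg
  have hp := h.p_nonneg
  have hD := t.D_nonneg
  have hε := t.ε_nonneg
  have h1s := t.one_le_s
  have hb0 : 0 ≤ b := le_trans (by positivity) hb
  have hpow : 0 ≤ (2 * n * p) ^ k := by positivity
  set V := snakeVars c y z with hV
  have hcard : (V.card : ℝ) ≤ s := by
    refine le_trans ?_ hs
    exact_mod_cast card_snakeVars_le c y z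
  set Q := (2 + 4 * b) * (1 + 4 * D) with hQ
  have hQ0 : 0 ≤ Q := by positivity
  set P := (2 * n * p) ^ k with hP
  have hUnn := fun c' w => h.halfWt_nonneg (c := c) (y := y) (z := z) (k := k) c' w
  set U := halfWt p q c y z with hU
  -- the weight of the half snakes that meet `V`
  let Uv : Literal n → (Fin (k + 1) → Literal n) → ℝ := fun c' w =>
    if ∃ i, (w i).1 ∈ V then U c' w else 0
  have hUvnn : ∀ c' w, 0 ≤ Uv c' w := by
    intro c' w
    simp only [Uv]
    split_ifs
    · exact hUnn _ _
    · exact le_rfl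
  have hA : ∀ c' : Literal n, c'.1 ∈ V → ∑ w, U c' w ≤ 6 ^ 6 * (Q * s * (ε * P)) := fun c' hc' =>
    sum_halfWt_le (F := fun _ r => r) (fun _ _ => rfl) (by positivity)
      fun τ => t.sum_hookWt_of_mem_le hcard hb hc'
  have hFr : ∀ c' : Literal n, c'.1 ∉ V → ∑ w, U c' w ≤ 6 ^ 6 * (Q * s * (q * P)) := fun c' hc' =>
    sum_halfWt_le (F := fun _ r => r) (fun _ _ => rfl) (by positivity)
      fun τ => t.sum_hookWt_of_notMem_le hcard hb hc'
  have hVis : ∀ c' : Literal n, c'.1 ∉ V →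
      ∑ w, Uv c' w ≤ 6 ^ 6 * (Q * s * (q * (ε * P))) := fun c' hc' =>
    sum_halfWt_le (F := fun w r => if ∃ i, (w i).1 ∈ V then r else 0)
      (fun w g => by split_ifs <;> simp) (by positivity)
      fun τ => t.sum_hookWt_visit_le hcard hb hc'
  have hterm : ∀ c' : Literal n, ∑ y' : Fin (k + 1) → Literal n, ∑ z' : Fin (k + 1) → Literal n,
      (if c'.1 ∈ V then U c' y' * U c'.neg z' else Uv c' y' * U c'.neg z' + U c' y' * Uv c'.neg z')
      ≤ if c'.1 ∈ V then (6 ^ 6 * (Q * s * (ε * P))) * (6 ^ 6 * (Q * s * (ε * P)))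
        else 2 * ((6 ^ 6 * (Q * s * (q * (ε * P)))) * (6 ^ 6 * (Q * s * (q * P)))) := by
    intro c'
    by_cases hc' : c'.1 ∈ V
    · simp only [hc', if_true]
      rw [← Finset.sum_mul_sum]
      exact mul_le_mul (hA c' hc') (hA c'.neg hc')
        (Finset.sum_nonneg fun _ _ => hUnn _ _) (by positivity)
    · simp only [hc', if_false, Finset.sum_add_distrib]
      rw [← Finset.sum_mul_sum, ← Finset.sum_mul_sum]
      have e1 := mul_le_mul (hVis c' hc') (hFr c'.neg hc')
        (Finset.sum_nonneg fun _ _ => hUnn _ _) (by positivity)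
      have e2 := mul_le_mul (hFr c' hc') (hVis c'.neg hc')
        (Finset.sum_nonneg fun _ _ => hUvnn _ _) (by positivity)
      linarith
  have hpt : ∀ x ∈ (snakes n k).filter (fun x =>
      ¬ Disjoint V (snakeVars x.1 x.2.1 x.2.2)),
      (Measure.pi (fun _ : Literal n => ν)).real
        (goodEvent E c y z ∩ goodEvent E x.1 x.2.1 x.2.2) ≤
      (Measure.pi (fun _ : Literal n => ν)).real (goodEvent E c y z) *
        (if x.1.1 ∈ V then U x.1 x.2.1 * U x.1.neg x.2.2
          else Uv x.1 x.2.1 * U x.1.neg x.2.2 + U x.1 x.2.1 * Uv x.1.neg x.2.2) := by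
    rintro ⟨c', y', z'⟩ hx
    simp only [Finset.mem_filter, mem_snakes] at hx
    refine (h.real_goodEvent_inter_le hq1 hd hx.1).trans ?_
    refine mul_le_mul_of_nonneg_left ?_ measureReal_nonneg
    simp only
    split_ifs with hc'
    · exact le_rfl
    · obtain ⟨v, hv, hv'⟩ := Finset.not_disjoint_iff.1 hx.2
      simp only [snakeVars, Finset.mem_insert, Finset.mem_union, Finset.mem_image,
        Finset.mem_univ, true_and] at hv'
      have n1 := mul_nonneg (hUvnn c' y') (hUnn c'.neg z')
      have n2 := mul_nonneg (hUnn c' y') (hUvnn c'.neg z')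
      rcases hv' with rfl | ⟨i, rfl⟩ | ⟨i, rfl⟩
      · exact absurd hv hc'
      · have : Uv c' y' = U c' y' := if_pos ⟨i, hv⟩
        rw [this]
        linarith
      · have : Uv c'.neg z' = U c'.neg z' := if_pos ⟨i, hv⟩
        rw [this]
        linarith
  refine (Finset.sum_le_sum hpt).trans ?_
  rw [← Finset.mul_sum]
  refine mul_le_mul_of_nonneg_left ?_ measureReal_nonneg
  calc _ ≤ ∑ x : Literal n × (Fin (k + 1) → Literal n) × (Fin (k + 1) → Literal n),
        (if x.1.1 ∈ V then U x.1 x.2.1 * U x.1.neg x.2.2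
          else Uv x.1 x.2.1 * U x.1.neg x.2.2 + U x.1 x.2.1 * Uv x.1.neg x.2.2) := by
        refine Finset.sum_le_sum_of_subset_of_nonneg (Finset.subset_univ _) fun x _ _ => ?_
        have n1 := mul_nonneg (hUvnn x.1 x.2.1) (hUnn x.1.neg x.2.2)
        have n2 := mul_nonneg (hUnn x.1 x.2.1) (hUvnn x.1.neg x.2.2)
        have n3 := mul_nonneg (hUnn x.1 x.2.1) (hUnn x.1.neg x.2.2)
        split_ifs <;> linarith
    _ = ∑ c' : Literal n, ∑ y' : Fin (k + 1) → Literal n, ∑ z' : Fin (k + 1) → Literal n,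
        (if c'.1 ∈ V then U c' y' * U c'.neg z'
          else Uv c' y' * U c'.neg z' + U c' y' * Uv c'.neg z') := by
        rw [Fintype.sum_prod_type]
        refine Finset.sum_congr rfl fun c' _ => ?_
        rw [Fintype.sum_prod_type]
    _ ≤ ∑ c' : Literal n, if c'.1 ∈ V then
          (6 ^ 6 * (Q * s * (ε * P))) * (6 ^ 6 * (Q * s * (ε * P)))
        else 2 * ((6 ^ 6 * (Q * s * (q * (ε * P)))) * (6 ^ 6 * (Q * s * (q * P)))) :=
        Finset.sum_le_sum fun c' _ => hterm c'
    _ ≤ 2 * s * ((6 ^ 6 * (Q * s * (ε * P))) * (6 ^ 6 * (Q * s * (ε * P)))) +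
        2 * n * (2 * ((6 ^ 6 * (Q * s * (q * (ε * P)))) * (6 ^ 6 * (Q * s * (q * P))))) :=
        sum_ite_mem_le (by positivity) (by positivity) hcard
    _ = 2 * (6 ^ 6 * Q) ^ 2 * s ^ 2 * (ε * P ^ 2) * (s * ε + (2 * n * q) * q) := by ring
    _ ≤ 2 * (6 ^ 6 * Q) ^ 2 * s ^ 2 * (ε * P ^ 2) * (s * ε + (b * s) * ε) := by
        have e1 : b ≤ b * s := le_mul_of_one_le_right hb0 h1s
        have e2 : (2 * n * q) * q ≤ (b * s) * ε :=
          mul_le_mul (hb.trans e1) t.q_le_ε hq (by positivity)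
        gcongr
    _ = _ := by
        rw [hP, ← pow_mul]
        ring

/-- A bound for the probability that there is no snake. -/
lemma real_isSat_le (h : EdgeRel ν E p q) (hp0 : 0 < p) {C : ℝ}
    (hC : 1 ≤ C) (hqp : q ≤ C * p) (hsmall : (2 * (2 * k + 3)) ^ 2 * (C ^ 4 * q) ≤ 1 / 2)
    (hn : 2 * (2 * k + 3) ^ 2 ≤ n)
    (t : TransferBounds n k p q (2 * k + 3) D ε) (hb : 2 * n * q ≤ b) :
    (Measure.pi (fun _ : Literal n => ν)).real
      {ω | (relFormula fun l l' => E (ω l) (ω l')).IsSat} ≤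
      8 * (1 + b) * (6 ^ 6 * ((2 + 4 * b) * (1 + 4 * D))) ^ 2 * (2 * k + 3) ^ 3 * (ε ^ 2 / p) := by
  classical
  have hq := h.q_nonneg
  have hb0 : 0 ≤ b := le_trans (by positivity) hb
  have hD := t.D_nonneg
  have hq1 : q ≤ 1 := t.q_le_ε.trans t.ε_le_one
  set T := snakes n k with hT
  let G : Literal n × (Fin (k + 1) → Literal n) × (Fin (k + 1) → Literal n) →
    Set (Literal n → X) := fun x => goodEvent E x.1 x.2.1 x.2.2
  set P := Measure.pi (fun _ : Literal n => ν) with hP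
  set S₀ := 2 * (1 + b) * (6 ^ 6 * ((2 + 4 * b) * (1 + 4 * D))) ^ 2 * (2 * k + 3 : ℝ) ^ 3 *
          ε ^ 2 * (2 * n * p) ^ (2 * k) with hS₀
  have hS₀0 : 0 ≤ S₀ := by positivity
  set m := ∑ a ∈ T, P.real (G a) with hm
  have hmain := real_iInter_compl_mul_sq_le (P := P) T (G := G) (R := m * S₀)
    (fun a _ => h.measurableSet_goodEvent) (by
      rw [← hm, sq, hm, Finset.sum_mul_sum, ← hm, hm, Finset.sum_mul, ← Finset.sum_add_distrib]
      refine Finset.sum_le_sum fun a ha => ?_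
      rw [← Finset.sum_filter_add_sum_filter_not T (fun x =>
        Disjoint (snakeVars a.1 a.2.1 a.2.2) (snakeVars x.1 x.2.1 x.2.2))]
      refine add_le_add ?_ ?_
      · -- variable-disjoint snakes are independent
        calc _ = ∑ x ∈ T.filter (fun x =>
              Disjoint (snakeVars a.1 a.2.1 a.2.2) (snakeVars x.1 x.2.1 x.2.2)),
              P.real (G a) * P.real (G x) := by
              refine Finset.sum_congr rfl fun x hx => ?_
              refine real_inter_eq_mul_of_disjoint h.measurableSet_goodEvent
                h.measurableSet_goodEvent dep_goodEvent dep_goodEvent ?_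
              exact Finset.disjoint_product.2 (Or.inl (Finset.mem_filter.1 hx).2)
          _ ≤ _ := Finset.sum_le_sum_of_subset_of_nonneg (Finset.filter_subset _ _)
              fun x _ _ => mul_nonneg measureReal_nonneg measureReal_nonneg
      · exact h.sum_real_goodEvent_inter_le hq1 (mem_snakes.1 ha) t le_rfl hb)
  have hm0 : (2 * n * p) ^ (2 * k) * p / 4 ≤ m := by
    have h1 : ∀ a ∈ T, p ^ (2 * k + 4) / 2 ≤ P.real (G a) := fun a ha =>
      h.le_real_induced_snake (mem_snakes.1 ha) hC hqp hsmall
    have h2 : (T.card : ℝ) * (p ^ (2 * k + 4) / 2) ≤ m := by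
      rw [← nsmul_eq_mul]
      exact Finset.card_nsmul_le_sum _ _ _ h1
    refine le_trans ?_ h2
    have h3 : (1 : ℝ) ≤ (2 * n * p) ^ 3 := one_le_pow₀ t.one_le
    calc (2 * n * p) ^ (2 * k) * p / 4 ≤ (2 * n * p) ^ (2 * k) * (2 * n * p) ^ 3 * p / 4 := by
          gcongr
          exact le_mul_of_one_le_right (by positivity) h3
      _ = (2 * n : ℝ) ^ (2 * k + 3) / 2 * (p ^ (2 * k + 4) / 2) := by
          rw [← pow_add, mul_pow]
          ring
      _ ≤ _ := by
          gcongr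
          exact le_card_snakes hn
  have hlam : 0 < (2 * n * p) ^ (2 * k) := pow_pos (lt_of_lt_of_le one_pos t.one_le) _
  have hmpos : 0 < m := lt_of_lt_of_le (by positivity) hm0
  have hsub : {ω | (relFormula fun l l' => E (ω l) (ω l')).IsSat} ⊆ ⋂ a ∈ T, (G a)ᶜ := by
    intro ω hω
    simp only [Set.mem_iInter]
    intro a ha hωa
    exact not_isSat_of_snake (R := fun l l' => E (ω l) (ω l')) (mem_snakes.1 ha) hωa.1.1 hωa.1.2 hω
  refine (measureReal_mono hsub (measure_ne_top _ _)).trans ?_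
  have h5 : P.real (⋂ a ∈ T, (G a)ᶜ) ≤ S₀ / m := by
    rw [le_div_iff₀ hmpos]
    have : P.real (⋂ a ∈ T, (G a)ᶜ) * m * m ≤ S₀ * m := by nlinarith
    exact le_of_mul_le_mul_right this hmpos
  refine h5.trans ?_
  calc S₀ / m ≤ S₀ / ((2 * n * p) ^ (2 * k) * p / 4) := by gcongr
    _ = _ := by
        rw [hS₀]
        field_simp
        ring

end EdgeRel

end SecondMoment

/-! ### Unsatisfiability above the threshold -/

/-- A path length with `r ^ pathLength r n ≥ n`, logarithmic in `n`. -/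
noncomputable def pathLength (r : ℝ) (n : ℕ) : ℕ := ⌈Real.log n / Real.log r⌉₊ + 1

lemma le_pow_pathLength {r : ℝ} (hr : 1 < r) (n : ℕ) : (n : ℝ) ≤ r ^ pathLength r n := by
  rcases Nat.eq_zero_or_pos n with rfl | hn
  · simp only [Nat.cast_zero]
    positivity
  have hn' : (0 : ℝ) < n := by exact_mod_cast hn
  have hlog : 0 < Real.log r := Real.log_pos hr
  have h1 : Real.log n / Real.log r ≤ pathLength r n := by
    refine (Nat.le_ceil _).trans ?_
    simp [pathLength]
  rw [div_le_iff₀ hlog, ← Real.log_pow] at h1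
  exact (Real.log_le_log_iff hn' (by positivity)).1 h1

lemma tendsto_pathLength_pow_div {r : ℝ} (hr : 1 < r) :
    Tendsto (fun n : ℕ => (2 * (pathLength r n : ℝ) + 3) ^ 7 / n) atTop (𝓝 0) := by
  have hlog : 0 < Real.log r := Real.log_pos hr
  have h1 : Tendsto (fun n : ℕ => Real.log n ^ 7 / (n : ℝ)) atTop (𝓝 0) :=
    ((Real.isLittleO_pow_log_id_atTop (n := 7)).tendsto_div_nhds_zero).comp
      tendsto_natCast_atTop_atTop
  have h2 := h1.const_mul ((2 / Real.log r + 7) ^ 7)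
  rw [mul_zero] at h2
  refine squeeze_zero' (Eventually.of_forall fun n => by positivity) ?_ h2
  have h3 : ∀ᶠ n : ℕ in atTop, (1 : ℝ) ≤ Real.log n :=
    (Real.tendsto_log_atTop.comp tendsto_natCast_atTop_atTop).eventually_ge_atTop 1
  filter_upwards [h3] with n hn
  rw [← mul_div_assoc, ← mul_pow]
  gcongr
  have h4 : (⌈Real.log n / Real.log r⌉₊ : ℝ) < Real.log n / Real.log r + 1 :=
    Nat.ceil_lt_add_one (by positivity)
  simp only [pathLength]
  push_cast
  have h5 : (2 / Real.log r + 7) * Real.log n = 2 * (Real.log n / Real.log r) + 7 * Real.log n := by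
    ring
  linarith

section Supercritical

variable {X : Type*} [MeasurableSpace X] {ν : Measure X} [IsProbabilityMeasure ν]

/-- If the expected number of implications of a literal stays above one, and no point has more
than the order of `1 / n` as the probability of an edge, then the formula is unsatisfiable with high
probability: by the second moment method it contains a snake of logarithmic length. -/
theorem tendsto_isSat_zero {E : ℕ → X → X → Prop} {p q : ℕ → ℝ} {r C₀ : ℝ} (hr : 1 < r)
    (h : ∀ᶠ n in atTop, EdgeRel ν (E n) (p n) (q n))
    (hp : ∀ᶠ n : ℕ in atTop, r ≤ 2 * n * p n)
    (hq : ∀ᶠ n : ℕ in atTop, n * q n ≤ C₀) :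
    Tendsto (fun n : ℕ => (Measure.pi (fun _ : Literal n => ν)).real
      {ω | (relFormula fun l l' => E n (ω l) (ω l')).IsSat}) atTop (𝓝 0) := by
  have hC₀ : 1 / 2 ≤ C₀ := by
    obtain ⟨n, hn, hpn, hqn⟩ := (h.and (hp.and hq)).exists
    have : (n : ℝ) * p n ≤ n * q n := mul_le_mul_of_nonneg_left hn.p_le_q (Nat.cast_nonneg _)
    linarith
  -- `D` solves `2 * C₀ + D = D * r`, and `2 * n * q n ≤ 2 * C₀`
  set D := 2 * C₀ / (r - 1) with hD
  have hr1 : 0 < r - 1 := by linarith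
  have hD0 : 0 ≤ D := by positivity
  have hlim := tendsto_pathLength_pow_div hr
  have hev : ∀ δ > 0, ∀ᶠ n : ℕ in atTop, (2 * (pathLength r n : ℝ) + 3) ^ 7 / n ≤ δ :=
    fun δ hδ => (hlim.eventually_lt_const hδ).mono fun _ h => h.le
  set K := 8 * (1 + 2 * C₀) * (6 ^ 6 * ((2 + 4 * (2 * C₀)) * (1 + 4 * D))) ^ 2 with hK
  have hlim2 := hlim.const_mul (K * (2 * C₀ * C₀))
  rw [mul_zero] at hlim2
  refine squeeze_zero' (Eventually.of_forall fun n => measureReal_nonneg) ?_ hlim2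
  filter_upwards [h, hp, hq, eventually_gt_atTop 0,
    hev (1 / 2) (by norm_num), hev (1 / C₀) (by positivity),
    hev (1 / (2 * C₀ * (D + 1))) (by positivity),
    hev (1 / (8 * (2 * C₀) ^ 4 * C₀)) (by positivity)] with n hn hpn hqn hn0 e1 e2 e3 e4
  have hn' : (0 : ℝ) < n := by exact_mod_cast hn0
  set k := pathLength r n with hk
  have hk1 : (1 : ℝ) ≤ k := by
    simp [hk, pathLength]
  set s : ℝ := 2 * k + 3 with hs
  have hs1 : 1 ≤ s := by linarith
  have hks : 2 * k ≤ s := by linarith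
  have hsn : s ^ 2 / n ≤ s ^ 7 / n := by
    gcongr
    norm_num
  have hq0 := hn.q_nonneg
  have hpq := hn.p_le_q
  have hp0 : 0 < p n := by
    by_contra hcon
    have : (2 * n : ℝ) * p n ≤ 0 := mul_nonpos_of_nonneg_of_nonpos (by positivity) (not_lt.1 hcon)
    linarith
  have hqdiv : q n ≤ C₀ / n := by
    rw [le_div_iff₀ hn']
    linarith
  have hqp : q n ≤ 2 * C₀ * p n := by
    refine hqdiv.trans ?_
    rw [div_le_iff₀ hn']
    nlinarith
  set ε := k * (2 * s * q n) with hε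
  have hε0 : 0 ≤ ε := by positivity
  have hεs : ε ≤ C₀ * (s ^ 7 / n) := by
    calc ε = 2 * k * s * q n := by rw [hε]; ring
      _ ≤ s * s * (C₀ / n) := by gcongr
      _ = C₀ * (s ^ 2 / n) := by ring
      _ ≤ _ := by gcongr
  have hqε : q n ≤ ε := by
    have : 1 * (2 * 1 * q n) ≤ ε := by rw [hε]; gcongr
    linarith
  have t : TransferBounds n k (p n) (q n) (2 * k + 3) D ε :=
    { p_nonneg := hp0.le
      q_nonneg := hq0
      one_le_s := hs1
      D_nonneg := hD0
      one_le := hr.le.trans hpn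
      le_D := by
        have h1 : D * (r - 1) = 2 * C₀ := by rw [hD]; field_simp
        have h2 : D * r ≤ D * (2 * n * p n) := by gcongr
        linarith
      le_ε := le_rfl
      ε_mul_D := by
        have : ε ≤ C₀ * (1 / (2 * C₀ * (D + 1))) := hεs.trans (by gcongr)
        have h1 : C₀ * (1 / (2 * C₀ * (D + 1))) = 1 / (2 * (D + 1)) := by field_simp
        rw [h1] at this
        calc ε * D ≤ 1 / (2 * (D + 1)) * D := by gcongr
          _ ≤ 1 / 2 := by
            rw [div_mul_eq_mul_div, div_le_div_iff₀ (by positivity) (by norm_num)]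
            linarith
      ε_le_one := by
        refine hεs.trans ?_
        calc C₀ * (s ^ 7 / n) ≤ C₀ * (1 / C₀) := by gcongr
          _ = 1 := by field_simp
      q_le_ε := hqε
      one_le_mul := by
        have h1 : (n : ℝ) ≤ (2 * n * p n) ^ k :=
          (le_pow_pathLength hr n).trans (pow_le_pow_left₀ (by linarith) hpn _)
        have h2 : 2 * p n ≤ ε := by
          have : 1 * (2 * 1 * p n) ≤ ε := by rw [hε]; gcongr
          linarith
        calc (1 : ℝ) ≤ 2 * p n * n := by linarith
          _ ≤ _ := by gcongr }
  refine (hn.real_isSat_le hp0 (C := 2 * C₀) (by linarith) hqp ?_ ?_ t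
    (b := 2 * C₀) (by linarith)).trans ?_
  · have h1 : (2 * s) ^ 2 * ((2 * C₀) ^ 4 * q n) ≤ 4 * (2 * C₀) ^ 4 * C₀ * (s ^ 7 / n) := by
      calc (2 * s) ^ 2 * ((2 * C₀) ^ 4 * q n) ≤ (2 * s) ^ 2 * ((2 * C₀) ^ 4 * (C₀ / n)) := by
            gcongr
        _ = 4 * (2 * C₀) ^ 4 * C₀ * (s ^ 2 / n) := by ring
        _ ≤ _ := by gcongr
    refine h1.trans ?_
    calc 4 * (2 * C₀) ^ 4 * C₀ * (s ^ 7 / n)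
        ≤ 4 * (2 * C₀) ^ 4 * C₀ * (1 / (8 * (2 * C₀) ^ 4 * C₀)) := by gcongr
      _ = 1 / 2 := by field_simp; norm_num
  · have h1 := hsn.trans e1
    rw [div_le_iff₀ hn'] at h1
    have h2 : (2 : ℝ) * (2 * k + 3) ^ 2 ≤ n := by linarith
    exact_mod_cast h2
  · have h1 : ε ^ 2 / p n ≤ 2 * C₀ * C₀ * (s ^ 4 / n) := by
      rw [div_le_iff₀ hp0]
      calc ε ^ 2 = (2 * k * s) ^ 2 * (q n * q n) := by rw [hε]; ring
        _ ≤ (s * s) ^ 2 * (C₀ / n * (2 * C₀ * p n)) := by gcongr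
        _ = _ := by ring
    have hK0 : 0 ≤ K := by positivity
    calc K * s ^ 3 * (ε ^ 2 / p n) ≤ K * s ^ 3 * (2 * C₀ * C₀ * (s ^ 4 / n)) := by gcongr
      _ = _ := by ring

end Supercritical

/-! ### Balls of the cube -/

section Cube

variable {d : ℕ}

lemma volume_closedBall_unitInterval_le (x : unitInterval) (r : ℝ) :
    volume (Metric.closedBall x r) ≤ ENNReal.ofReal (2 * r) := by
  rw [unitInterval.volume_apply]
  calc volume (Subtype.val '' Metric.closedBall x r)
      ≤ volume (Metric.closedBall (x : ℝ) r) := by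
        refine measure_mono ?_
        rintro _ ⟨y, hy, rfl⟩
        exact hy
    _ = _ := Real.volume_closedBall _ _

lemma volume_closedBall_unitInterval_eq {x : unitInterval} {r : ℝ} (h0 : r ≤ x)
    (h1 : (x : ℝ) ≤ 1 - r) : volume (Metric.closedBall x r) = ENNReal.ofReal (2 * r) := by
  rw [unitInterval.volume_apply, ← Real.volume_closedBall (x : ℝ) r]
  congr 1
  ext y
  constructor
  · rintro ⟨y, hy, rfl⟩
    exact hy
  · intro hy
    have h := hy
    rw [Metric.mem_closedBall, Real.dist_eq, abs_le] at h
    exact ⟨⟨y, by linarith, by linarith⟩, hy, rfl⟩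

lemma real_volume_closedBall_le {r : ℝ} (hr : 0 ≤ r) (x : Cube d) :
    (volume : Measure (Cube d)).real {y | dist x y ≤ r} ≤ (2 * r) ^ d := by
  have e : {y | dist x y ≤ r} = Metric.closedBall x r := by
    ext y
    simp [dist_comm]
  have h : volume (Metric.closedBall x r) ≤ ENNReal.ofReal ((2 * r) ^ d) := by
    rw [volume_pi_closedBall x hr, ENNReal.ofReal_pow (by positivity)]
    calc _ ≤ ∏ _i : Fin d, ENNReal.ofReal (2 * r) :=
          Finset.prod_le_prod' fun i _ => volume_closedBall_unitInterval_le _ _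
      _ = _ := by simp
  rw [e]
  exact ENNReal.toReal_le_of_le_ofReal (by positivity) h

/-- The probability that two uniform points of the cube are close: it is at least that of the
first point keeping the distance `r` from the boundary, times the volume of a full ball. -/
lemma le_real_prod_dist_le {r : ℝ} (hr : 0 ≤ r) (hr' : r ≤ 1 / 2) :
    (1 - 2 * r) ^ d * (2 * r) ^ d ≤ ((volume : Measure (Cube d)).prod volume).real
      {z : Cube d × Cube d | dist z.1 z.2 ≤ r} := by
  have hmeas : MeasurableSet {z : Cube d × Cube d | dist z.1 z.2 ≤ r} :=
    measurableSet_le (measurable_fst.dist measurable_snd) measurable_const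
  let a : unitInterval := ⟨r, hr, by linarith⟩
  let b : unitInterval := ⟨1 - r, by linarith, by linarith⟩
  let S : Set (Cube d) := Set.pi Set.univ fun _ => Set.Icc a b
  have hS : MeasurableSet S := MeasurableSet.univ_pi fun _ => measurableSet_Icc
  have hvol : volume S = ENNReal.ofReal ((1 - 2 * r) ^ d) := by
    rw [volume_pi_pi, ENNReal.ofReal_pow (by linarith)]
    simp only [unitInterval.volume_Icc, Finset.prod_const, Finset.card_univ, Fintype.card_fin, a, b]
    congr 2
    ring
  have hball : ∀ x ∈ S, volume {y | dist x y ≤ r} = ENNReal.ofReal ((2 * r) ^ d) := by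
    intro x hx
    have e : {y | dist x y ≤ r} = Metric.closedBall x r := by
      ext y
      simp [dist_comm]
    rw [e, volume_pi_closedBall x hr, ENNReal.ofReal_pow (by positivity)]
    rw [Finset.prod_congr rfl fun i _ => volume_closedBall_unitInterval_eq (x := x i) (r := r)
      (hx i trivial).1 (hx i trivial).2]
    simp
  have key : ENNReal.ofReal ((1 - 2 * r) ^ d * (2 * r) ^ d) ≤
      ((volume : Measure (Cube d)).prod volume) {z : Cube d × Cube d | dist z.1 z.2 ≤ r} := by
    rw [Measure.prod_apply hmeas, ENNReal.ofReal_mul (pow_nonneg (by linarith) _), ← hvol,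
      mul_comm, ← setLIntegral_const]
    refine (setLIntegral_mono' hS fun x hx => ?_).trans (setLIntegral_le_lintegral S _)
    exact (hball x hx).ge
  rw [measureReal_def]
  exact (ENNReal.ofReal_le_iff_le_toReal (measure_ne_top _ _)).1 key

end Cube

/-! ### The radius -/

lemma scale_nonneg (d n : ℕ) : 0 ≤ scale d n := Real.rpow_nonneg (Nat.cast_nonneg _) _

lemma scale_pow {d n : ℕ} (hd : 1 ≤ d) : scale d n ^ d = 1 / n := by
  have hd' : (d : ℝ) ≠ 0 := by positivity
  rw [scale, ← Real.rpow_natCast, ← Real.rpow_mul (Nat.cast_nonneg _)]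
  rw [show -(1 / (d : ℝ)) * d = -1 by field_simp, Real.rpow_neg_one, one_div]

lemma tendsto_scale {d : ℕ} (hd : 1 ≤ d) : Tendsto (scale d) atTop (𝓝 0) := by
  have hd' : (0 : ℝ) < 1 / (d : ℝ) := by positivity
  exact (tendsto_rpow_neg_atTop hd').comp tendsto_natCast_atTop_atTop

/-- The threshold of the uniform model. -/
lemma two_rpow_pow {d : ℕ} (hd : 1 ≤ d) : 2 * (2 * (2 : ℝ) ^ (-(1 + 1 / (d : ℝ)))) ^ d = 1 := by
  have hd' : (d : ℝ) ≠ 0 := by positivity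
  have e : 2 * (2 : ℝ) ^ (-(1 + 1 / (d : ℝ))) = 2 ^ (-(1 / (d : ℝ))) := by
    nth_rewrite 1 [← Real.rpow_one 2]
    rw [← Real.rpow_add two_pos]
    congr 1
    ring
  rw [e, ← Real.rpow_natCast, ← Real.rpow_mul two_pos.le,
    show -(1 / (d : ℝ)) * d = -1 by field_simp, Real.rpow_neg_one]
  norm_num

/-- The threshold of the Poisson model. -/
lemma two_pow_mul_rpow_sq (d : ℕ) : (2 : ℝ) ^ (d + 1) * ((2 : ℝ) ^ (-(((d : ℝ) + 1) / 2))) ^ 2 =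
    1 := by
  rw [← Real.rpow_natCast, ← Real.rpow_natCast, ← Real.rpow_mul two_pos.le,
    ← Real.rpow_add two_pos]
  push_cast
  rw [show (d : ℝ) + 1 + -(((d : ℝ) + 1) / 2) * 2 = 0 by ring, Real.rpow_zero]

/-- If the outer measures of the complements tend to zero, then the probabilities tend to one. -/
lemma tendsto_measure_one {Ω : ℕ → Type*} [∀ n, MeasurableSpace (Ω n)] {P : ∀ n, Measure (Ω n)}
    [∀ n, IsProbabilityMeasure (P n)] {A : ∀ n, Set (Ω n)}
    (h : Tendsto (fun n => (P n).real (A n)ᶜ) atTop (𝓝 0)) :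
    Tendsto (fun n => P n (A n)) atTop (𝓝 1) := by
  have h1 : Tendsto (fun n => P n (A n)ᶜ) atTop (𝓝 0) := by
    rw [← ENNReal.ofReal_zero]
    refine (ENNReal.tendsto_ofReal h).congr fun n => ?_
    exact ENNReal.ofReal_toReal (measure_ne_top _ _)
  have h2 : Tendsto (fun n => 1 - P n (A n)ᶜ) atTop (𝓝 1) := by
    simpa using ENNReal.Tendsto.sub (tendsto_const_nhds (x := (1 : ℝ≥0∞))) h1 (by simp)
  refine tendsto_of_tendsto_of_tendsto_of_le_of_le h2 tendsto_const_nhds (fun n => ?_)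
    fun n => prob_le_one
  rw [tsub_le_iff_right, ← measure_univ (μ := P n), ← Set.union_compl_self (A n)]
  exact measure_union_le _ _

/-! ### The model with one uniform point for each literal -/

section Uniform

variable {d : ℕ}

lemma edgeRel_uniform {r : ℝ} (hr : 0 ≤ r) :
    EdgeRel (volume : Measure (Cube d)) (fun x y => dist x y ≤ r)
      (((volume : Measure (Cube d)).prod volume).real {z : Cube d × Cube d | dist z.1 z.2 ≤ r})
      ((2 * r) ^ d) where
  meas := measurableSet_le (measurable_fst.dist measurable_snd) measurable_const
  symm x y h := by rwa [dist_comm]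
  le_q x := real_volume_closedBall_le hr x
  eq_p := rfl

lemma uniformFormula_eq {n : ℕ} (γ : ℝ) (X : Literal n → Cube d) :
    uniformFormula γ X = relFormula fun l l' => dist (X l) (X l') ≤ γ * scale d n := by
  simp [uniformFormula, geomFormula, relFormula]

lemma two_mul_scale_pow (hd : 1 ≤ d) (γ : ℝ) (n : ℕ) :
    (2 * (γ * scale d n)) ^ d = (2 * γ) ^ d / n := by
  rw [← mul_assoc, mul_pow, scale_pow hd]
  ring

/-- Below the threshold `2 (2γ) ^ d = 1`. -/
lemma tendsto_uniform_not_isSat (hd : 1 ≤ d) {γ : ℝ} (hγ : 0 ≤ γ) (h : 2 * (2 * γ) ^ d < 1) :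
    Tendsto (fun n : ℕ => (uniformLaw d n).real {X | ¬ (uniformFormula γ X).IsSat}) atTop
      (𝓝 0) := by
  have hE : ∀ n, EdgeRel (volume : Measure (Cube d)) (fun x y => dist x y ≤ γ * scale d n)
      (((volume : Measure (Cube d)).prod volume).real
        {z : Cube d × Cube d | dist z.1 z.2 ≤ γ * scale d n}) ((2 * (γ * scale d n)) ^ d) :=
    fun n => edgeRel_uniform (mul_nonneg hγ (scale_nonneg d n))
  have key := tendsto_not_isSat_zero h (Eventually.of_forall hE) ?_ ?_
  · simp only [uniformFormula_eq]
    exact key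
  · filter_upwards [eventually_gt_atTop 0] with n hn
    have hn' : (0 : ℝ) < n := by exact_mod_cast hn
    have hpq := (edgeRel_uniform (d := d) (mul_nonneg hγ (scale_nonneg d n))).p_le_q
    rw [two_mul_scale_pow hd] at hpq
    calc _ ≤ 2 * n * ((2 * γ) ^ d / n) := by gcongr
      _ = _ := by field_simp
  · have h1 : Tendsto (fun n : ℕ => ((2 * γ) ^ d) ^ 2 * (1 / (n : ℝ))) atTop (𝓝 0) := by
      simpa only [mul_zero] using
        (tendsto_one_div_atTop_nhds_zero_nat (𝕜 := ℝ)).const_mul (((2 * γ) ^ d) ^ 2)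
    refine h1.congr' ?_
    filter_upwards [eventually_gt_atTop 0] with n hn
    have hn' : (0 : ℝ) < n := by exact_mod_cast hn
    rw [two_mul_scale_pow hd]
    field_simp

/-- Above the threshold `2 (2γ) ^ d = 1`; the loss at the boundary of the cube vanishes as the
radius tends to zero. -/
lemma tendsto_uniform_isSat (hd : 1 ≤ d) {γ : ℝ} (hγ : 0 ≤ γ) (h : 1 < 2 * (2 * γ) ^ d) :
    Tendsto (fun n : ℕ => (uniformLaw d n).real {X | (uniformFormula γ X).IsSat}) atTop
      (𝓝 0) := by
  have hE : ∀ n, EdgeRel (volume : Measure (Cube d)) (fun x y => dist x y ≤ γ * scale d n)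
      (((volume : Measure (Cube d)).prod volume).real
        {z : Cube d × Cube d | dist z.1 z.2 ≤ γ * scale d n}) ((2 * (γ * scale d n)) ^ d) :=
    fun n => edgeRel_uniform (mul_nonneg hγ (scale_nonneg d n))
  have hlim : Tendsto (fun n : ℕ => 2 * (2 * γ) ^ d * (1 - 2 * (γ * scale d n)) ^ d) atTop
      (𝓝 (2 * (2 * γ) ^ d * (1 - 2 * (γ * 0)) ^ d)) :=
    ((tendsto_const_nhds.sub (((tendsto_scale hd).const_mul γ).const_mul 2)).pow d).const_mul _
  have hlim2 : Tendsto (fun n : ℕ => γ * scale d n) atTop (𝓝 (γ * 0)) :=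
    (tendsto_scale hd).const_mul γ
  simp only [mul_zero, sub_zero, one_pow, mul_one] at hlim hlim2
  have key := tendsto_isSat_zero (r := (1 + 2 * (2 * γ) ^ d) / 2) (C₀ := (2 * γ) ^ d)
    (by linarith) (Eventually.of_forall hE) ?_ ?_
  · simp only [uniformFormula_eq]
    exact key
  · filter_upwards [eventually_gt_atTop 0, hlim.eventually_const_lt
      (show (1 + 2 * (2 * γ) ^ d) / 2 < _ by linarith),
      hlim2.eventually_lt_const (show (0 : ℝ) < 1 / 2 by norm_num)] with n hn h1 h2
    have hn' : (0 : ℝ) < n := by exact_mod_cast hn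
    have h3 := le_real_prod_dist_le (d := d) (mul_nonneg hγ (scale_nonneg d n)) h2.le
    rw [two_mul_scale_pow hd] at h3
    calc _ ≤ 2 * (2 * γ) ^ d * (1 - 2 * (γ * scale d n)) ^ d := h1.le
      _ = 2 * n * ((1 - 2 * (γ * scale d n)) ^ d * ((2 * γ) ^ d / n)) := by field_simp
      _ ≤ _ := by gcongr
  · filter_upwards [eventually_gt_atTop 0] with n hn
    have hn' : (0 : ℝ) < n := by exact_mod_cast hn
    rw [two_mul_scale_pow hd]
    exact le_of_eq (by field_simp)

end Uniform

/-! ### Relations between random clusters of points -/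

/-- A Bonferroni inequality with a uniform bound on the pairwise intersections. -/
lemma sum_real_sub_le_real_biUnion {Ω κ : Type*} [MeasurableSpace Ω] {P : Measure Ω}
    [IsFiniteMeasure P] {F : κ → Set Ω} (hF : ∀ t, MeasurableSet (F t)) {w : ℝ}
    (hw : ∀ s t, s ≠ t → P.real (F s ∩ F t) ≤ w) (hw0 : 0 ≤ w) (I : Finset κ) :
    ∑ t ∈ I, P.real (F t) - (I.card : ℝ) ^ 2 * w ≤ P.real (⋃ t ∈ I, F t) := by
  classical
  induction I using Finset.induction_on with
  | empty => simp
  | insert a I ha ih =>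
    rw [Finset.sum_insert ha, Finset.card_insert_of_notMem ha, Finset.set_biUnion_insert]
    have h1 := measureReal_union_add_inter (μ := P) (s := F a)
      (Finset.measurableSet_biUnion I fun t _ => hF t) (measure_ne_top _ _) (measure_ne_top _ _)
    have h2 : P.real (F a ∩ ⋃ t ∈ I, F t) ≤ I.card * w := by
      rw [Set.inter_iUnion₂]
      refine (measureReal_biUnion_finset_le I _).trans ?_
      rw [← nsmul_eq_mul]
      refine Finset.sum_le_card_nsmul _ _ _ fun t ht => hw a t ?_
      rintro rfl
      exact ha ht
    push_cast
    nlinarith [mul_nonneg (Nat.cast_nonneg (α := ℝ) I.card) hw0]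

section Cluster

set_option linter.unusedSectionVars false

variable {X : Type*} [MeasurableSpace X] {D : X → X → Prop} {K : ℕ}

/-- Two clusters of points (a cluster consists of a number `m` and of the first `m` terms of a
sequence of points) of size at most `K` are related if some point of the first one is related to
some point of the second one. -/
def clusterRel (D : X → X → Prop) (K : ℕ) (x y : ℕ × (ℕ → X)) : Prop :=
  x.1 ≤ K ∧ y.1 ≤ K ∧ ∃ i < x.1, ∃ j < y.1, D (x.2 i) (y.2 j)

/-- The `i`-th term of the first sequence is related to the `j`-th term of the second one. -/
def termRel (D : X → X → Prop) (t : ℕ × ℕ) : Set ((ℕ → X) × (ℕ → X)) :=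
  {w | D (w.1 t.1) (w.2 t.2)}

/-- The event that the first `a` terms of the first sequence and the first `b` terms of the second
one are related somewhere. -/
def clusterEvent (D : X → X → Prop) (a b : ℕ) : Set ((ℕ → X) × (ℕ → X)) :=
  ⋃ t ∈ Finset.range a ×ˢ Finset.range b, termRel D t

lemma mem_clusterEvent {a b : ℕ} {w : (ℕ → X) × (ℕ → X)} :
    w ∈ clusterEvent D a b ↔ ∃ i < a, ∃ j < b, D (w.1 i) (w.2 j) := by
  simp only [clusterEvent, termRel, Set.mem_iUnion, Finset.mem_product, Finset.mem_range,
    Set.mem_ofPred_eq, Prod.exists, exists_prop]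
  exact ⟨fun ⟨i, j, ⟨hi, hj⟩, h⟩ => ⟨i, hi, j, hj, h⟩, fun ⟨i, hi, j, hj, h⟩ => ⟨i, j, ⟨hi, hj⟩, h⟩⟩

lemma measurableSet_termRel (hD : MeasurableSet {z : X × X | D z.1 z.2}) (t : ℕ × ℕ) :
    MeasurableSet (termRel D t) := by
  have hm : Measurable fun w : (ℕ → X) × (ℕ → X) => (w.1 t.1, w.2 t.2) :=
    ((measurable_pi_apply _).comp measurable_fst).prodMk
      ((measurable_pi_apply _).comp measurable_snd)
  exact hm hD

lemma measurableSet_clusterEvent (hD : MeasurableSet {z : X × X | D z.1 z.2}) (a b : ℕ) :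
    MeasurableSet (clusterEvent D a b) :=
  Finset.measurableSet_biUnion _ fun t _ => measurableSet_termRel hD t

/-- The event that two random clusters have the sizes `t.1` and `t.2` and are related. -/
def sizedClusterEvent (D : X → X → Prop) (t : ℕ × ℕ) :
    Set ((ℕ × (ℕ → X)) × (ℕ × (ℕ → X))) :=
  {z | z.1.1 = t.1 ∧ z.2.1 = t.2 ∧ (z.1.2, z.2.2) ∈ clusterEvent D t.1 t.2}

lemma measurableSet_sizedClusterEvent (hD : MeasurableSet {z : X × X | D z.1 z.2}) (t : ℕ × ℕ) :
    MeasurableSet (sizedClusterEvent D t) := by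
  have hm : Measurable fun z : (ℕ × (ℕ → X)) × (ℕ × (ℕ → X)) => (z.1.2, z.2.2) := by fun_prop
  have h1 : Measurable fun z : (ℕ × (ℕ → X)) × (ℕ × (ℕ → X)) => z.1.1 := by fun_prop
  have h2 : Measurable fun z : (ℕ × (ℕ → X)) × (ℕ × (ℕ → X)) => z.2.1 := by fun_prop
  exact (h1 (measurableSet_singleton t.1)).inter
    ((h2 (measurableSet_singleton t.2)).inter (hm (measurableSet_clusterEvent hD t.1 t.2)))

lemma setOf_clusterRel (D : X → X → Prop) (K : ℕ) :
    {z : (ℕ × (ℕ → X)) × (ℕ × (ℕ → X)) | clusterRel D K z.1 z.2} =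
      ⋃ t ∈ Finset.range (K + 1) ×ˢ Finset.range (K + 1), sizedClusterEvent D t := by
  ext z
  simp only [clusterRel, sizedClusterEvent, mem_clusterEvent, Set.mem_iUnion, Finset.mem_product,
    Finset.mem_range, Set.mem_ofPred_eq, Prod.exists, exists_prop, Nat.lt_succ_iff]
  constructor
  · rintro ⟨h1, h2, h⟩
    exact ⟨_, _, ⟨h1, h2⟩, rfl, rfl, h⟩
  · rintro ⟨a, b, ⟨h1, h2⟩, rfl, rfl, h⟩
    exact ⟨h1, h2, h⟩

variable {ν : Measure X} [IsProbabilityMeasure ν] {p v : ℝ}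

/-- The law of a sequence of independent points. -/
noncomputable abbrev seqLaw (ν : Measure X) [IsProbabilityMeasure ν] : Measure (ℕ → X) :=
  Measure.infinitePi fun _ => ν

lemma real_seqLaw_le (h : EdgeRel ν D p v) (x : X) (j : ℕ) :
    (seqLaw ν).real {g | D x (g j)} ≤ v := by
  have hm : MeasurableSet {y | D x y} := measurable_prodMk_left h.meas
  have := (measurePreserving_eval_infinitePi (fun _ : ℕ => ν) j).measureReal_preimage
    hm.nullMeasurableSet
  exact this.le.trans (h.le_q x)

lemma real_termRel (h : EdgeRel ν D p v) (t : ℕ × ℕ) :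
    ((seqLaw ν).prod (seqLaw ν)).real (termRel D t) = p := by
  have hmp := (measurePreserving_eval_infinitePi (fun _ : ℕ => ν) t.1).prod
    (measurePreserving_eval_infinitePi (fun _ : ℕ => ν) t.2)
  rw [← h.eq_p]
  exact hmp.measureReal_preimage h.meas.nullMeasurableSet

lemma real_seqLaw_inter_le (h : EdgeRel ν D p v) (x x' : X) {j j' : ℕ} (hj : j ≠ j') :
    (seqLaw ν).real {g | D x (g j) ∧ D x' (g j')} ≤ v ^ 2 := by
  have hm : ∀ x, MeasurableSet {y | D x y} := fun x => measurable_prodMk_left h.meas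
  let t : ℕ → Set X := fun i => if i = j then {y | D x y} else {y | D x' y}
  have e : {g : ℕ → X | D x (g j) ∧ D x' (g j')} = Set.pi (({j, j'} : Finset ℕ) : Set ℕ) t := by
    ext g
    simp [t, hj.symm]
  rw [measureReal_def, e, Measure.infinitePi_pi, Finset.prod_pair hj, ENNReal.toReal_mul, sq]
  · simp only [t, if_true, if_neg hj.symm]
    exact mul_le_mul (h.le_q x) (h.le_q x') ENNReal.toReal_nonneg
      (ENNReal.toReal_nonneg.trans (h.le_q x))
  · intro i _
    simp only [t]
    split_ifs
    exacts [hm x, hm x']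

lemma real_termRel_inter_le_of_snd_ne (h : EdgeRel ν D p v) {s t : ℕ × ℕ} (hst : s.2 ≠ t.2) :
    ((seqLaw ν).prod (seqLaw ν)).real (termRel D s ∩ termRel D t) ≤ v ^ 2 := by
  have hm := (measurableSet_termRel h.meas s).inter (measurableSet_termRel h.meas t)
  refine ENNReal.toReal_le_of_le_ofReal (sq_nonneg v) ?_
  rw [Measure.prod_apply hm]
  calc _ ≤ ∫⁻ _, ENNReal.ofReal (v ^ 2) ∂(seqLaw ν) := by
        refine lintegral_mono fun f => ?_
        rw [← ENNReal.ofReal_toReal (measure_ne_top (seqLaw ν) _)]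
        exact ENNReal.ofReal_le_ofReal (real_seqLaw_inter_le h (f s.1) (f t.1) hst)
    _ = _ := by simp

/-- Two different pairs of terms are both related with probability at most `v ^ 2`, also if the
pairs share a term. -/
lemma real_termRel_inter_le (h : EdgeRel ν D p v) {s t : ℕ × ℕ} (hst : s ≠ t) :
    ((seqLaw ν).prod (seqLaw ν)).real (termRel D s ∩ termRel D t) ≤ v ^ 2 := by
  by_cases h2 : s.2 = t.2
  · have h1 : s.1 ≠ t.1 := fun h1 => hst (Prod.ext h1 h2)
    have hm := (measurableSet_termRel h.meas s).inter (measurableSet_termRel h.meas t)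
    rw [← (Measure.measurePreserving_swap (μ := seqLaw ν)
      (ν := seqLaw ν)).measureReal_preimage hm.nullMeasurableSet]
    refine (measureReal_mono ?_).trans
      (real_termRel_inter_le_of_snd_ne h (s := s.swap) (t := t.swap) h1)
    rintro w ⟨hs, ht⟩
    exact ⟨h.symm _ _ hs, h.symm _ _ ht⟩
  · exact real_termRel_inter_le_of_snd_ne h h2

lemma real_clusterEvent_le (h : EdgeRel ν D p v) (a b : ℕ) :
    ((seqLaw ν).prod (seqLaw ν)).real (clusterEvent D a b) ≤ a * b * p := by
  refine (measureReal_biUnion_finset_le _ _).trans (le_of_eq ?_)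
  simp [real_termRel h]

lemma le_real_clusterEvent (h : EdgeRel ν D p v) (a b : ℕ) :
    a * b * p - (a * b : ℝ) ^ 2 * v ^ 2 ≤
      ((seqLaw ν).prod (seqLaw ν)).real (clusterEvent D a b) := by
  have := sum_real_sub_le_real_biUnion (measurableSet_termRel h.meas)
    (fun s t hst => real_termRel_inter_le h hst) (sq_nonneg v) (Finset.range a ×ˢ Finset.range b)
  simpa [real_termRel h, clusterEvent] using this

variable {π : Measure ℕ} [IsProbabilityMeasure π]

/-- The sizes of two random clusters are independent of their points. -/
lemma real_sizedClusterEvent (hD : MeasurableSet {z : X × X | D z.1 z.2}) (t : ℕ × ℕ) :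
    ((π.prod (seqLaw ν)).prod (π.prod (seqLaw ν))).real (sizedClusterEvent D t) =
      π.real {t.1} * π.real {t.2} *
        ((seqLaw ν).prod (seqLaw ν)).real (clusterEvent D t.1 t.2) := by
  have hm := measurableSet_clusterEvent hD t.1 t.2
  simp only [measureReal_def, ← ENNReal.toReal_mul]
  congr 1
  rw [Measure.prod_apply (measurableSet_sizedClusterEvent hD t), Measure.prod_apply hm]
  have h1 : ∀ x : ℕ × (ℕ → X), (π.prod (seqLaw ν)) (Prod.mk x ⁻¹' sizedClusterEvent D t) =
      ({t.1} : Set ℕ).indicator (fun _ => π {t.2}) x.1 *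
        seqLaw ν (Prod.mk x.2 ⁻¹' clusterEvent D t.1 t.2) := by
    intro x
    by_cases hx : x.1 = t.1
    · have e : Prod.mk x ⁻¹' sizedClusterEvent D t =
          {t.2} ×ˢ (Prod.mk x.2 ⁻¹' clusterEvent D t.1 t.2) := by
        ext y
        simp [sizedClusterEvent, hx]
      rw [e, Measure.prod_prod]
      simp [hx]
    · have e : Prod.mk x ⁻¹' sizedClusterEvent D t = ∅ := by
        ext y
        simp [sizedClusterEvent, hx]
      simp [e, hx]
  simp only [h1]
  rw [lintegral_prod_mul (f := ({t.1} : Set ℕ).indicator fun _ => π {t.2})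
    (g := fun f => seqLaw ν (Prod.mk f ⁻¹' clusterEvent D t.1 t.2)) (by fun_prop)
    (measurable_measure_prodMk_left hm).aemeasurable,
    lintegral_indicator (measurableSet_singleton _), setLIntegral_const, mul_comm (π {t.2})]

/-- The mean of the size of a random cluster truncated at `K`. -/
noncomputable def truncMean (π : Measure ℕ) (K : ℕ) : ℝ :=
  ∑ a ∈ Finset.range (K + 1), a * π.real {a}

lemma truncMean_nonneg (π : Measure ℕ) (K : ℕ) : 0 ≤ truncMean π K :=
  Finset.sum_nonneg fun _ _ => by positivity

lemma real_clusterRel_eq (hD : MeasurableSet {z : X × X | D z.1 z.2}) (K : ℕ) :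
    ((π.prod (seqLaw ν)).prod (π.prod (seqLaw ν))).real
        {z : (ℕ × (ℕ → X)) × (ℕ × (ℕ → X)) | clusterRel D K z.1 z.2} =
      ∑ a ∈ Finset.range (K + 1), ∑ b ∈ Finset.range (K + 1), π.real {a} * π.real {b} *
        ((seqLaw ν).prod (seqLaw ν)).real (clusterEvent D a b) := by
  rw [setOf_clusterRel, measureReal_biUnion_finset _
    fun t _ => measurableSet_sizedClusterEvent hD t, Finset.sum_product]
  · simp only [real_sizedClusterEvent hD]
  · intro s _ t _ hst
    refine Set.disjoint_left.2 fun z hs ht => hst (Prod.ext ?_ ?_)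
    · exact hs.1.symm.trans ht.1
    · exact hs.2.1.symm.trans ht.2.1

lemma truncMean_sq (π : Measure ℕ) (K : ℕ) : truncMean π K ^ 2 =
    ∑ a ∈ Finset.range (K + 1), ∑ b ∈ Finset.range (K + 1),
      π.real {a} * π.real {b} * (a * b) := by
  rw [sq, truncMean, Finset.sum_mul_sum]
  exact Finset.sum_congr rfl fun a _ => Finset.sum_congr rfl fun b _ => by ring

lemma real_clusterRel_le (h : EdgeRel ν D p v) (K : ℕ) :
    ((π.prod (seqLaw ν)).prod (π.prod (seqLaw ν))).real
        {z : (ℕ × (ℕ → X)) × (ℕ × (ℕ → X)) | clusterRel D K z.1 z.2} ≤ truncMean π K ^ 2 * p := by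
  rw [real_clusterRel_eq h.meas, truncMean_sq, Finset.sum_mul]
  refine Finset.sum_le_sum fun a _ => ?_
  rw [Finset.sum_mul]
  refine Finset.sum_le_sum fun b _ => ?_
  rw [mul_assoc (π.real {a} * π.real {b})]
  gcongr
  exact real_clusterEvent_le h a b

lemma le_real_clusterRel (h : EdgeRel ν D p v) (K : ℕ) :
    truncMean π K ^ 2 * p - K ^ 4 * v ^ 2 ≤
      ((π.prod (seqLaw ν)).prod (π.prod (seqLaw ν))).real
        {z : (ℕ × (ℕ → X)) × (ℕ × (ℕ → X)) | clusterRel D K z.1 z.2} := by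
  have hsum : ∑ a ∈ Finset.range (K + 1), π.real {a} ≤ 1 := by
    rw [← measureReal_biUnion_finset (fun a _ b _ hab => by simpa using hab)
      fun a _ => measurableSet_singleton a]
    exact measureReal_le_one
  have h0 : ∀ a, 0 ≤ π.real {a} := fun a => measureReal_nonneg
  have hsum0 : 0 ≤ ∑ a ∈ Finset.range (K + 1), π.real {a} := Finset.sum_nonneg fun a _ => h0 a
  have hsq : ∑ a ∈ Finset.range (K + 1), ∑ b ∈ Finset.range (K + 1),
      π.real {a} * π.real {b} ≤ 1 := by
    rw [← Finset.sum_mul_sum]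
    exact mul_le_one₀ hsum hsum0 hsum
  have hw : 0 ≤ (K : ℝ) ^ 4 * v ^ 2 := by positivity
  calc truncMean π K ^ 2 * p - K ^ 4 * v ^ 2
      ≤ truncMean π K ^ 2 * p - (∑ a ∈ Finset.range (K + 1), ∑ b ∈ Finset.range (K + 1),
        π.real {a} * π.real {b}) * (K ^ 4 * v ^ 2) := by nlinarith
    _ = ∑ a ∈ Finset.range (K + 1), ∑ b ∈ Finset.range (K + 1),
        π.real {a} * π.real {b} * (a * b * p - K ^ 4 * v ^ 2) := by
      rw [truncMean_sq, Finset.sum_mul, Finset.sum_mul, ← Finset.sum_sub_distrib]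
      refine Finset.sum_congr rfl fun a _ => ?_
      rw [Finset.sum_mul, Finset.sum_mul, ← Finset.sum_sub_distrib]
      exact Finset.sum_congr rfl fun b _ => by ring
    _ ≤ _ := by
      rw [real_clusterRel_eq h.meas]
      refine Finset.sum_le_sum fun a ha => Finset.sum_le_sum fun b hb => ?_
      refine mul_le_mul_of_nonneg_left ?_ (mul_nonneg (h0 a) (h0 b))
      refine le_trans ?_ (le_real_clusterEvent h a b)
      have ha' : (a : ℝ) ≤ K := by exact_mod_cast Nat.lt_succ_iff.1 (Finset.mem_range.1 ha)
      have hb' : (b : ℝ) ≤ K := by exact_mod_cast Nat.lt_succ_iff.1 (Finset.mem_range.1 hb)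
      have hab : (a * b : ℝ) ^ 2 ≤ K ^ 4 := by
        calc (a * b : ℝ) ^ 2 ≤ (K * K) ^ 2 := by gcongr
          _ = _ := by ring
      gcongr

/-- Random clusters of bounded size form an edge relation. -/
lemma edgeRel_cluster (h : EdgeRel ν D p v) (K : ℕ) :
    EdgeRel (π.prod (seqLaw ν)) (clusterRel D K)
      (((π.prod (seqLaw ν)).prod (π.prod (seqLaw ν))).real
        {z : (ℕ × (ℕ → X)) × (ℕ × (ℕ → X)) | clusterRel D K z.1 z.2}) (K ^ 2 * v) where
  meas := by
    rw [setOf_clusterRel]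
    exact Finset.measurableSet_biUnion _ fun t _ => measurableSet_sizedClusterEvent h.meas t
  symm := by
    rintro x y ⟨hx, hy, i, hi, j, hj, hd⟩
    exact ⟨hy, hx, j, hj, i, hi, h.symm _ _ hd⟩
  le_q x := by
    calc (π.prod (seqLaw ν)).real {y | clusterRel D K x y}
        ≤ (π.prod (seqLaw ν)).real
          (⋃ t ∈ Finset.range K ×ˢ Finset.range K, {y | D (x.2 t.1) (y.2 t.2)}) := by
          refine measureReal_mono ?_ (measure_ne_top _ _)
          rintro y ⟨hx, hy, i, hi, j, hj, hd⟩
          simp only [Set.mem_iUnion]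
          exact ⟨(i, j), Finset.mem_product.2
            ⟨Finset.mem_range.2 (hi.trans_le hx), Finset.mem_range.2 (hj.trans_le hy)⟩, hd⟩
      _ ≤ ∑ _t ∈ Finset.range K ×ˢ Finset.range K, v := by
          refine (measureReal_biUnion_finset_le _ _).trans (Finset.sum_le_sum fun t _ => ?_)
          have e : {y : ℕ × (ℕ → X) | D (x.2 t.1) (y.2 t.2)} =
              Set.univ ×ˢ {g : ℕ → X | D (x.2 t.1) (g t.2)} := by
            ext y
            simp
          rw [e, measureReal_prod_prod, probReal_univ, one_mul]
          exact real_seqLaw_le h _ _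
      _ = _ := by
          simp [sq]
  eq_p := rfl

end Cluster

/-! ### The Poisson model -/

section Poisson

variable {d : ℕ} {μ : ℝ≥0}

lemma hasSum_mul_poissonMeasure (μ : ℝ≥0) :
    HasSum (fun a : ℕ => a * (poissonMeasure μ).real {a}) (μ : ℝ) := by
  have h1 := (hasSum_one_poissonMeasure μ).mul_left (μ : ℝ)
  rw [mul_one] at h1
  have h2 : HasSum (fun a : ℕ => ((a + 1 : ℕ) : ℝ) * (poissonMeasure μ).real {a + 1}) (μ : ℝ) := by
    refine h1.congr_fun fun a => ?_
    rw [poissonMeasure_real_singleton, Nat.factorial_succ]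
    have : (a.factorial : ℝ) ≠ 0 := by positivity
    push_cast
    field_simp
    ring
  simpa using (hasSum_nat_add_iff (f := fun a : ℕ => (a : ℝ) * (poissonMeasure μ).real {a}) 1).1 h2

lemma tendsto_truncMean (μ : ℝ≥0) :
    Tendsto (truncMean (poissonMeasure μ)) atTop (𝓝 (μ : ℝ)) :=
  (tendsto_add_atTop_iff_nat 1).2 (hasSum_mul_poissonMeasure μ).tendsto_sum_nat

lemma truncMean_le (μ : ℝ≥0) (K : ℕ) : truncMean (poissonMeasure μ) K ≤ μ :=
  sum_le_hasSum _ (fun _ _ => by positivity) (hasSum_mul_poissonMeasure μ)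

/-- The tail of the Poisson distribution decays exponentially, by Markov's inequality for the
second power moment generating function. -/
lemma exists_real_poissonMeasure_gt_le (μ : ℝ≥0) :
    ∃ C : ℝ, ∀ K : ℕ, (poissonMeasure μ).real {a | K < a} ≤ C / 2 ^ K := by
  have hint : Integrable (fun a : ℕ => (2 : ℝ) ^ a) (poissonMeasure μ) := by
    rw [integrable_poissonMeasure_iff]
    refine ((Real.summable_pow_div_factorial (2 * μ)).mul_left (Real.exp (-μ))).congr fun a => ?_
    rw [Real.norm_of_nonneg (by positivity), mul_pow]
    ring
  refine ⟨∫ a, (2 : ℝ) ^ a ∂(poissonMeasure μ), fun K => ?_⟩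
  rw [le_div_iff₀' (by positivity)]
  refine le_trans ?_ (mul_meas_ge_le_integral_of_nonneg
    (Eventually.of_forall fun a => by positivity) hint ((2 : ℝ) ^ K))
  refine mul_le_mul_of_nonneg_left (measureReal_mono ?_) (by positivity)
  intro a ha
  exact pow_le_pow_right₀ (one_le_two (α := ℝ)) (le_of_lt ha)

instance (d : ℕ) (μ : ℝ≥0) : IsProbabilityMeasure (poissonProcessLaw d μ) := by
  unfold poissonProcessLaw
  infer_instance

instance (d n : ℕ) (μ : ℝ≥0) : IsProbabilityMeasure (poissonLaw d n μ) := by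
  unfold poissonLaw
  infer_instance

lemma poissonFormula_eq {n : ℕ} (ω : Literal n → PoissonSample d) :
    poissonFormula ω = relFormula fun l l' =>
      ∃ x ∈ (ω l).points, ∃ y ∈ (ω l').points, dist x y ≤ scale d n := rfl

lemma relFormula_clusterRel_isSat_of_poissonFormula {n : ℕ} (K : ℕ)
    (ω : Literal n → PoissonSample d) (h : (poissonFormula ω).IsSat) :
    (relFormula fun l l' =>
      clusterRel (fun x y : Cube d => dist x y ≤ scale d n) K (ω l) (ω l')).IsSat := by
  rw [poissonFormula_eq] at h
  refine relFormula_mono (fun l l' => ?_) h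
  rintro ⟨-, -, i, hi, j, hj, hd⟩
  exact ⟨_, ⟨i, hi, rfl⟩, _, ⟨j, hj, rfl⟩, hd⟩

lemma poissonFormula_isSat_of_clusterRel {n : ℕ} (K : ℕ)
    (ω : Literal n → PoissonSample d) (hK : ∀ l, (ω l).1 ≤ K)
    (h : (relFormula fun l l' =>
      clusterRel (fun x y : Cube d => dist x y ≤ scale d n) K (ω l) (ω l')).IsSat) :
    (poissonFormula ω).IsSat := by
  rw [poissonFormula_eq]
  refine relFormula_mono (fun l l' => ?_) h
  rintro ⟨_, ⟨i, hi, rfl⟩, _, ⟨j, hj, rfl⟩, hd⟩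
  exact ⟨hK l, hK l', i, hi, j, hj, hd⟩

lemma real_exists_size_gt_le {n : ℕ} (K : ℕ) :
    (poissonLaw d n μ).real {ω | ∃ l, K < (ω l).1} ≤
      2 * n * (poissonMeasure μ).real {a | K < a} := by
  have e : {ω : Literal n → PoissonSample d | ∃ l, K < (ω l).1} =
      ⋃ l ∈ (Finset.univ : Finset (Literal n)), {ω | K < (ω l).1} := by
    ext ω
    simp
  have h1 : ∀ l : Literal n, (poissonLaw d n μ).real {ω | K < (ω l).1} =
      (poissonMeasure μ).real {a | K < a} := by
    intro l
    have hmp : MeasurePreserving (fun ω : Literal n → PoissonSample d => (ω l).1)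
        (poissonLaw d n μ) (poissonMeasure μ) :=
      (measurePreserving_fst (μ := poissonMeasure μ)
        (ν := Measure.infinitePi fun _ : ℕ => (volume : Measure (Cube d)))).comp
        (measurePreserving_eval (fun _ : Literal n => poissonProcessLaw d μ) l)
    exact hmp.measureReal_preimage (MeasurableSet.of_discrete (s := {a | K < a})).nullMeasurableSet
  rw [e]
  refine (measureReal_biUnion_finset_le _ _).trans (le_of_eq ?_)
  simp only [h1, Finset.sum_const, Finset.card_univ, Fintype.card_prod, Fintype.card_fin,
    Fintype.card_bool, nsmul_eq_mul]
  push_cast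
  ring

/-- The closeness of two uniform points at the scale of the Poisson model. -/
lemma edgeRel_scale (hd : 1 ≤ d) (n : ℕ) :
    EdgeRel (volume : Measure (Cube d)) (fun x y => dist x y ≤ scale d n)
      (((volume : Measure (Cube d)).prod volume).real
        {z : Cube d × Cube d | dist z.1 z.2 ≤ scale d n}) (2 ^ d / n) := by
  have h := edgeRel_uniform (d := d) (scale_nonneg d n)
  rwa [mul_pow, scale_pow hd, mul_one_div] at h

/-- Below the threshold `2 ^ (d + 1) * μ ^ 2 = 1`. With high probability no process has more than
`K n` points, where `K n` is logarithmic in `n`. -/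
lemma tendsto_poisson_not_isSat (hd : 1 ≤ d) (h : 2 ^ (d + 1) * (μ : ℝ) ^ 2 < 1) :
    Tendsto (fun n : ℕ => (poissonLaw d n μ).real {ω | ¬ (poissonFormula ω).IsSat}) atTop
      (𝓝 0) := by
  let K : ℕ → ℕ := fun n => 2 * pathLength 2 n
  have key := tendsto_not_isSat_zero h
    (Eventually.of_forall fun n => edgeRel_cluster (π := poissonMeasure μ)
      (edgeRel_scale hd n) (K n)) ?_ ?_
  · obtain ⟨C, hC⟩ := exists_real_poissonMeasure_gt_le μ
    have hlim : Tendsto (fun n : ℕ => 2 * C * (1 / (n : ℝ))) atTop (𝓝 0) := by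
      simpa only [mul_zero] using (tendsto_one_div_atTop_nhds_zero_nat (𝕜 := ℝ)).const_mul (2 * C)
    have hsum := key.add hlim
    rw [add_zero] at hsum
    refine squeeze_zero' (Eventually.of_forall fun n => measureReal_nonneg) ?_ hsum
    filter_upwards [eventually_gt_atTop 0] with n hn
    have hn' : (0 : ℝ) < n := by exact_mod_cast hn
    have hC0 : 0 ≤ C := by simpa using measureReal_nonneg.trans (hC 0)
    have hsub : {ω : Literal n → PoissonSample d | ¬ (poissonFormula ω).IsSat} ⊆
        {ω | ¬ (relFormula fun l l' =>
          clusterRel (fun x y : Cube d => dist x y ≤ scale d n) (K n) (ω l) (ω l')).IsSat} ∪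
        {ω | ∃ l, K n < (ω l).1} := by
      intro ω hω
      by_cases hK : ∃ l, K n < (ω l).1
      · exact Or.inr hK
      · push Not at hK
        exact Or.inl fun hs => hω (poissonFormula_isSat_of_clusterRel _ ω hK hs)
    refine (measureReal_mono hsub).trans ((measureReal_union_le _ _).trans ?_)
    refine add_le_add le_rfl ((real_exists_size_gt_le (K n)).trans ?_)
    calc 2 * n * (poissonMeasure μ).real {a | K n < a} ≤ 2 * n * (C / 2 ^ K n) := by
          gcongr
          exact hC _
      _ ≤ 2 * n * (C / (n : ℝ) ^ 2) := by
          gcongr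
          simp only [K]
          rw [mul_comm 2 (pathLength 2 n), pow_mul]
          gcongr
          exact le_pow_pathLength one_lt_two n
      _ = 2 * C * (1 / n) := by field_simp
  · filter_upwards [eventually_gt_atTop 0] with n hn
    have hn' : (0 : ℝ) < n := by exact_mod_cast hn
    have h1 := real_clusterRel_le (π := poissonMeasure μ) (edgeRel_scale hd n) (K n)
    have h2 := (edgeRel_scale hd n).p_le_q
    have h3 := truncMean_le μ (K n)
    have h4 := truncMean_nonneg (poissonMeasure μ) (K n)
    calc _ ≤ 2 * n * ((μ : ℝ) ^ 2 * (2 ^ d / n)) := by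
          refine mul_le_mul_of_nonneg_left (h1.trans ?_) (by positivity)
          gcongr
      _ = _ := by
          field_simp
          ring
  · have hlim := (tendsto_pathLength_pow_div one_lt_two).const_mul ((2 ^ d) ^ 2 : ℝ)
    rw [mul_zero] at hlim
    refine squeeze_zero' (Eventually.of_forall fun n => by positivity) ?_ hlim
    filter_upwards [eventually_gt_atTop 0] with n hn
    have hn' : (0 : ℝ) < n := by exact_mod_cast hn
    have h1 : (K n : ℝ) ^ 4 ≤ (2 * (pathLength 2 n : ℝ) + 3) ^ 7 := by
      calc (K n : ℝ) ^ 4 ≤ (2 * (pathLength 2 n : ℝ) + 3) ^ 4 := by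
            simp only [K]
            push_cast
            gcongr
            linarith
        _ ≤ _ := pow_le_pow_right₀ (by linarith [Nat.cast_nonneg (α := ℝ) (pathLength 2 n)])
            (by norm_num)
    calc (n : ℝ) * ((K n : ℝ) ^ 2 * (2 ^ d / n)) ^ 2 = (2 ^ d) ^ 2 * (K n ^ 4 / n) := by
          field_simp
      _ ≤ _ := by gcongr

/-- Above the threshold `2 ^ (d + 1) * μ ^ 2 = 1`. Discarding the processes with more than a large
constant number of points leaves a subformula that is still above the threshold. -/
lemma tendsto_poisson_isSat (hd : 1 ≤ d) (h : 1 < 2 ^ (d + 1) * (μ : ℝ) ^ 2) :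
    Tendsto (fun n : ℕ => (poissonLaw d n μ).real {ω | (poissonFormula ω).IsSat}) atTop
      (𝓝 0) := by
  obtain ⟨K, hK⟩ : ∃ K, 1 < 2 ^ (d + 1) * truncMean (poissonMeasure μ) K ^ 2 :=
    ((((tendsto_truncMean μ).pow 2).const_mul (2 ^ (d + 1) : ℝ)).eventually_const_lt h).exists
  set m := truncMean (poissonMeasure μ) K with hm
  have hlim1 : Tendsto (fun n : ℕ => 2 ^ (d + 1) * m ^ 2 * (1 - 2 * scale d n) ^ d -
      2 * K ^ 4 * (2 ^ d) ^ 2 * (1 / (n : ℝ))) atTop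
      (𝓝 (2 ^ (d + 1) * m ^ 2 * (1 - 2 * 0) ^ d - 2 * K ^ 4 * (2 ^ d) ^ 2 * 0)) :=
    (((tendsto_const_nhds.sub ((tendsto_scale hd).const_mul 2)).pow d).const_mul _).sub
      (tendsto_one_div_atTop_nhds_zero_nat.const_mul _)
  simp only [mul_zero, sub_zero, one_pow, mul_one] at hlim1
  have key := tendsto_isSat_zero (r := (1 + 2 ^ (d + 1) * m ^ 2) / 2) (C₀ := K ^ 2 * 2 ^ d)
    (by linarith) (Eventually.of_forall fun n => edgeRel_cluster (π := poissonMeasure μ)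
      (edgeRel_scale hd n) K) ?_ ?_
  · refine squeeze_zero (fun n => measureReal_nonneg) (fun n => ?_) key
    exact measureReal_mono fun ω hω => relFormula_clusterRel_isSat_of_poissonFormula K ω hω
  · filter_upwards [eventually_gt_atTop 0, hlim1.eventually_const_lt
      (show (1 + 2 ^ (d + 1) * m ^ 2) / 2 < _ by linarith),
      (tendsto_scale hd).eventually_lt_const (show (0 : ℝ) < 1 / 2 by norm_num)] with n hn h1 h2
    have hn' : (0 : ℝ) < n := by exact_mod_cast hn
    have h3 := le_real_prod_dist_le (d := d) (scale_nonneg d n) h2.le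
    rw [mul_pow 2 (scale d n), scale_pow hd] at h3
    have h4 := le_real_clusterRel (π := poissonMeasure μ) (edgeRel_scale hd n) K
    rw [← hm] at h4
    calc _ ≤ _ := h1.le
      _ = 2 * n * (m ^ 2 * ((1 - 2 * scale d n) ^ d * (2 ^ d * (1 / n))) -
          K ^ 4 * (2 ^ d / n) ^ 2) := by
          field_simp
          ring
      _ ≤ _ := by
          refine mul_le_mul_of_nonneg_left (le_trans ?_ h4) (by positivity)
          gcongr
  · filter_upwards [eventually_gt_atTop 0] with n hn
    have hn' : (0 : ℝ) < n := by exact_mod_cast hn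
    exact le_of_eq (by field_simp)

end Poisson

instance (d n : ℕ) : IsProbabilityMeasure (uniformLaw d n) := by
  unfold uniformLaw
  infer_instance

end Geom2SAT

theorem theorem3 (d : ℕ) (hd : 1 ≤ d) (ε : ℝ) (hε : 0 < ε) :
    (∀ γ : ℝ, 0 ≤ γ →
      (γ < (2 : ℝ) ^ (-(1 + 1 / (d : ℝ))) - ε →
        Tendsto (fun n : ℕ => Geom2SAT.uniformLaw d n
          {X | (Geom2SAT.uniformFormula γ X).IsSat}) atTop (𝓝 1)) ∧
      (γ > (2 : ℝ) ^ (-(1 + 1 / (d : ℝ))) + ε →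
        Tendsto (fun n : ℕ => Geom2SAT.uniformLaw d n
          {X | ¬ (Geom2SAT.uniformFormula γ X).IsSat}) atTop (𝓝 1))) ∧
    (∀ μ : ℝ≥0,
      ((μ : ℝ) < (2 : ℝ) ^ (-(((d : ℝ) + 1) / 2)) - ε →
        Tendsto (fun n : ℕ => Geom2SAT.poissonLaw d n μ
          {ω | (Geom2SAT.poissonFormula ω).IsSat}) atTop (𝓝 1)) ∧
      ((μ : ℝ) > (2 : ℝ) ^ (-(((d : ℝ) + 1) / 2)) + ε →
        Tendsto (fun n : ℕ => Geom2SAT.poissonLaw d n μ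
          {ω | ¬ (Geom2SAT.poissonFormula ω).IsSat}) atTop (𝓝 1))) := by
  have hd0 : d ≠ 0 := by omega
  refine ⟨fun γ hγ => ⟨fun h => ?_, fun h => ?_⟩, fun μ => ⟨fun h => ?_, fun h => ?_⟩⟩
  · refine Geom2SAT.tendsto_measure_one (Geom2SAT.tendsto_uniform_not_isSat hd hγ ?_)
    rw [← Geom2SAT.two_rpow_pow hd]
    have : γ < (2 : ℝ) ^ (-(1 + 1 / (d : ℝ))) := by linarith
    gcongr
  · refine Geom2SAT.tendsto_measure_one ?_
    simp only [Set.compl_ofPred, not_not]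
    refine Geom2SAT.tendsto_uniform_isSat hd hγ ?_
    rw [← Geom2SAT.two_rpow_pow hd]
    have : (2 : ℝ) ^ (-(1 + 1 / (d : ℝ))) < γ := by linarith
    gcongr
  · refine Geom2SAT.tendsto_measure_one (Geom2SAT.tendsto_poisson_not_isSat hd ?_)
    rw [← Geom2SAT.two_pow_mul_rpow_sq d]
    have : (μ : ℝ) < (2 : ℝ) ^ (-(((d : ℝ) + 1) / 2)) := by linarith
    gcongr
  · refine Geom2SAT.tendsto_measure_one ?_
    simp only [Set.compl_ofPred, not_not]
    refine Geom2SAT.tendsto_poisson_isSat hd ?_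
    rw [← Geom2SAT.two_pow_mul_rpow_sq d]
    have : (2 : ℝ) ^ (-(((d : ℝ) + 1) / 2)) < μ := by linarith
    gcongr
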